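/- Let $\ell\ge 2$. For $A=(A_1,\dots,A_R)$ with $A_i\in\mathbb R^n$, let $U=A^{\odot \ell}$ be the $n^\ell\times R$ matrix with columns $A_i^{\otimes \ell}$. For tensors $X,Y$ of order $\ell$ put $\Phi(X,Y)=\Psi(X,Y)+\Psi(Y,X)$, where $$\Psi(X,Y)(i_1,\dots,i_\ell,j_1,\dots,j_\ell)=X_{i_1\dots i_{\ell-1}i_\ell}Y_{j_1\dots j_{\ell-1}j_\ell}-X_{i_1\dots i_{\ell-1}j_\ell}Y_{j_1\dots j_{\ell-1}i_\ell},$$ and let $M_\Phi$ be the $n^{2\ell}\times\binom R2$ matrix with columns $\Phi(A_i^{\otimes\ell},A_j^{\otimes\ell})$, $i<j$. The condition number of a matrix with $k\ge 1$ columns is $\sigma_1/\sigma_k$ (it is $\infty$ if $\sigma_k=0$), and it is $1$ if there are no columns. Let $\kappa_U,\kappa_M$ be the condition numbers of $U$ and $M_\Phi$. Algorithms are programs for a randomized real random access machine: integer registers with $+,\ \max(x-y,0),\ \times,\ <$; arrays of real numbers with exact $+,-,\times,/,<$, rational constants and $k$-th roots; independent $N(0,1)$ samples; all of these at unit cost;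 and the exact spectral decomposition of a real symmetric $d\times d$ matrix, at cost $d^3+1$. **Theorem.** There are a single randomized algorithm $\mathcal A$ and a polynomial $p$, and for every $\ell\ge2$ constants $c,c'>0$ depending only on $\ell$, such that the following holds for all $n,R$, all $A_1,\dots,A_R\in\mathbb R^n$ with $\kappa_U,\kappa_M<\infty$, all $\varepsilon>0$ and all $0<\gamma<1$. Let $$T=\sum_{i=1}^R A_i^{\otimes 2\ell}+\mathsf{Err},\qquad \|\mathsf{Err}\|_F\le \frac{\varepsilon^{c}}{(n\,\kappa_U\,\kappa_M)^{c'}} .$$ On input $(n,\ell,R,T,\varepsilon,\gamma)$, the algorithm $\mathcal A$ always halts after at most $p(\ell+n^\ell+\kappa_U+\kappa_M+\log(1/\gamma))$ steps, and with failure probability at most $\gamma$ it outputs vectors $B_1,\dots,B_R\in\mathbb R^n$ such that $$\min_{\pi\in S_R,\ s\in\{\pm1\}^R}\ \sum_{i=1}^R\|A_i-s_iB_{\pi(i)}\|\le\varepsilon .$$ (For $n\ge2$ the running time is $\mathrm{poly}(n^\ell,\kappa_U,\kappa_M,\log(1/\gamma))$, since $\ell\le n^\ell$.) -/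

import Mathlib

open MeasureTheory ProbabilityTheory
open scoped ENNReal

noncomputable section

/-! ### Tensors, the rank-one detector, condition numbers -/

/-- Order-`m` tensors with all modes of dimension `n`. -/
abbrev Tensor (m n : ℕ) : Type := (Fin m → Fin n) → ℝ

/-- The Frobenius norm of a tensor. -/
def frobNorm {m n : ℕ} (T : Tensor m n) : ℝ := Real.sqrt (∑ I, T I ^ 2)

/-- The tensor power `a^{⊗ m}`. -/
def tensorPow {n : ℕ} (m : ℕ) (a : EuclideanSpace ℝ (Fin n)) : Tensor m n :=
  fun I => ∏ s, a (I s)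

/-- The moment tensor `∑ r, (A r)^{⊗ m}`. -/
def momentTensor {n R : ℕ} (m : ℕ) (A : Fin R → EuclideanSpace ℝ (Fin n)) : Tensor m n :=
  fun I => ∑ r, tensorPow m (A r) I

/-- The multi-index `i` with its last entry replaced by the last entry of `j`. -/
def replaceLast {l n : ℕ} (i j : Fin l → Fin n) : Fin l → Fin n :=
  fun s => if s.val + 1 = l then j s else i s

/-- `Ψ(X, Y)(i, j) = X_i Y_j - X_{i'} Y_{j'}`, where `i', j'` are `i, j` with their last
entries exchanged; the `2l` indices are grouped as a pair of multi-indices of length `l`. -/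
def detectorPsi {l n : ℕ} (X Y : Tensor l n) (p : (Fin l → Fin n) × (Fin l → Fin n)) : ℝ :=
  X p.1 * Y p.2 - X (replaceLast p.1 p.2) * Y (replaceLast p.2 p.1)

/-- The rank-one detector `Φ(X, Y) = Ψ(X, Y) + Ψ(Y, X)`. -/
def detectorPhi {l n : ℕ} (X Y : Tensor l n) (p : (Fin l → Fin n) × (Fin l → Fin n)) : ℝ :=
  detectorPsi X Y p + detectorPsi Y X p

/-- The Khatri-Rao power `A^{⊙ l}`: its columns are the flattened tensors `(A r)^{⊗ l}`. -/
def khatriRaoPow {n R : ℕ} (l : ℕ) (A : Fin R → EuclideanSpace ℝ (Fin n)) :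
    Matrix (Fin l → Fin n) (Fin R) ℝ :=
  Matrix.of fun I r => tensorPow l (A r) I

/-- The matrix `M_Φ`, with one column `Φ((A i)^{⊗ l}, (A j)^{⊗ l})` for every pair `i < j`. -/
def detectorMatrix {n R : ℕ} (l : ℕ) (A : Fin R → EuclideanSpace ℝ (Fin n)) :
    Matrix ((Fin l → Fin n) × (Fin l → Fin n)) {q : Fin R × Fin R // q.1 < q.2} ℝ :=
  Matrix.of fun p q => detectorPhi (tensorPow l (A q.1.1)) (tensorPow l (A q.1.2)) p

/-- The condition number `σ_1 / σ_k` of a matrix with `k` columns: it is infinite if the columns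
are linearly dependent, and `1` by convention if there are no columns. (Mathlib numbers the
singular values from `0`, in decreasing order.) -/
def condNumber {ι κ : Type*} [Fintype ι] [Fintype κ] [DecidableEq κ] (M : Matrix ι κ ℝ) : ℝ≥0∞ :=
  if Fintype.card κ = 0 then 1
  else if M.toEuclideanLin.singularValues (Fintype.card κ - 1) = 0 then ⊤
  else ENNReal.ofReal
    (M.toEuclideanLin.singularValues 0 / M.toEuclideanLin.singularValues (Fintype.card κ - 1))

/-! ### Exact spectral decomposition -/

/-- The symmetric part `(M + Mᵀ) / 2`. -/
def symPart {d : ℕ} (M : Matrix (Fin d) (Fin d) ℝ) : Matrix (Fin d) (Fin d) ℝ :=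
  (2⁻¹ : ℝ) • (M + M.transpose)

theorem symPart_isSymmetric {d : ℕ} (M : Matrix (Fin d) (Fin d) ℝ) :
    (symPart M).toEuclideanLin.IsSymmetric := by
  rw [Matrix.isSymmetric_toEuclideanLin_iff]
  ext i j
  simp [symPart, mul_add, add_comm]

/-- The eigenvalues of the symmetric part of `M`, with multiplicity, in decreasing order. -/
def symEigenvalue {d : ℕ} (M : Matrix (Fin d) (Fin d) ℝ) (j : Fin d) : ℝ :=
  (symPart_isSymmetric M).eigenvalues finrank_euclideanSpace_fin j

/-- The `j`-th vector of an orthonormal basis of eigenvectors of the symmetric part of `M`,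
belonging to the eigenvalue `symEigenvalue M j`. -/
def symEigenvector {d : ℕ} (M : Matrix (Fin d) (Fin d) ℝ) (j : Fin d) :
    EuclideanSpace ℝ (Fin d) :=
  (symPart_isSymmetric M).eigenvectorBasis finrank_euclideanSpace_fin j

/-! ### A randomized real random access machine

A program is a finite text in a small imperative language. It has integer registers and arrays of
real numbers with exact arithmetic. One step is charged for every operation and every test;
the spectral decomposition of a `d × d` matrix is charged `d ^ 3 + 1` steps. -/

namespace RealRAM

/-- A memory state: integer registers, real arrays (array `a`, entry `p`), and the part of
the stream of random numbers which has not been read yet. -/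
structure State where
  nat : ℕ → ℕ
  real : ℕ → ℕ → ℝ
  tape : ℕ → ℝ

/-- Integer expressions. -/
inductive NExp where
  | const (k : ℕ)
  | var (x : ℕ)
  | add (e f : NExp)
  | sub (e f : NExp)
  | mul (e f : NExp)

/-- The value of an integer expression (subtraction is truncated at `0`). -/
def NExp.eval (s : State) : NExp → ℕ
  | .const k => k
  | .var x => s.nat x
  | .add e f => e.eval s + f.eval s
  | .sub e f => e.eval s - f.eval s
  | .mul e f => e.eval s * f.eval s

/-- The number of operations in an integer expression. -/
def NExp.cost : NExp → ℕ
  | .const _ => 1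
  | .var _ => 1
  | .add e f => e.cost + f.cost + 1
  | .sub e f => e.cost + f.cost + 1
  | .mul e f => e.cost + f.cost + 1

/-- Real expressions: rational constants, array entries, the four arithmetic operations,
and `k`-th roots. -/
inductive RExp where
  | const (q : ℚ)
  | get (a : ℕ) (i : NExp)
  | add (e f : RExp)
  | sub (e f : RExp)
  | mul (e f : RExp)
  | div (e f : RExp)
  | root (k : NExp) (e : RExp)

/-- The value of a real expression. Division by zero returns `0`, and the root of a negative
number is `0`. -/
def RExp.eval (s : State) : RExp → ℝ
  | .const q => (q : ℝ)
  | .get a i => s.real a (i.eval s)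
  | .add e f => e.eval s + f.eval s
  | .sub e f => e.eval s - f.eval s
  | .mul e f => e.eval s * f.eval s
  | .div e f => e.eval s / f.eval s
  | .root k e => (max (e.eval s) 0) ^ ((k.eval s : ℝ)⁻¹)

/-- The number of operations in a real expression. -/
def RExp.cost : RExp → ℕ
  | .const _ => 1
  | .get _ i => i.cost + 1
  | .add e f => e.cost + f.cost + 1
  | .sub e f => e.cost + f.cost + 1
  | .mul e f => e.cost + f.cost + 1
  | .div e f => e.cost + f.cost + 1
  | .root k e => k.cost + e.cost + 1

/-- Tests: exact comparison of integers or of reals. -/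
inductive Test where
  | nlt (e f : NExp)
  | rlt (e f : RExp)

/-- The test succeeds. -/
def Test.Holds (s : State) : Test → Prop
  | .nlt e f => e.eval s < f.eval s
  | .rlt e f => e.eval s < f.eval s

/-- The number of operations in a test. -/
def Test.cost : Test → ℕ
  | .nlt e f => e.cost + f.cost + 1
  | .rlt e f => e.cost + f.cost + 1

/-- Programs. -/
inductive Prog where
  /-- do nothing -/
  | skip
  /-- integer register `x := e` -/
  | setNat (x : ℕ) (e : NExp)
  /-- array entry `a[i] := e` -/
  | setReal (a : ℕ) (i : NExp) (e : RExp)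
  /-- array entry `a[i] :=` next random number -/
  | gauss (a : ℕ) (i : NExp)
  /-- spectral decomposition of the symmetric part of the `d × d` matrix stored in array `a`:
  eigenvalues are written to array `w` and eigenvectors to array `v` -/
  | eig (d : NExp) (a w v : ℕ)
  | seq (P Q : Prog)
  | ite (b : Test) (P Q : Prog)
  | while (b : Test) (P : Prog)

/-- Write a real number to entry `p` of array `a`. -/
def State.write (s : State) (a p : ℕ) (x : ℝ) : State :=
  { s with real := Function.update s.real a (Function.update (s.real a) p x) }

/-- The `d × d` matrix stored row by row in array `a`. -/
def State.readMatrix (s : State) (d a : ℕ) : Matrix (Fin d) (Fin d) ℝ :=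
  Matrix.of fun i j => s.real a (i.val * d + j.val)

/-- The `d` eigenvalues of the matrix in array `a`, in decreasing order, are written to the entries
`0, …, d - 1` of array `w`; coordinate `i` of the `j`-th eigenvector is written to entry
`i * d + j` of array `v`. -/
def State.eig (s : State) (d a w v : ℕ) : State :=
  { s with
    real := Function.update
      (Function.update s.real w
        (fun p => if h : p < d then symEigenvalue (s.readMatrix d a) ⟨p, h⟩ else s.real w p))
      v
      (fun p => if h : p / d < d ∧ p % d < d then
          symEigenvector (s.readMatrix d a) ⟨p % d, h.2⟩ ⟨p / d, h.1⟩ else s.real v p) }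

/-- `Exec P s s' t`: program `P`, started in state `s`, halts in state `s'` after exactly
`t` steps. -/
inductive Exec : Prog → State → State → ℕ → Prop
  | skip (s : State) : Exec .skip s s 1
  | setNat (s : State) (x : ℕ) (e : NExp) :
      Exec (.setNat x e) s { s with nat := Function.update s.nat x (e.eval s) } (e.cost + 1)
  | setReal (s : State) (a : ℕ) (i : NExp) (e : RExp) :
      Exec (.setReal a i e) s (s.write a (i.eval s) (e.eval s)) (i.cost + e.cost + 1)
  | gauss (s : State) (a : ℕ) (i : NExp) :
      Exec (.gauss a i) s
        { s.write a (i.eval s) (s.tape 0) with tape := fun k => s.tape (k + 1) } (i.cost + 1)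
  | eig (s : State) (d : NExp) (a w v : ℕ) :
      Exec (.eig d a w v) s (s.eig (d.eval s) a w v) (d.cost + (d.eval s ^ 3 + 1))
  | seq {P Q : Prog} {s₁ s₂ s₃ : State} {t₁ t₂ : ℕ} (hP : Exec P s₁ s₂ t₁)
      (hQ : Exec Q s₂ s₃ t₂) : Exec (.seq P Q) s₁ s₃ (t₁ + t₂)
  | iteTrue {b : Test} {P Q : Prog} {s₁ s₂ : State} {t : ℕ} (hb : b.Holds s₁)
      (hP : Exec P s₁ s₂ t) : Exec (.ite b P Q) s₁ s₂ (b.cost + t)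
  | iteFalse {b : Test} {P Q : Prog} {s₁ s₂ : State} {t : ℕ} (hb : ¬ b.Holds s₁)
      (hQ : Exec Q s₁ s₂ t) : Exec (.ite b P Q) s₁ s₂ (b.cost + t)
  | whileTrue {b : Test} {P : Prog} {s₁ s₂ s₃ : State} {t₁ t₂ : ℕ} (hb : b.Holds s₁)
      (hP : Exec P s₁ s₂ t₁) (hW : Exec (.while b P) s₂ s₃ t₂) :
      Exec (.while b P) s₁ s₃ (b.cost + t₁ + t₂)
  | whileFalse {b : Test} {P : Prog} {s : State} (hb : ¬ b.Holds s) :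
      Exec (.while b P) s s b.cost

/-- The law of the random stream: independent standard Gaussian numbers. -/
def gaussianTape : Measure (ℕ → ℝ) := Measure.infinitePi fun _ => gaussianReal 0 1

/-- The initial state for the input `(n, l, R, T, ε, γ)`: integer registers `0, 1, 2` hold
`n, l, R`; array `0` holds `T`, the entry of multi-index `I` at position `∑ s, I s * n ^ s`;
array `1` holds `ε, γ`; all other memory is `0`; the random stream is `ω`. -/
def initState {n l : ℕ} (R : ℕ) (T : Tensor (2 * l) n) (ε γ : ℝ) (ω : ℕ → ℝ) : State where
  nat := fun x => if x = 0 then n else if x = 1 then l else if x = 2 then R else 0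
  real := fun a p =>
    if a = 0 then
      if h : p < n ^ (2 * l) then T (finFunctionFinEquiv.symm ⟨p, h⟩) else 0
    else if a = 1 then (if p = 0 then ε else if p = 1 then γ else 0)
    else 0
  tape := ω

/-- The vectors `B_1, …, B_R ∈ ℝ^n` returned in a final state: coordinate `j` of the `i`-th
vector is read from entry `i * n + j` of array `2`. -/
def output (s : State) (n R : ℕ) (i : Fin R) : EuclideanSpace ℝ (Fin n) :=
  WithLp.toLp 2 fun j => s.real 2 (i.val * n + j.val)

end RealRAM

/-- `∑ i, ‖A_i - s_i B_{π(i)}‖ ≤ ε` for some permutation `π` and some signs `s_i = ±1`. -/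
def CloseUpToPermSign {n R : ℕ} (A B : Fin R → EuclideanSpace ℝ (Fin n)) (ε : ℝ) : Prop :=
  ∃ (π : Equiv.Perm (Fin R)) (s : Fin R → ℝ), (∀ i, s i = 1 ∨ s i = -1) ∧
    ∑ i, ‖A i - s i • B (π i)‖ ≤ ε

end

/-! Write u_r for the flattened tensor A_r^{⊗ℓ}. Regrouped as an n^ℓ × n^ℓ matrix, T equals ∑ u_r
u_rᵀ up to the error. Its R leading eigenvectors, scaled by the square roots of their eigenvalues,
are vectors w_k ≈ ∑_i q_i(k) u_i with a nearly orthonormal family q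
(`exists_nearly_orthogonal_coordinates`, `abs_inner_sub_ite_le_of_frame`). Thus the u_i are known up
to a nearly orthogonal matrix, and what remains is to find the q_i.

The detector does this. Since Φ(u_i, u_i) = 0 and the Φ(u_i, u_j) with i < j are quantitatively
independent, ∑ E_{kl} Φ(w_k, w_l) is small only when the symmetric part of E is nearly diagonal in
the family q. Such E are found as the last eigenvectors of the Gram matrix of the vectors Φ(w_k,
w_l). By `exists_separating_near_diagonal` their symmetric parts are nearly diagonalized by q, and
any two q_i are told apart by at least one of them. The number κ_M controls only a ratio of singular
values; the absolute scale comes from a closed formula for ‖Φ(a^{⊗ℓ}, b^{⊗ℓ})‖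
(`sum_detectorPhi_tensorPow_sq`, `le_norm_detectorBilin_sq`).

The joint diagonalization uses no random combination of these matrices. Each of them is cut at all
its spectral gaps larger than 1/R². A spectral projection at such a gap nearly fixes some q_i and
nearly kills the others, so products of projections isolate smaller and smaller classes of indices.
One pass starts from the identity and, at each gap, keeps a half which still contains a component
not yet found; this is decided by the sum of squared entries of a matrix product
(`half_lt_entrySq_iff`, `NearlyJointlyDiagonal.split`). After all matrices the class is a single
index i (`NearlyJointlyDiagonal.exists_single`), the product X is close to q_i q_iᵀ, and W X Wᵀ is
close to u_i u_iᵀ. Its largest diagonal entry and one slice give A_i up to sign (`abs_entry_sub_le`,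
`exists_sign_abs_sub_le`). R passes find all components.

No lower bound on the smallest singular value σ of U is given. If ‖T‖^{1/(2ℓ)} is below ε/(2R), the
zero vectors are an admissible answer (`sum_norm_le_of_small`). Otherwise ε is bounded in terms of
σ^{1/ℓ}, R and κ_U, and `budget` turns the assumed bound on the error into all the smallness
conditions needed. Dimensions n ≤ 1 are treated apart. No Gaussian number is ever read, so the
failure event is empty.

The machine part proves correctness and running time together, by a program logic whose time bounds
`timeBound S c` are closed under composition and loops. -/

noncomputable section

namespace RealRAM

/-! ### Program logic with time bounds -/

/-- Program `P`, started in `s`, halts within `B` steps in a state satisfying `Q`. -/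
def Runs (P : Prog) (s : State) (B : ℕ) (Q : State → Prop) : Prop :=
  ∃ s' t, Exec P s s' t ∧ t ≤ B ∧ Q s'

/-- A family of time bounds, polynomial in `S`, that is closed under sums and loops. -/
def timeBound (S c : ℕ) : ℕ := ((c + 1) * S) ^ (c + 1)

theorem timeBound_mono {S a b : ℕ} (hS : 1 ≤ S) (h : a ≤ b) : timeBound S a ≤ timeBound S b := by
  unfold timeBound
  calc ((a + 1) * S) ^ (a + 1) ≤ ((b + 1) * S) ^ (a + 1) := by gcongr
    _ ≤ ((b + 1) * S) ^ (b + 1) := by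
        apply Nat.pow_le_pow_right _ (by omega)
        exact Nat.mul_pos (by omega) hS

/-- Both summands are at most powers of x = (a + b + 2) S, and a sum of two numbers which are at
least 2 is at most their product. Hence adding times amounts to adding indices. -/
theorem timeBound_add {S a b : ℕ} (hS : 1 ≤ S) :
    timeBound S a + timeBound S b ≤ timeBound S (a + b + 1) := by
  unfold timeBound
  set x := (a + b + 1 + 1) * S with hx
  have h2 : 2 ≤ x := by nlinarith
  have ha : ((a + 1) * S) ^ (a + 1) ≤ x ^ (a + 1) := by rw [hx]; gcongr; omega
  have hb : ((b + 1) * S) ^ (b + 1) ≤ x ^ (b + 1) := by rw [hx]; gcongr; omega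
  have ha2 : 2 ≤ x ^ (a + 1) := h2.trans (Nat.le_self_pow (by omega) x)
  have hb2 : 2 ≤ x ^ (b + 1) := h2.trans (Nat.le_self_pow (by omega) x)
  have : x ^ (a + b + 1 + 1) = x ^ (a + 1) * x ^ (b + 1) := by rw [← pow_add]; congr 1; omega
  rw [this]
  nlinarith

theorem le_timeBound {S c : ℕ} (hS : 1 ≤ S) : c + 1 ≤ timeBound S c := by
  unfold timeBound
  calc c + 1 ≤ (c + 1) * S := Nat.le_mul_of_pos_right _ hS
    _ ≤ _ := Nat.le_self_pow (by omega) _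

theorem le_timeBound_of_le {S c x : ℕ} (hS : 1 ≤ S) (h : x ≤ c + 1) : x ≤ timeBound S c :=
  h.trans (le_timeBound hS)

/-- At most S repetitions cost one further factor S, which raising the exponent absorbs; the
overhead of the tests is a constant. So a loop shifts the index by a fixed amount, for which 100 is
generous. -/
theorem loop_le_timeBound {S a m q : ℕ} (hS : 1 ≤ S) (hm : m ≤ S) (hq : q ≤ 40) :
    m * (timeBound S a + q + 6) + q + 4 ≤ timeBound S (a + 100) := by
  have h1 : timeBound S a + 46 ≤ timeBound S (a + 46) := by
    have := timeBound_add (a := a) (b := 45) hS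
    have h2 := le_timeBound (c := 45) hS
    exact le_trans (by omega) (this.trans (timeBound_mono hS (by omega)))
  have h3 : S * timeBound S (a + 46) ≤ timeBound S (a + 47) := by
    unfold timeBound
    rw [pow_succ _ (a + 47), mul_comm]
    gcongr
    · omega
    · nlinarith
  have h4 := le_timeBound (c := 45) hS
  have h5 := timeBound_add (a := a + 47) (b := 45) hS
  calc _ ≤ S * timeBound S (a + 46) + 44 := by
        have : m * (timeBound S a + q + 6) ≤ S * timeBound S (a + 46) :=
          Nat.mul_le_mul hm (by omega)
        omega
    _ ≤ timeBound S (a + 47) + timeBound S 45 := by omega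
    _ ≤ _ := h5.trans (timeBound_mono hS (by omega))

theorem eig_le_timeBound {S d q : ℕ} (hS : 1 ≤ S) (hd : d ≤ S) (hq : q ≤ 40) :
    q + (d ^ 3 + 1) ≤ timeBound S 50 := by
  have h1 : d ^ 3 ≤ timeBound S 2 := by
    unfold timeBound
    exact Nat.pow_le_pow_left (by omega) 3
  have h2 := le_timeBound (c := 40) hS
  have h3 := timeBound_add (a := 2) (b := 40) hS
  have h4 := timeBound_mono (a := 2 + 40 + 1) (b := 50) hS (by omega)
  omega

theorem Runs.mono {P : Prog} {s : State} {B B' : ℕ} {Q Q' : State → Prop}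
    (h : Runs P s B Q) (hB : B ≤ B') (hQ : ∀ s', Q s' → Q' s') : Runs P s B' Q' := by
  obtain ⟨s', t, h1, h2, h3⟩ := h
  exact ⟨s', t, h1, h2.trans hB, hQ _ h3⟩

theorem Runs.imp {P : Prog} {s : State} {B : ℕ} {Q Q' : State → Prop}
    (h : Runs P s B Q) (hQ : ∀ s', Q s' → Q' s') : Runs P s B Q' := h.mono le_rfl hQ

theorem Runs.timeLe {P : Prog} {s : State} {S a b : ℕ} {Q : State → Prop} (hS : 1 ≤ S)
    (h : Runs P s (timeBound S a) Q) (hab : a ≤ b) : Runs P s (timeBound S b) Q :=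
  h.mono (timeBound_mono hS hab) fun _ => id

theorem Runs.skip {s : State} {S : ℕ} {Q : State → Prop} (hS : 1 ≤ S) (h : Q s) :
    Runs .skip s (timeBound S 0) Q :=
  ⟨_, _, .skip s, le_timeBound hS, h⟩

/-- The indices a, b, c are numerals for a concrete program, so all time estimates reduce to
comparisons of numerals in which S does not occur. -/
theorem Runs.seq {P P' : Prog} {s : State} {S a b c : ℕ} {Q Q' : State → Prop} (hS : 1 ≤ S)
    (h : Runs P s (timeBound S a) Q') (h' : ∀ s', Q' s' → Runs P' s' (timeBound S b) Q)
    (hc : a + b + 1 ≤ c) : Runs (.seq P P') s (timeBound S c) Q := by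
  obtain ⟨s', t, h1, h2, h3⟩ := h
  obtain ⟨s'', t', h1', h2', h3'⟩ := h' s' h3
  refine ⟨s'', _, .seq h1 h1', ?_, h3'⟩
  exact (add_le_add h2 h2').trans ((timeBound_add hS).trans (timeBound_mono hS hc))

theorem Runs.setNat {s : State} {S c : ℕ} {x : ℕ} {e : NExp} {Q : State → Prop} (hS : 1 ≤ S)
    (hc : e.cost ≤ c) (h : Q { s with nat := Function.update s.nat x (e.eval s) }) :
    Runs (.setNat x e) s (timeBound S c) Q :=
  ⟨_, _, .setNat s x e, le_timeBound_of_le hS (by omega), h⟩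

theorem Runs.setReal {s : State} {S c : ℕ} {a : ℕ} {i : NExp} {e : RExp} {Q : State → Prop}
    (hS : 1 ≤ S) (hc : i.cost + e.cost ≤ c) (h : Q (s.write a (i.eval s) (e.eval s))) :
    Runs (.setReal a i e) s (timeBound S c) Q :=
  ⟨_, _, .setReal s a i e, le_timeBound_of_le hS (by omega), h⟩

theorem Runs.eig {s : State} {S : ℕ} {d : NExp} {a w v : ℕ} {Q : State → Prop}
    (hS : 1 ≤ S) (hd : d.eval s ≤ S) (hc : d.cost ≤ 40) (h : Q (s.eig (d.eval s) a w v)) :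
    Runs (.eig d a w v) s (timeBound S 50) Q :=
  ⟨_, _, .eig s d a w v, eig_le_timeBound hS hd hc, h⟩

theorem Runs.ite {s : State} {S c c' : ℕ} {b : Test} {P P' : Prog} {Q : State → Prop}
    (hS : 1 ≤ S) (h1 : b.Holds s → Runs P s (timeBound S c) Q)
    (h2 : ¬ b.Holds s → Runs P' s (timeBound S c) Q) (hc : c + b.cost + 1 ≤ c') :
    Runs (.ite b P P') s (timeBound S c') Q := by
  have key : b.cost + timeBound S c ≤ timeBound S c' := by
    have := le_timeBound (c := b.cost) hS
    have h3 := timeBound_add (a := c) (b := b.cost) hS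
    have h4 := timeBound_mono hS hc
    omega
  by_cases hb : b.Holds s
  · obtain ⟨s', t, h3, h4, h5⟩ := h1 hb
    exact ⟨s', _, .iteTrue hb h3, by omega, h5⟩
  · obtain ⟨s', t, h3, h4, h5⟩ := h2 hb
    exact ⟨s', _, .iteFalse hb h3, by omega, h5⟩

/-- The loop `for x = 0, …, e - 1`. -/
def forN (x : ℕ) (e : NExp) (body : Prog) : Prog :=
  .seq (.setNat x (.const 0))
    (.while (.nlt (.var x) e) (.seq body (.setNat x (.add (.var x) (.const 1)))))

/-- The state with integer register `x` set to `v`. -/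
def State.setReg (s : State) (x v : ℕ) : State := { s with nat := Function.update s.nat x v }

@[simp] theorem State.setReg_real (s : State) (x v : ℕ) : (s.setReg x v).real = s.real := rfl

@[simp] theorem State.setReg_nat_self (s : State) (x v : ℕ) : (s.setReg x v).nat x = v := by
  simp [State.setReg]

theorem State.setReg_nat_of_ne (s : State) {x y v : ℕ} (h : y ≠ x) :
    (s.setReg x v).nat y = s.nat y := by
  simp [State.setReg, h]

/-- The loop bound is evaluated anew at every test, so the invariant must keep its value equal to m.
The invariant is asserted after the counter has been set, and may therefore mention the counter. -/
theorem Runs.forN {x : ℕ} {e : NExp} {body : Prog} {s : State} {m S c : ℕ} {Q : State → Prop}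
    (hS : 1 ≤ S) (hm : m ≤ S) (hcost : e.cost ≤ 38) (Inv : ℕ → State → Prop)
    (h0 : Inv 0 (s.setReg x 0))
    (he : ∀ i s', i ≤ m → Inv i s' → s'.nat x = i → e.eval s' = m)
    (hb : ∀ i s', i < m → Inv i s' → s'.nat x = i → Runs body s' (timeBound S c)
      fun s'' => s''.nat x = i ∧ Inv (i + 1) (s''.setReg x (i + 1)))
    (hQ : ∀ s', Inv m s' → s'.nat x = m → Q s') :
    Runs (forN x e body) s (timeBound S (c + 100)) Q := by
  -- Induction on the number k of iterations still to be made.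
  have key : ∀ k i s', k + i = m → Inv i s' → s'.nat x = i →
      Runs (.while (.nlt (.var x) e) (.seq body (.setNat x (.add (.var x) (.const 1))))) s'
        (k * (timeBound S c + (e.cost + 2) + 4) + (e.cost + 2)) (fun s' => Inv m s' ∧ s'.nat x = m) := by
    intro k
    induction k with
    | zero =>
      intro i s' hi hI hx
      obtain rfl : i = m := by omega
      refine ⟨s', _, .whileFalse ?_, ?_, hI, hx⟩
      · simp [Test.Holds, NExp.eval, hx, he i s' le_rfl hI hx]
      · simp [Test.cost, NExp.cost]; omega
    | succ k ih =>
      intro i s' hi hI hx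
      obtain ⟨s1, t1, h1, h2, h3, h4⟩ := hb i s' (by omega) hI hx
      obtain ⟨s2, t2, h5, h6, h7⟩ := ih (i + 1) (s1.setReg x (i + 1)) (by omega) h4 (by simp)
      have hex : Exec (.setNat x (.add (.var x) (.const 1))) s1 (s1.setReg x (i + 1)) 4 := by
        have := Exec.setNat s1 x (.add (.var x) (.const 1))
        simpa [NExp.eval, NExp.cost, h3, State.setReg] using this
      refine ⟨s2, _, .whileTrue ?_ (.seq h1 hex) h5, ?_, h7⟩
      · simp only [Test.Holds, NExp.eval, hx, he i s' (by omega) hI hx]; omega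
      · simp only [Test.cost, NExp.cost]
        rw [Nat.succ_mul]
        omega
  obtain ⟨s2, t2, h5, h6, h7, h8⟩ := key m 0 _ (by omega) h0 (by simp)
  refine ⟨s2, _, .seq (.setNat s x (.const 0)) h5, ?_, hQ _ h7 h8⟩
  refine le_trans ?_ (loop_le_timeBound (q := e.cost + 2) hS hm (by omega))
  have : m * (timeBound S c + (e.cost + 2) + 4) ≤ m * (timeBound S c + (e.cost + 2) + 6) :=
    Nat.mul_le_mul_left _ (by omega)
  simp only [NExp.cost]
  omega

/-- The registers below `d` and the arrays outside `A` have not changed. -/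
def Frame (d : ℕ) (A : Set ℕ) (s s' : State) : Prop :=
  (∀ y < d, s'.nat y = s.nat y) ∧ ∀ a ∉ A, s'.real a = s.real a

theorem Frame.trans {d : ℕ} {A : Set ℕ} {s s' s'' : State} (h : Frame d A s s')
    (h' : Frame d A s' s'') : Frame d A s s'' :=
  ⟨fun y hy => (h'.1 y hy).trans (h.1 y hy), fun a ha => (h'.2 a ha).trans (h.2 a ha)⟩

theorem Frame.weaken {d d' : ℕ} {A A' : Set ℕ} {s s' : State} (h : Frame d A s s') (hd : d' ≤ d)
    (hA : A ⊆ A') : Frame d' A' s s' :=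
  ⟨fun y hy => h.1 y (by omega), fun a ha => h.2 a fun h' => ha (hA h')⟩

theorem Frame.write {d : ℕ} {A : Set ℕ} {s : State} {a p : ℕ} {v : ℝ} (ha : a ∈ A) :
    Frame d A s (s.write a p v) := by
  refine ⟨fun _ _ => rfl, fun b hb => ?_⟩
  have : b ≠ a := fun h => hb (h ▸ ha)
  simp [State.write, this]

theorem Frame.setReg {d : ℕ} {A : Set ℕ} {s : State} {x v : ℕ} (hx : d ≤ x) :
    Frame d A s (s.setReg x v) :=
  ⟨fun y hy => State.setReg_nat_of_ne _ (by omega), fun _ _ => rfl⟩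

theorem State.write_real (s : State) (a p : ℕ) (v : ℝ) (b q : ℕ) :
    (s.write a p v).real b q = if b = a ∧ q = p then v else s.real b q := by
  unfold State.write
  by_cases h : b = a
  · subst h; by_cases h' : q = p
    · subst h'; simp
    · simp [h']
  · simp [h]

/-- The invariant sees only the real arrays; integer data are protected by the frame condition.
Nested loops use increasing registers, so that a body which respects registers up to x leaves the
counters of all enclosing loops intact. -/
theorem Runs.forFrame {x : ℕ} {e : NExp} {body : Prog} {s : State} {m S c : ℕ} {A : Set ℕ}
    (hS : 1 ≤ S) (hm : m ≤ S) (hcost : e.cost ≤ 38) (Inv : ℕ → (ℕ → ℕ → ℝ) → Prop)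
    (he : ∀ s', Frame x A s s' → e.eval s' = m) (h0 : Inv 0 s.real)
    (hb : ∀ i s', i < m → s'.nat x = i → Frame x A s s' → Inv i s'.real →
      Runs body s' (timeBound S c) fun s'' => Frame (x + 1) A s' s'' ∧ Inv (i + 1) s''.real) :
    Runs (RealRAM.forN x e body) s (timeBound S (c + 100))
      fun s' => Frame x A s s' ∧ Inv m s'.real := by
  refine Runs.forN hS hm hcost (fun i s' => Frame x A s s' ∧ Inv i s'.real)
    ⟨Frame.setReg le_rfl, by simpa using h0⟩ (fun i s' _ h _ => he s' h.1) ?_ (fun s' h _ => h)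
  intro i s' hi ⟨hF, hI⟩ hx
  refine (hb i s' hi hx hF hI).imp ?_
  intro s'' ⟨hF', hI'⟩
  refine ⟨(hF'.1 x (by omega)).trans hx, ?_, by simpa using hI'⟩
  exact (hF.trans (hF'.weaken (by omega) subset_rfl)).trans (Frame.setReg le_rfl)

/-- From `s` to `s'`, the entries of array `a` at the addresses in `D` have been given
their values under `f`; nothing else changed in array `a`, other than towards `f`. -/
def Fills (d : ℕ) (A : Set ℕ) (a : ℕ) (D : Set ℕ) (f : ℕ → ℝ) (s s' : State) : Prop :=
  Frame d A s s' ∧ (∀ p ∈ D, s'.real a p = f p) ∧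
    ∀ p, s'.real a p = s.real a p ∨ s'.real a p = f p

/-- The last clause of `Fills` makes filling monotone: an address that has received its final value
cannot lose it later. Hence the address sets of different iterations need not be disjoint. -/
theorem Runs.forFill {x : ℕ} {e : NExp} {body : Prog} {s : State} {m S c : ℕ} {A : Set ℕ} {a : ℕ}
    {f : ℕ → ℝ} {D' : Set ℕ} (D : ℕ → Set ℕ)
    (hS : 1 ≤ S) (hm : m ≤ S) (hcost : e.cost ≤ 38)
    (he : ∀ s', Frame x A s s' → e.eval s' = m)
    (hD : ∀ p ∈ D', ∃ i < m, p ∈ D i)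
    (hb : ∀ i s', i < m → s'.nat x = i → Frame x A s s' →
      Runs body s' (timeBound S c) (Fills (x + 1) A a (D i) f s')) :
    Runs (RealRAM.forN x e body) s (timeBound S (c + 100)) (Fills x A a D' f s) := by
  refine (Runs.forFrame hS hm hcost (fun i r => (∀ j < i, ∀ p ∈ D j, r a p = f p) ∧
    ∀ p, r a p = s.real a p ∨ r a p = f p) he ⟨by simp, by simp⟩ ?_).imp ?_
  · intro i s' hi hx hF ⟨h1, h2⟩
    refine (hb i s' hi hx hF).imp ?_
    rintro s'' ⟨hF', h3, h4⟩
    refine ⟨hF', ?_, ?_⟩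
    · intro j hj p hp
      rcases Nat.lt_succ_iff_lt_or_eq.1 hj with hj | rfl
      · rcases h4 p with h | h
        · rw [h, h1 j hj p hp]
        · exact h
      · exact h3 p hp
    · intro p
      rcases h4 p with h | h
      · rw [h]; exact h2 p
      · exact .inr h
  · rintro s' ⟨hF, h1, h2⟩
    refine ⟨hF, fun p hp => ?_, h2⟩
    obtain ⟨i, hi, hpi⟩ := hD p hp
    exact h1 i hi p hpi

theorem Fills.write {d : ℕ} {A : Set ℕ} {a p : ℕ} {f : ℕ → ℝ} {s : State} {v : ℝ} (ha : a ∈ A)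
    (hv : v = f p) : Fills d A a {p} f s (s.write a p v) := by
  refine ⟨Frame.write ha, ?_, ?_⟩
  · rintro q rfl; simp [State.write_real, hv]
  · intro q
    by_cases h : q = p
    · subst h; right; simp [State.write_real, hv]
    · left; simp [State.write_real, h]

/-- Array `20` serves as an accumulator: entry `a[i] := ∑_{z < m} e`. -/
def setSum (a : ℕ) (i : NExp) (z : ℕ) (m : NExp) (e : RExp) : Prog :=
  .seq (.setReal 20 (.const 0) (.const 0))
    (.seq (forN z m (.setReal 20 (.const 0) (.add (.get 20 (.const 0)) e)))
      (.setReal a i (.get 20 (.const 0))))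

theorem Runs.setSum {a : ℕ} {i : NExp} {z : ℕ} {m : NExp} {e : RExp} {s : State} {S M p : ℕ}
    {A : Set ℕ} {f : ℕ → ℝ} (g : ℕ → ℝ)
    (hS : 1 ≤ S) (hM : M ≤ S) (hm : m.cost ≤ 38) (hi : i.cost ≤ 60) (he : e.cost ≤ 60)
    (hA : a ∈ A) (h20 : 20 ∈ A) (ha : a ≠ 20)
    (hmM : ∀ s', Frame z {20} s s' → m.eval s' = M)
    (hip : ∀ s', Frame z {20} s s' → i.eval s' = p)
    (heg : ∀ k s', k < M → Frame z {20} s s' → s'.nat z = k → e.eval s' = g k)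
    (hf : f p = ∑ k ∈ Finset.range M, g k) :
    Runs (RealRAM.setSum a i z m e) s (timeBound S 400) (Fills z A a {p} f s) := by
  refine Runs.seq (a := 3) (b := 250) hS
    (Q' := fun s' => Frame z {20} s s' ∧ s'.real 20 0 = 0) ?_ ?_ (by norm_num)
  · refine Runs.setReal hS (by simp [NExp.cost, RExp.cost]) ?_
    exact ⟨Frame.write (by simp), by simp [State.write_real, NExp.eval, RExp.eval]⟩
  rintro s1 ⟨hF1, h1⟩
  refine Runs.seq (a := 165) (b := 70) hS
    (Q' := fun s' => Frame z {20} s s' ∧ s'.real 20 0 = ∑ k ∈ Finset.range M, g k) ?_ ?_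
    (by norm_num)
  · refine (Runs.forFrame (c := 65) (A := {20}) hS hM hm
      (fun k r => r 20 0 = ∑ k ∈ Finset.range k, g k) (fun s' h => hmM s' (hF1.trans h))
      (by simpa using h1) ?_).imp ?_
    · intro k s' hk hz hF hI
      refine Runs.setReal hS (by simp [NExp.cost, RExp.cost]; omega) ?_
      refine ⟨Frame.write (by simp), ?_⟩
      simp [State.write_real, NExp.eval, RExp.eval, Finset.sum_range_succ, hI,
        heg k s' hk (hF1.trans hF) hz]
    · rintro s' ⟨hF, h⟩; exact ⟨hF1.trans hF, h⟩
  rintro s2 ⟨hF2, h2⟩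
  refine Runs.setReal hS (by simp [NExp.cost, RExp.cost]; omega) ?_
  have hF2' : Frame z A s s2 := hF2.weaken le_rfl (by simpa using h20)
  have hw := Fills.write (d := z) (A := A) (a := a) (p := p) (f := f) (s := s2) hA
    (v := ∑ k ∈ Finset.range M, g k) hf.symm
  have e1 : i.eval s2 = p := hip s2 hF2
  have e2 : RExp.eval s2 (.get 20 (.const 0)) = ∑ k ∈ Finset.range M, g k := by
    simpa [RExp.eval, NExp.eval] using h2
  rw [e1, e2]
  refine ⟨hF2'.trans hw.1, hw.2.1, fun q => ?_⟩
  rcases hw.2.2 q with h | h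
  · left; rw [h, hF2.2 a (by simpa using ha)]
  · exact .inr h

/-- Row-major position of entry `(i, j)` in a matrix with rows of length `d`. -/
abbrev NExp.idx (i d j : NExp) : NExp := .add (.mul i d) j

/-- Array `a` becomes the `r × d` matrix with entries `∑_k e`; the row, column and summation
indices are in registers `x`, `x + 1`, `x + 2`. -/
def fillMat (x a : ℕ) (r d m : NExp) (e : RExp) : Prog :=
  forN x r (forN (x + 1) d (setSum a (.idx (.var x) d (.var (x + 1))) (x + 2) m e))

theorem Frame.anti {d : ℕ} {A : Set ℕ} {s s' : State} (h : Frame d A s s') {d' : ℕ} (hd : d' ≤ d) :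
    Frame d' A s s' := h.weaken hd subset_rfl

theorem Runs.fillMat {x a : ℕ} {r d m : NExp} {e : RExp} {s : State} {S r₀ d₀ : ℕ}
    (M : ℕ → ℕ → ℕ) (g : ℕ → ℕ → ℕ → ℝ)
    (hS : 1 ≤ S) (hrS : r₀ ≤ S) (hdS : d₀ ≤ S) (hMS : ∀ i < r₀, ∀ j < d₀, M i j ≤ S)
    (hcr : r.cost ≤ 38) (hcd : d.cost ≤ 38) (hcm : m.cost ≤ 38) (hce : e.cost ≤ 60) (ha : a ≠ 20)
    (hr : ∀ s', Frame x {20, a} s s' → r.eval s' = r₀)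
    (hd : ∀ s', Frame x {20, a} s s' → d.eval s' = d₀)
    (hm : ∀ i j s', i < r₀ → j < d₀ → Frame x {20, a} s s' → s'.nat x = i → s'.nat (x + 1) = j →
      m.eval s' = M i j)
    (he : ∀ i j k s', i < r₀ → j < d₀ → k < M i j → Frame x {20, a} s s' → s'.nat x = i →
      s'.nat (x + 1) = j → s'.nat (x + 2) = k → e.eval s' = g i j k) :
    Runs (RealRAM.fillMat x a r d m e) s (timeBound S 600) fun s' =>
      Frame x {20, a} s s' ∧
        ∀ i < r₀, ∀ j < d₀, s'.real a (i * d₀ + j) = ∑ k ∈ Finset.range (M i j), g i j k := by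
  have hdiv : ∀ i j, j < d₀ → (i * d₀ + j) / d₀ = i ∧ (i * d₀ + j) % d₀ = j := by
    intro i j hj
    have h0 : 0 < d₀ := by omega
    constructor
    · rw [mul_comm, Nat.mul_add_div h0, Nat.div_eq_of_lt hj, add_zero]
    · rw [mul_comm, Nat.mul_add_mod, Nat.mod_eq_of_lt hj]
  -- `Fills` speaks about addresses, so row and column are recovered as quotient and remainder by
  -- the row length.
  set f : ℕ → ℝ := fun p => ∑ k ∈ Finset.range (M (p / d₀) (p % d₀)), g (p / d₀) (p % d₀) k with hf
  have hsub : ({20} : Set ℕ) ⊆ {20, a} := by simp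
  refine (Runs.forFill (c := 500) (A := {20, a}) (a := a) (f := f)
    (D' := {p | ∃ i < r₀, ∃ j < d₀, p = i * d₀ + j})
    (fun i => {p | ∃ j < d₀, p = i * d₀ + j}) hS hrS hcr hr (by rintro p ⟨i, hi, h⟩; exact ⟨i, hi, h⟩)
    ?_).imp ?_
  · intro i s1 hi hx hF1
    refine (Runs.forFill (c := 400) (A := {20, a}) (a := a) (f := f)
      (fun j => {i * d₀ + j}) hS hdS hcd (fun s' h => hd s' (hF1.trans (h.anti (by omega))))
      (by rintro p ⟨j, hj, rfl⟩; exact ⟨j, hj, rfl⟩) ?_)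
    intro j s2 hj hx2 hF2
    have hF12 : Frame x {20, a} s s2 := hF1.trans (hF2.anti (by omega))
    have hx1 : s2.nat x = i := (hF2.1 x (by omega)).trans hx
    have tr : ∀ {s'}, Frame (x + 2) {20} s2 s' → Frame x {20, a} s s' ∧ s'.nat x = i ∧
        s'.nat (x + 1) = j := fun {s'} h =>
      ⟨hF12.trans (h.weaken (by omega) hsub), (h.1 x (by omega)).trans hx1,
        (h.1 (x + 1) (by omega)).trans hx2⟩
    refine Runs.setSum (M := M i j) (fun k => g i j k) hS (hMS i hi j hj) hcm ?_ hce (by simp)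
      (by simp) ha ?_ ?_ ?_ ?_
    · simp [NExp.cost]; omega
    · intro s' h; obtain ⟨h1, h2, h3⟩ := tr h; exact hm i j s' hi hj h1 h2 h3
    · intro s' h; obtain ⟨h1, h2, h3⟩ := tr h
      simp [NExp.eval, h2, h3, hd s' h1]
    · intro k s' hk h h4; obtain ⟨h1, h2, h3⟩ := tr h
      exact he i j k s' hi hj hk h1 h2 h3 h4
    · simp only [hf, (hdiv i j hj).1, (hdiv i j hj).2]
  · rintro s' ⟨hF, h1, -⟩
    refine ⟨hF, fun i hi j hj => ?_⟩
    rw [h1 _ ⟨i, hi, j, hj, rfl⟩]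
    simp only [hf, (hdiv i j hj).1, (hdiv i j hj).2]

theorem State.eig_frame (s : State) (x d a w v : ℕ) : Frame x {w, v} s (s.eig d a w v) := by
  refine ⟨fun _ _ => rfl, fun b hb => ?_⟩
  simp only [Set.mem_insert_iff, Set.mem_singleton_iff, not_or] at hb
  simp [State.eig, hb.1, hb.2]

theorem State.eig_real_fst (s : State) {d a w v : ℕ} (hwv : w ≠ v) (j : Fin d) :
    (s.eig d a w v).real w j = symEigenvalue (s.readMatrix d a) j := by
  simp [State.eig, hwv]

theorem State.eig_real_snd (s : State) {d a w v : ℕ} (i j : Fin d) :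
    (s.eig d a w v).real v (i * d + j) = symEigenvector (s.readMatrix d a) j i := by
  have h0 : 0 < d := i.pos
  have h1 : (i.val * d + j.val) / d = i := by
    rw [mul_comm, Nat.mul_add_div h0, Nat.div_eq_of_lt j.2, add_zero]
  have h2 : (i.val * d + j.val) % d = j := by
    rw [mul_comm, Nat.mul_add_mod, Nat.mod_eq_of_lt j.2]
  simp [State.eig, h1, h2]

end RealRAM

/-! ### Spectral preliminaries -/

section Spectral

variable {H : Type*} [NormedAddCommGroup H] [InnerProductSpace ℝ H]

theorem OrthonormalBasis.sum_sq_inner {ι : Type*} [Fintype ι] (b : OrthonormalBasis ι ℝ H) (x : H) :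
    ∑ t, inner ℝ (b t) x ^ 2 = ‖x‖ ^ 2 := by
  have := b.sum_sq_norm_inner_right x
  simpa using this

theorem exists_mem_ne_zero_of_card_lt_finrank [FiniteDimensional ℝ H] {κ : Type*} [Fintype κ]
    (V : Submodule ℝ H)
    (v : κ → H) (h : Fintype.card κ < Module.finrank ℝ V) :
    ∃ x ∈ V, x ≠ 0 ∧ ∀ t, inner ℝ (v t) x = 0 := by
  let φ : V →ₗ[ℝ] (κ → ℝ) := LinearMap.pi fun t => (innerₛₗ ℝ (v t)).comp V.subtype
  have hk : LinearMap.ker φ ≠ ⊥ := by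
    apply LinearMap.ker_ne_bot_of_finrank_lt
    simpa using h
  obtain ⟨x, hx, hx0⟩ := Submodule.exists_mem_ne_zero_of_ne_bot hk
  refine ⟨x, x.2, by simpa using hx0, fun t => ?_⟩
  have := congrFun (LinearMap.mem_ker.1 hx) t
  simpa [φ] using this

/-- Half of the Courant–Fischer principle. By dimension, V meets the span of the eigenvectors 0, …,
m in a nonzero vector, and on that span the form is at least `lam m` times the squared norm. -/
theorem eigenvalue_le_of_form_le [FiniteDimensional ℝ H] {N : ℕ} (b : OrthonormalBasis (Fin N) ℝ H)
    {lam : Fin N → ℝ} (hlam : Antitone lam) (V : Submodule ℝ H) (c : ℝ) (m : Fin N)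
    (hV : N < Module.finrank ℝ V + (m + 1))
    (h : ∀ x ∈ V, ∑ t, lam t * inner ℝ (b t) x ^ 2 ≤ c * ‖x‖ ^ 2) : lam m ≤ c := by
  obtain ⟨x, hxV, hx0, hx⟩ := exists_mem_ne_zero_of_card_lt_finrank V
    (fun t : {t : Fin N // m < t} => b t) (by
      have : Fintype.card {t : Fin N // m < t} = N - 1 - m := by
        rw [Fintype.card_of_subtype (Finset.Ioi m) (by simp), Fin.card_Ioi]
      rw [this]; have := m.2; omega)
  have h1 := h x hxV
  have h2 : lam m * ‖x‖ ^ 2 ≤ ∑ t, lam t * inner ℝ (b t) x ^ 2 := by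
    rw [← b.sum_sq_inner, Finset.mul_sum]
    refine Finset.sum_le_sum fun t _ => ?_
    by_cases ht : m < t
    · simp [hx ⟨t, ht⟩]
    · exact mul_le_mul_of_nonneg_right (hlam (not_lt.1 ht)) (sq_nonneg _)
  have h3 : 0 < ‖x‖ ^ 2 := by positivity
  exact le_of_mul_le_mul_right (h2.trans h1) h3

/-- The other half: V contains a nonzero vector orthogonal to the first m eigenvectors, and on such
vectors the form is at most `lam m` times the squared norm. -/
theorem le_eigenvalue_of_le_form [FiniteDimensional ℝ H] {N : ℕ} (b : OrthonormalBasis (Fin N) ℝ H)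
    {lam : Fin N → ℝ} (hlam : Antitone lam) (V : Submodule ℝ H) (c : ℝ) (m : Fin N)
    (hV : m < Module.finrank ℝ V)
    (h : ∀ x ∈ V, c * ‖x‖ ^ 2 ≤ ∑ t, lam t * inner ℝ (b t) x ^ 2) : c ≤ lam m := by
  obtain ⟨x, hxV, hx0, hx⟩ := exists_mem_ne_zero_of_card_lt_finrank V
    (fun t : {t : Fin N // t < m} => b t) (by
      have : Fintype.card {t : Fin N // t < m} = m := by
        rw [Fintype.card_of_subtype (Finset.Iio m) (by simp), Fin.card_Iio]
      rw [this]; exact hV)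
  have h1 := h x hxV
  have h2 : ∑ t, lam t * inner ℝ (b t) x ^ 2 ≤ lam m * ‖x‖ ^ 2 := by
    rw [← b.sum_sq_inner, Finset.mul_sum]
    refine Finset.sum_le_sum fun t _ => ?_
    by_cases ht : t < m
    · simp [hx ⟨t, ht⟩]
    · exact mul_le_mul_of_nonneg_right (hlam (not_lt.1 ht)) (sq_nonneg _)
  have h3 : 0 < ‖x‖ ^ 2 := by positivity
  exact le_of_mul_le_mul_right (h1.trans h2) h3

theorem finrank_le_card_add_finrank_of_ker [FiniteDimensional ℝ H] {κ : Type*} [Fintype κ]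
    (φ : H →ₗ[ℝ] (κ → ℝ)) :
    Module.finrank ℝ H ≤ Fintype.card κ + Module.finrank ℝ (LinearMap.ker φ) := by
  have h := LinearMap.finrank_range_add_finrank_ker φ
  have h2 : Module.finrank ℝ (LinearMap.range φ) ≤ Fintype.card κ := by
    simpa using Submodule.finrank_le (LinearMap.range φ)
  omega

theorem LinearMap.IsSymmetric.inner_apply_self [FiniteDimensional ℝ H] {T : H →ₗ[ℝ] H}
    (hT : T.IsSymmetric) {N : ℕ} (hN : Module.finrank ℝ H = N) (x : H) :
    inner ℝ x (T x) = ∑ t, hT.eigenvalues hN t * inner ℝ (hT.eigenvectorBasis hN t) x ^ 2 := by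
  rw [← (hT.eigenvectorBasis hN).sum_inner_mul_inner]
  refine Finset.sum_congr rfl fun t _ => ?_
  rw [← hT, hT.apply_eigenvectorBasis hN t]
  simp only [RCLike.ofReal_real_eq_id, id_eq, inner_smul_left, conj_trivial]
  rw [real_inner_comm]
  ring

end Spectral

/-! ### Singular values and condition numbers -/

section CondNumber

variable {ι κ : Type*} [Fintype ι] [Fintype κ] [DecidableEq κ]

/-- The basis consists of right singular vectors, that is, eigenvectors of the adjoint composed with
T. It reduces both extremal properties of singular values to termwise comparisons. -/
theorem LinearMap.exists_basis_norm_apply_sq {H H' : Type*} [NormedAddCommGroup H]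
    [InnerProductSpace ℝ H] [FiniteDimensional ℝ H] [NormedAddCommGroup H'] [InnerProductSpace ℝ H']
    [FiniteDimensional ℝ H'] (T : H →ₗ[ℝ] H') {N : ℕ} (hN : Module.finrank ℝ H = N) :
    ∃ b : OrthonormalBasis (Fin N) ℝ H, ∀ x,
      ‖T x‖ ^ 2 = ∑ t : Fin N, T.singularValues t ^ 2 * inner ℝ (b t) x ^ 2 := by
  refine ⟨T.isSymmetric_adjoint_comp_self.eigenvectorBasis hN, fun x => ?_⟩
  have h := T.isSymmetric_adjoint_comp_self.inner_apply_self hN x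
  have h2 : inner ℝ x ((LinearMap.adjoint T ∘ₗ T) x) = inner ℝ (T x) (T x) := by
    rw [LinearMap.comp_apply, LinearMap.adjoint_inner_right]
  rw [← real_inner_self_eq_norm_sq, ← h2, h]
  refine Finset.sum_congr rfl fun t _ => ?_
  rw [LinearMap.sq_singularValues_fin _ hN]

theorem norm_toEuclideanLin_le (M : Matrix ι κ ℝ) (x : EuclideanSpace ℝ κ) :
    ‖M.toEuclideanLin x‖ ≤ M.toEuclideanLin.singularValues 0 * ‖x‖ := by
  obtain ⟨b, hb⟩ := LinearMap.exists_basis_norm_apply_sq M.toEuclideanLin finrank_euclideanSpace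
  refine le_of_sq_le_sq ?_ (mul_nonneg (LinearMap.singularValues_nonneg _ _) (norm_nonneg _))
  rw [hb, mul_pow, ← b.sum_sq_inner x, Finset.mul_sum]
  refine Finset.sum_le_sum fun t _ => mul_le_mul_of_nonneg_right ?_ (sq_nonneg _)
  exact pow_le_pow_left₀ (LinearMap.singularValues_nonneg _ _)
    (M.toEuclideanLin.singularValues_antitone (Nat.zero_le _)) 2

theorem le_norm_toEuclideanLin (M : Matrix ι κ ℝ) (x : EuclideanSpace ℝ κ) :
    M.toEuclideanLin.singularValues (Fintype.card κ - 1) * ‖x‖ ≤ ‖M.toEuclideanLin x‖ := by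
  obtain ⟨b, hb⟩ := LinearMap.exists_basis_norm_apply_sq M.toEuclideanLin finrank_euclideanSpace
  refine le_of_sq_le_sq ?_ (norm_nonneg _)
  rw [hb, mul_pow, ← b.sum_sq_inner x, Finset.mul_sum]
  refine Finset.sum_le_sum fun t _ => mul_le_mul_of_nonneg_right ?_ (sq_nonneg _)
  exact pow_le_pow_left₀ (LinearMap.singularValues_nonneg _ _)
    (M.toEuclideanLin.singularValues_antitone (by omega)) 2

theorem condNumber_of_isEmpty (M : Matrix ι κ ℝ) (h : Fintype.card κ = 0) : condNumber M = 1 := by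
  simp [condNumber, h]

/-- A finite condition number bounds the ratio between the largest and the smallest stretch. -/
theorem exists_stretch_of_condNumber_ne_top (M : Matrix ι κ ℝ) (h0 : Fintype.card κ ≠ 0)
    (h : condNumber M ≠ ⊤) :
    ∃ σ : ℝ, 0 < σ ∧ 1 ≤ (condNumber M).toReal ∧ (∀ x, σ * ‖x‖ ≤ ‖M.toEuclideanLin x‖) ∧
      ∀ x, ‖M.toEuclideanLin x‖ ≤ (condNumber M).toReal * σ * ‖x‖ := by
  have hs : M.toEuclideanLin.singularValues (Fintype.card κ - 1) ≠ 0 := by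
    intro hs
    simp [condNumber, h0, hs] at h
  have hpos : 0 < M.toEuclideanLin.singularValues (Fintype.card κ - 1) :=
    lt_of_le_of_ne (LinearMap.singularValues_nonneg _ _) (Ne.symm hs)
  have hle := M.toEuclideanLin.singularValues_antitone (Nat.zero_le (Fintype.card κ - 1))
  have hk : (condNumber M).toReal = M.toEuclideanLin.singularValues 0 /
      M.toEuclideanLin.singularValues (Fintype.card κ - 1) := by
    rw [condNumber, if_neg h0, if_neg hs, ENNReal.toReal_ofReal]
    exact div_nonneg (LinearMap.singularValues_nonneg _ _) hpos.le
  refine ⟨_, hpos, ?_, le_norm_toEuclideanLin M, fun x => ?_⟩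
  · rw [hk, one_le_div hpos]; exact hle
  · rw [hk, div_mul_cancel₀ _ hs]; exact norm_toEuclideanLin_le M x

theorem one_le_condNumber_toReal (M : Matrix ι κ ℝ) (h : condNumber M ≠ ⊤) :
    1 ≤ (condNumber M).toReal := by
  by_cases h0 : Fintype.card κ = 0
  · simp [condNumber_of_isEmpty M h0]
  · exact (exists_stretch_of_condNumber_ne_top M h0 h).choose_spec.2.1

end CondNumber

/-! ### Whitening -/

section Whitening

variable {H : Type*} [NormedAddCommGroup H] [InnerProductSpace ℝ H]

theorem inner_sum_smul_self {R : ℕ} (u : Fin R → H) (c : Fin R → ℝ) (x : H) :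
    inner ℝ (∑ i, c i • u i) x = ∑ i, c i * inner ℝ (u i) x := by
  simp [sum_inner, inner_smul_left]

/-- An operator and its adjoint have the same norm: if d is the vector of inner products, then ‖d‖²
= ⟨∑ d_i u_i, x⟩ ≤ a ‖d‖ ‖x‖. -/
theorem norm_adjoint_apply_le {R : ℕ} (u : Fin R → H) {a : ℝ}
    (hup : ∀ c : EuclideanSpace ℝ (Fin R), ‖∑ i, c i • u i‖ ≤ a * ‖c‖) (x : H) :
    ∑ i, inner ℝ (u i) x ^ 2 ≤ a ^ 2 * ‖x‖ ^ 2 := by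
  set d : EuclideanSpace ℝ (Fin R) := WithLp.toLp 2 fun i => inner ℝ (u i) x with hd
  have h1 : ∑ i, inner ℝ (u i) x ^ 2 = ‖d‖ ^ 2 := by
    simp [EuclideanSpace.real_norm_sq_eq, hd]
  have h2 : ‖d‖ ^ 2 = inner ℝ (∑ i, d i • u i) x := by
    rw [inner_sum_smul_self, ← h1]
    simp [hd, sq]
  have h3 : ‖d‖ ^ 2 ≤ a * ‖d‖ * ‖x‖ := by
    rw [h2]
    exact (real_inner_le_norm _ _).trans (by gcongr; exact hup d)
  rw [h1]
  by_cases h0 : ‖d‖ = 0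
  · have : 0 ≤ a ^ 2 * ‖x‖ ^ 2 := by positivity
    rw [h0]; simpa using this
  · have h4 : ‖d‖ ≤ a * ‖x‖ := by
      have : 0 < ‖d‖ := lt_of_le_of_ne (norm_nonneg _) (Ne.symm h0)
      nlinarith
    rw [← mul_pow]
    exact pow_le_pow_left₀ (norm_nonneg _) h4 2

/-- On the range of the synthesis map its adjoint has the same lower bound. With x = ∑ c_i u_i and d
the vector of inner products, ‖x‖² = ⟨c, d⟩ ≤ ‖c‖ ‖d‖, while a ‖c‖ ≤ ‖x‖. -/
theorem le_norm_adjoint_apply {R : ℕ} (u : Fin R → H) {a : ℝ} (ha : 0 < a)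
    (hlow : ∀ c : EuclideanSpace ℝ (Fin R), a * ‖c‖ ≤ ‖∑ i, c i • u i‖)
    (c : EuclideanSpace ℝ (Fin R)) :
    a ^ 2 * ‖∑ i, c i • u i‖ ^ 2 ≤ ∑ i, inner ℝ (u i) (∑ i, c i • u i) ^ 2 := by
  set x := ∑ i, c i • u i with hx
  set d : EuclideanSpace ℝ (Fin R) := WithLp.toLp 2 fun i => inner ℝ (u i) x with hd
  have h1 : ∑ i, inner ℝ (u i) x ^ 2 = ‖d‖ ^ 2 := by
    simp [EuclideanSpace.real_norm_sq_eq, hd]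
  have h2 : ‖x‖ ^ 2 ≤ ‖c‖ * ‖d‖ := by
    rw [← real_inner_self_eq_norm_sq]
    conv_lhs => rw [hx, inner_sum_smul_self]
    have : ∑ i, c i * inner ℝ (u i) x = inner ℝ d c := by
      simp [PiLp.inner_apply, hd]
    rw [← hx, this, mul_comm]
    exact real_inner_le_norm _ _
  rw [h1, ← mul_pow]
  refine pow_le_pow_left₀ (by positivity) ?_ 2
  by_cases h0 : ‖x‖ = 0
  · rw [h0]; simp
  · have hpos : 0 < ‖x‖ := lt_of_le_of_ne (norm_nonneg _) (Ne.symm h0)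
    have h3 := hlow c
    rw [← hx] at h3
    have h4 : a * ‖x‖ ^ 2 ≤ ‖x‖ * ‖d‖ := by
      calc a * ‖x‖ ^ 2 ≤ a * (‖c‖ * ‖d‖) := by gcongr
        _ = (a * ‖c‖) * ‖d‖ := by ring
        _ ≤ _ := by gcongr
    nlinarith

variable [FiniteDimensional ℝ H] in
/-- If `∑ i, u i ⊗ u i` is close to an operator with eigenpairs `μ, b`, then `u` is, up to a small
error, obtained from the vectors `√μ_k b_k` by a nearly orthogonal change of coordinates. -/
theorem exists_nearly_orthogonal_coordinates {N R : ℕ} (hR : R ≤ N)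
    (b : OrthonormalBasis (Fin N) ℝ H) {mu : Fin N → ℝ} (hmu : Antitone mu) (M : H →ₗ[ℝ] H)
    (hMb : ∀ t, M (b t) = mu t • b t) (u : Fin R → H) {σ K η : ℝ} (hσ : 0 < σ) (hK : 1 ≤ K)
    (hη0 : 0 ≤ η) (hη : η ≤ σ ^ 2 / 2)
    (hlow : ∀ c : EuclideanSpace ℝ (Fin R), σ * ‖c‖ ≤ ‖∑ i, c i • u i‖)
    (hup : ∀ c : EuclideanSpace ℝ (Fin R), ‖∑ i, c i • u i‖ ≤ K * σ * ‖c‖)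
    (hM : ∀ x, ‖M x - ∑ i, inner ℝ (u i) x • u i‖ ≤ η * ‖x‖) :
    ∃ q : Fin R → EuclideanSpace ℝ (Fin R),
      (∀ z, |∑ i, inner ℝ (q i) z ^ 2 - ‖z‖ ^ 2| ≤ 2 * η / σ ^ 2 * ‖z‖ ^ 2) ∧
      (∀ k, ‖√(mu (Fin.castLE hR k)) • b (Fin.castLE hR k) - ∑ i, q i k • u i‖ ≤ 2 * η / σ) ∧
      (∀ k, ‖√(mu (Fin.castLE hR k)) • b (Fin.castLE hR k)‖ ≤ 2 * K * σ) ∧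
      ∀ x, ∑ k, inner ℝ (√(mu (Fin.castLE hR k)) • b (Fin.castLE hR k)) x ^ 2
        ≤ (2 * K * σ) ^ 2 * ‖x‖ ^ 2 := by
  have hform : ∀ x, |inner ℝ x (M x) - ∑ i, inner ℝ (u i) x ^ 2| ≤ η * ‖x‖ ^ 2 := by
    intro x
    have h1 : inner ℝ x (M x) - ∑ i, inner ℝ (u i) x ^ 2 =
        inner ℝ x (M x - ∑ i, inner ℝ (u i) x • u i) := by
      rw [inner_sub_right, inner_sum]
      congr 1
      refine Finset.sum_congr rfl fun i _ => ?_
      rw [inner_smul_right, real_inner_comm, sq]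
    rw [h1]
    calc _ ≤ ‖x‖ * ‖M x - ∑ i, inner ℝ (u i) x • u i‖ := abs_real_inner_le_norm _ _
      _ ≤ ‖x‖ * (η * ‖x‖) := by gcongr; exact hM x
      _ = _ := by ring
  have hMx : ∀ x, inner ℝ x (M x) = ∑ t, mu t * inner ℝ (b t) x ^ 2 := by
    intro x
    have h1 : M x = ∑ t, (inner ℝ (b t) x * mu t) • b t := by
      conv_lhs => rw [← b.sum_repr' x, map_sum]
      refine Finset.sum_congr rfl fun t _ => ?_
      rw [map_smul, hMb, smul_smul]
    conv_lhs => rw [h1]; enter [2]; rw [← b.sum_repr' x]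
    rw [b.orthonormal.inner_sum]
    refine Finset.sum_congr rfl fun t _ => ?_
    rw [conj_trivial]; ring
  set v : Fin R → H := fun k => b (Fin.castLE hR k) with hv
  have hvo : Orthonormal ℝ v := b.orthonormal.comp _ (Fin.castLE_injective hR)
  set m : Fin R → ℝ := fun k => mu (Fin.castLE hR k) with hm
  -- The span of the u_i has dimension R, and on it the form of M is at least σ² - η ≥ σ²/2.
  have hmlow : ∀ k, σ ^ 2 / 2 ≤ m k := by
    intro k
    let φ : EuclideanSpace ℝ (Fin R) →ₗ[ℝ] H :=
      (Fintype.linearCombination ℝ u).comp (WithLp.linearEquiv 2 ℝ (Fin R → ℝ)).toLinearMap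
    have hφ : ∀ c, φ c = ∑ i, c i • u i := fun c => by simp [φ, Fintype.linearCombination_apply]
    have hinj : Function.Injective φ := by
      rw [← LinearMap.ker_eq_bot, LinearMap.ker_eq_bot']
      intro c hc
      have := hlow c
      rw [← hφ, hc, norm_zero] at this
      have : ‖c‖ ≤ 0 := by nlinarith [norm_nonneg c]
      simpa using this
    refine le_eigenvalue_of_le_form b hmu (LinearMap.range φ) _ _ ?_ ?_
    · rw [LinearMap.finrank_range_of_inj hinj]; simp
    · rintro _ ⟨c, rfl⟩
      rw [← hMx]
      have h1 := (abs_le.1 (hform (φ c))).1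
      have h2 := le_norm_adjoint_apply u hσ hlow c
      rw [← hφ] at h2
      nlinarith [sq_nonneg ‖φ c‖]
  have hmpos : ∀ k, 0 < m k := fun k => lt_of_lt_of_le (by positivity) (hmlow k)
  have hmup : ∀ k, m k ≤ (2 * K * σ) ^ 2 := by
    intro k
    have h1 := (abs_le.1 (hform (v k))).2
    have h2 := norm_adjoint_apply_le u hup (v k)
    have h3 : ‖v k‖ = 1 := hvo.1 k
    have h4 : inner ℝ (v k) (M (v k)) = m k := by
      simp only [hv, hMb, inner_smul_right, hm]
      rw [real_inner_self_eq_norm_sq, b.orthonormal.1]; simp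
    rw [h4, h3] at h1
    rw [h3] at h2
    have : σ ^ 2 ≤ K ^ 2 * σ ^ 2 := le_mul_of_one_le_left (sq_nonneg σ) (one_le_pow₀ hK)
    nlinarith
  have hsq : ∀ k, σ / 2 ≤ √(m k) := by
    intro k
    apply Real.le_sqrt_of_sq_le
    nlinarith [hmlow k]
  have hsqpos : ∀ k, 0 < √(m k) := fun k => Real.sqrt_pos.2 (hmpos k)
  have hsqsq : ∀ k, √(m k) ^ 2 = m k := fun k => Real.sq_sqrt (hmpos k).le
  -- If M were exactly ∑ u_i u_iᵀ, the matrix with these entries would be orthogonal and √m_k v_k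
  -- would equal ∑ q_i(k) u_i. The claims below measure the deviation.
  refine ⟨fun i => WithLp.toLp 2 fun k => inner ℝ (u i) (v k) / √(m k), ?_, ?_, ?_, ?_⟩
  · intro z
    -- Whitening: x is chosen so that ⟨x, M x⟩ = ‖z‖² and ⟨u_i, x⟩ = ⟨q_i, z⟩. Near orthogonality of
    -- q at z is then `hform` at x.
    set y : Fin R → ℝ := fun k => z k / √(m k) with hy
    set x := ∑ k, y k • v k with hx
    have hMx' : M x = ∑ k, (y k * m k) • v k := by
      rw [hx, map_sum]
      refine Finset.sum_congr rfl fun k _ => ?_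
      rw [map_smul, hv]
      simp only [hMb, smul_smul]
      rfl
    have h1 : inner ℝ x (M x) = ‖z‖ ^ 2 := by
      rw [hMx', hx, hvo.inner_sum, EuclideanSpace.real_norm_sq_eq]
      refine Finset.sum_congr rfl fun k _ => ?_
      have h2 := hsqsq k
      have h0 := (hsqpos k).ne'
      simp only [hy, conj_trivial]
      generalize √(m k) = r at *
      rw [← h2]
      field_simp
    have h2 : ‖x‖ ^ 2 ≤ 2 / σ ^ 2 * ‖z‖ ^ 2 := by
      rw [← real_inner_self_eq_norm_sq, hx, hvo.inner_sum, EuclideanSpace.real_norm_sq_eq,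
        Finset.mul_sum]
      refine Finset.sum_le_sum fun k _ => ?_
      simp only [hy, conj_trivial]
      have e : z k / √(m k) * (z k / √(m k)) = (1 / m k) * z k ^ 2 := by
        have h2 := hsqsq k
        have h0 := (hsqpos k).ne'
        generalize √(m k) = r at *
        rw [← h2]
        field_simp
      rw [e]
      refine mul_le_mul_of_nonneg_right ?_ (sq_nonneg _)
      rw [div_le_div_iff₀ (hmpos k) (by positivity)]
      linarith [hmlow k]
    have h3 : ∀ i, inner ℝ (WithLp.toLp 2 fun k => inner ℝ (u i) (v k) / √(m k) :
        EuclideanSpace ℝ (Fin R)) z = inner ℝ (u i) x := by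
      intro i
      rw [hx, inner_sum, PiLp.inner_apply]
      refine Finset.sum_congr rfl fun k _ => ?_
      simp [hy, inner_smul_right]
      ring
    simp only [h3]
    have h4 := hform x
    rw [h1, abs_sub_comm] at h4
    refine h4.trans ?_
    calc η * ‖x‖ ^ 2 ≤ η * (2 / σ ^ 2 * ‖z‖ ^ 2) := by gcongr
      _ = _ := by ring
  · intro k
    have h0 := (hsqpos k).ne'
    -- As v_k is an eigenvector of M, the difference is the approximation error of M at v_k divided
    -- by √m_k.
    have e : √(m k) • v k - ∑ i, (inner ℝ (u i) (v k) / √(m k)) • u i =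
        (√(m k))⁻¹ • (M (v k) - ∑ i, inner ℝ (u i) (v k) • u i) := by
      rw [smul_sub, Finset.smul_sum]
      congr 1
      · simp only [hv, hMb, smul_smul]
        congr 1
        change √(m k) = (√(m k))⁻¹ * m k
        rw [← hsqsq k]; field_simp
        rw [Real.sqrt_sq (Real.sqrt_nonneg _)]
      · refine Finset.sum_congr rfl fun i _ => ?_
        rw [smul_smul]; congr 1; ring
    change ‖√(m k) • v k - ∑ i, (inner ℝ (u i) (v k) / √(m k)) • u i‖ ≤ _
    rw [e, norm_smul, Real.norm_of_nonneg (by positivity)]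
    have h1 := hM (v k)
    rw [hvo.1 k, mul_one] at h1
    have h2 : (√(m k))⁻¹ ≤ 2 / σ := by
      rw [inv_eq_one_div, div_le_div_iff₀ (hsqpos k) hσ]; linarith [hsq k]
    calc _ ≤ 2 / σ * η := by gcongr
      _ = _ := by ring
  · intro k
    change ‖√(m k) • v k‖ ≤ _
    rw [norm_smul, hvo.1 k, mul_one, Real.norm_of_nonneg (by positivity)]
    exact Real.sqrt_le_iff.2 ⟨by positivity, hmup k⟩
  · intro x
    change ∑ k, inner ℝ (√(m k) • v k) x ^ 2 ≤ _
    calc _ ≤ ∑ k, (2 * K * σ) ^ 2 * ‖inner ℝ (v k) x‖ ^ 2 := by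
          refine Finset.sum_le_sum fun k _ => ?_
          rw [inner_smul_left, conj_trivial, mul_pow, hsqsq, Real.norm_eq_abs, sq_abs]
          exact mul_le_mul_of_nonneg_right (hmup k) (sq_nonneg _)
      _ ≤ _ := by
          rw [← Finset.mul_sum]
          gcongr
          exact hvo.sum_inner_products_le x

end Whitening

/-! ### Nearly orthonormal families -/

section NearlyOrthonormal

/-- For the self-adjoint operator 1 - ∑ q_i q_iᵀ a bound on the quadratic form is a bound on the
norm; this is polarization. -/
theorem norm_sub_frame_le {H : Type*} [NormedAddCommGroup H] [InnerProductSpace ℝ H] {R : ℕ}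
    (q : Fin R → H) {β : ℝ} (hβ : 0 ≤ β)
    (h : ∀ z, |∑ i, inner ℝ (q i) z ^ 2 - ‖z‖ ^ 2| ≤ β * ‖z‖ ^ 2) (z : H) :
    ‖z - ∑ i, inner ℝ (q i) z • q i‖ ≤ β * ‖z‖ := by
  set e := z - ∑ i, inner ℝ (q i) z • q i with he
  have hB : ∀ x, inner ℝ x e = inner ℝ x z - ∑ i, inner ℝ (q i) x * inner ℝ (q i) z := by
    intro x
    rw [he, inner_sub_right, inner_sum]
    congr 1
    refine Finset.sum_congr rfl fun i _ => ?_
    rw [inner_smul_right, real_inner_comm x (q i)]; ring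
  have hpol : ∀ x, 4 * inner ℝ x e ≤ 2 * β * (‖x‖ ^ 2 + ‖z‖ ^ 2) := by
    intro x
    have h1 := (abs_le.1 (h (x + z))).1
    have h2 := (abs_le.1 (h (x - z))).2
    have h3 : ‖x + z‖ ^ 2 = ‖x‖ ^ 2 + 2 * inner ℝ x z + ‖z‖ ^ 2 := norm_add_sq_real x z
    have h4 : ‖x - z‖ ^ 2 = ‖x‖ ^ 2 - 2 * inner ℝ x z + ‖z‖ ^ 2 := norm_sub_sq_real x z
    have h5 : ∑ i, inner ℝ (q i) (x + z) ^ 2 - ∑ i, inner ℝ (q i) (x - z) ^ 2 =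
        4 * ∑ i, inner ℝ (q i) x * inner ℝ (q i) z := by
      rw [← Finset.sum_sub_distrib, Finset.mul_sum]
      refine Finset.sum_congr rfl fun i _ => ?_
      rw [inner_add_right, inner_sub_right]; ring
    rw [hB]
    nlinarith
  refine le_of_sq_le_sq ?_ (by positivity)
  -- The best test vector is the error itself scaled by 1/β, which balances the two squares in the
  -- polarized inequality; β = 0 must be treated apart.
  rcases hβ.eq_or_lt with rfl | hpos
  · have := hpol e
    rw [real_inner_self_eq_norm_sq] at this
    nlinarith
  · have h1 := hpol (β⁻¹ • e)
    rw [inner_smul_left, conj_trivial, real_inner_self_eq_norm_sq, norm_smul,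
      Real.norm_of_nonneg (by positivity)] at h1
    have h2 : 2 * β * ((β⁻¹ * ‖e‖) ^ 2 + ‖z‖ ^ 2) = 2 * β⁻¹ * ‖e‖ ^ 2 + 2 * β * ‖z‖ ^ 2 := by
      field_simp
    rw [h2] at h1
    have h3 : β⁻¹ * ‖e‖ ^ 2 ≤ β * ‖z‖ ^ 2 := by linarith
    have h4 : ‖e‖ ^ 2 = β * (β⁻¹ * ‖e‖ ^ 2) := by field_simp
    rw [h4, mul_pow, sq β, mul_assoc]
    gcongr

/-- For a square matrix, near orthonormality of the rows is transferred to the columns. The frame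
inequality at z = q_i gives ‖q_i‖² ≤ 1 + β and bounds the squared inner products by ‖q_i‖² (1 + β -
‖q_i‖²). Summing the inequality over the standard basis gives ∑ ‖q_i‖² ≥ R (1 - β), so no single
‖q_i‖² can be below 1 - 2Rβ. The inner products are controlled only through their squares, hence the
condition on δ². -/
theorem abs_inner_sub_ite_le_of_frame {R : ℕ} (q : Fin R → EuclideanSpace ℝ (Fin R)) {β δ : ℝ}
    (hβ : 0 ≤ β) (hδ : 4 * R * β ≤ δ ^ 2) (hδ0 : 0 ≤ δ) (hδ1 : δ ≤ 1)
    (h : ∀ z, |∑ i, inner ℝ (q i) z ^ 2 - ‖z‖ ^ 2| ≤ β * ‖z‖ ^ 2) (i j : Fin R) :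
    |inner ℝ (q i) (q j) - if i = j then 1 else 0| ≤ δ := by
  have hR : (1 : ℝ) ≤ R := by exact_mod_cast i.pos
  have hRβ : β ≤ R * β := le_mul_of_one_le_left hβ hR
  have hδδ : δ ^ 2 ≤ δ := by nlinarith
  have hle : ∀ i, ‖q i‖ ^ 2 ≤ 1 + β ∧
      ∀ j, j ≠ i → inner ℝ (q j) (q i) ^ 2 ≤ ‖q i‖ ^ 2 * (1 + β - ‖q i‖ ^ 2) := by
    intro i
    have h1 := (abs_le.1 (h (q i))).2
    rw [← Finset.add_sum_erase _ _ (Finset.mem_univ i), real_inner_self_eq_norm_sq] at h1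
    have h2 : ∀ j, j ≠ i → inner ℝ (q j) (q i) ^ 2 ≤
        ∑ j ∈ Finset.univ.erase i, inner ℝ (q j) (q i) ^ 2 := fun j hj =>
      Finset.single_le_sum (f := fun j => inner ℝ (q j) (q i) ^ 2) (fun _ _ => sq_nonneg _)
        (Finset.mem_erase.2 ⟨hj, Finset.mem_univ j⟩)
    have h3 : 0 ≤ ∑ j ∈ Finset.univ.erase i, inner ℝ (q j) (q i) ^ 2 :=
      Finset.sum_nonneg fun _ _ => sq_nonneg _
    refine ⟨?_, fun j hj => ?_⟩
    · by_contra hc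
      push Not at hc
      nlinarith [sq_nonneg ‖q i‖]
    · nlinarith [h2 j hj]
  have hsum : (R : ℝ) * (1 - β) ≤ ∑ i, ‖q i‖ ^ 2 := by
    have h1 : ∀ k : Fin R, 1 - β ≤ ∑ i, (q i k) ^ 2 := by
      intro k
      have := (abs_le.1 (h (EuclideanSpace.single k 1))).1
      have e : ∀ i, inner ℝ (q i) (EuclideanSpace.single k (1 : ℝ)) = q i k := fun i => by
        simp [EuclideanSpace.inner_single_right]
      simp only [e, PiLp.norm_single, norm_one, one_pow, mul_one] at this
      linarith
    calc (R : ℝ) * (1 - β) = ∑ k : Fin R, (1 - β) := by simp; ring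
      _ ≤ ∑ k, ∑ i, (q i k) ^ 2 := Finset.sum_le_sum fun k _ => h1 k
      _ = _ := by
        rw [Finset.sum_comm]
        simp [EuclideanSpace.real_norm_sq_eq]
  have hge : ∀ i, 1 - 2 * R * β ≤ ‖q i‖ ^ 2 := by
    intro i
    rw [← Finset.add_sum_erase _ _ (Finset.mem_univ i)] at hsum
    have h1 : ∑ j ∈ Finset.univ.erase i, ‖q j‖ ^ 2 ≤ (R - 1) * (1 + β) := by
      calc _ ≤ ∑ j ∈ Finset.univ.erase i, (1 + β) := Finset.sum_le_sum fun j _ => (hle j).1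
        _ = _ := by simp [Finset.card_erase_of_mem, Nat.cast_sub (i.pos : 1 ≤ R)]; ring
    nlinarith
  split_ifs with hij
  · subst hij
    rw [real_inner_self_eq_norm_sq, abs_le]
    constructor
    · nlinarith [hge i]
    · nlinarith [(hle i).1]
  · rw [sub_zero]
    refine abs_le_of_sq_le_sq ?_ hδ0
    have h1 := (hle j).2 i hij
    have h2 := (hle j).1
    have h3 := hge j
    have h4 : ‖q j‖ ^ 2 * (1 + β - ‖q j‖ ^ 2) ≤ (1 + β) * (β + 2 * R * β) := by
      apply mul_le_mul h2 (by linarith) (by linarith) (by linarith)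
    have h5 : β ≤ 1 / 4 := by nlinarith
    nlinarith

end NearlyOrthonormal

/-! ### The kernel of the rank-one detector -/

theorem toEuclideanLin_coord {m n : Type*} [Fintype n] [DecidableEq n] (M : Matrix m n ℝ)
    (z : EuclideanSpace ℝ n) (a : m) : M.toEuclideanLin z a = ∑ b, M a b * z b := rfl

section Detector

variable {H H₂ : Type*} [NormedAddCommGroup H] [InnerProductSpace ℝ H] [NormedAddCommGroup H₂]
  [InnerProductSpace ℝ H₂] {R : ℕ}

/-- The combination `∑ k l, E k l • Φ (w k) (w l)`. -/
def pairForm (Φ : H →ₗ[ℝ] H →ₗ[ℝ] H₂) (w : Fin R → H)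
    (E : EuclideanSpace ℝ (Fin R × Fin R)) : H₂ :=
  ∑ p, E p • Φ (w p.1) (w p.2)

/-- The matrix `Qᵀ E Q`, where `Q` has columns `q i`. -/
def conjCoord (q : Fin R → EuclideanSpace ℝ (Fin R)) :
    EuclideanSpace ℝ (Fin R × Fin R) →ₗ[ℝ] EuclideanSpace ℝ (Fin R × Fin R) where
  toFun E := WithLp.toLp 2 fun p => ∑ r, q p.1 r.1 * q p.2 r.2 * E r
  map_add' E E' := by
    ext p; simp [mul_add, Finset.sum_add_distrib]
  map_smul' c E := by
    ext p; simp only [PiLp.smul_apply, smul_eq_mul, RingHom.id_apply, Finset.mul_sum]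
    exact Finset.sum_congr rfl fun r _ => by ring

theorem conjCoord_apply (q : Fin R → EuclideanSpace ℝ (Fin R))
    (E : EuclideanSpace ℝ (Fin R × Fin R)) (p : Fin R × Fin R) :
    conjCoord q E p = ∑ r, q p.1 r.1 * q p.2 r.2 * E r := rfl

/-- Substituting linear combinations into a bilinear map amounts to a congruence of the coefficient
matrix. This moves the detector from the computed w_k to the unknown u_i. -/
theorem pairForm_conjCoord (Φ : H →ₗ[ℝ] H →ₗ[ℝ] H₂) (u : Fin R → H)
    (q : Fin R → EuclideanSpace ℝ (Fin R)) (E : EuclideanSpace ℝ (Fin R × Fin R)) :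
    pairForm Φ u (conjCoord q E) = pairForm Φ (fun k => ∑ i, q i k • u i) E := by
  have h2 : ∀ r : Fin R × Fin R, Φ (∑ i, q i r.1 • u i) (∑ i, q i r.2 • u i) =
      ∑ p : Fin R × Fin R, (q p.1 r.1 * q p.2 r.2) • Φ (u p.1) (u p.2) := by
    intro r
    rw [map_sum Φ, LinearMap.sum_apply, Fintype.sum_prod_type]
    refine Finset.sum_congr rfl fun i _ => ?_
    rw [map_smul, LinearMap.smul_apply, map_sum, Finset.smul_sum]
    refine Finset.sum_congr rfl fun j _ => ?_
    rw [map_smul, smul_smul]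
  simp only [pairForm, conjCoord_apply, h2, Finset.sum_smul, Finset.smul_sum, smul_smul]
  rw [Finset.sum_comm]
  refine Finset.sum_congr rfl fun r _ => Finset.sum_congr rfl fun p _ => ?_
  congr 1; ring

theorem sum_abs_le_mul_norm (E : EuclideanSpace ℝ (Fin R × Fin R)) : ∑ p, |E p| ≤ R * ‖E‖ := by
  refine le_of_sq_le_sq ?_ (by positivity)
  have h := sq_sum_le_card_mul_sum_sq (s := (Finset.univ : Finset (Fin R × Fin R)))
    (f := fun p => |E p|)
  simp only [sq_abs, Finset.card_univ, Fintype.card_prod, Fintype.card_fin, Nat.cast_mul] at h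
  rw [mul_pow, EuclideanSpace.real_norm_sq_eq, sq (R : ℝ)]
  exact h

/-- Replacing one argument at a time costs 4aω and 8aω, because ‖v_k‖ ≤ 2ω when a ≤ ω. The factor R
compares the sum of absolute values of R² coefficients with their Euclidean norm. -/
theorem norm_pairForm_sub_le (Φ : H →ₗ[ℝ] H →ₗ[ℝ] H₂) (hΦ : ∀ x y, ‖Φ x y‖ ≤ 4 * ‖x‖ * ‖y‖)
    (w v : Fin R → H) {a ω : ℝ} (ha : a ≤ ω)
    (hw : ∀ k, ‖w k‖ ≤ ω) (hv : ∀ k, ‖w k - v k‖ ≤ a)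
    (E : EuclideanSpace ℝ (Fin R × Fin R)) :
    ‖pairForm Φ w E - pairForm Φ v E‖ ≤ 12 * R * a * ω * ‖E‖ := by
  have h1 : ∀ p : Fin R × Fin R,
      ‖Φ (w p.1) (w p.2) - Φ (v p.1) (v p.2)‖ ≤ 12 * a * ω := by
    intro p
    have ha0 : 0 ≤ a := (norm_nonneg _).trans (hv p.1)
    have hω : 0 ≤ ω := ha0.trans ha
    have e : Φ (w p.1) (w p.2) - Φ (v p.1) (v p.2) =
        Φ (w p.1 - v p.1) (w p.2) + Φ (v p.1) (w p.2 - v p.2) := by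
      simp only [map_sub, LinearMap.sub_apply]; abel
    have hvn : ‖v p.1‖ ≤ 2 * ω := by
      have := norm_sub_norm_le (v p.1) (w p.1)
      rw [norm_sub_rev] at this
      linarith [hv p.1, hw p.1]
    rw [e]
    calc _ ≤ 4 * ‖w p.1 - v p.1‖ * ‖w p.2‖ + 4 * ‖v p.1‖ * ‖w p.2 - v p.2‖ :=
          (norm_add_le _ _).trans (add_le_add (hΦ _ _) (hΦ _ _))
      _ ≤ 4 * a * ω + 4 * (2 * ω) * a := by
          gcongr
          · exact hv _
          · exact hw _
          · exact hv _
      _ = _ := by ring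
  rcases isEmpty_or_nonempty (Fin R) with hR | ⟨⟨k⟩⟩
  · simp only [pairForm, Finset.univ_eq_empty, Finset.sum_empty, sub_self, norm_zero]
    have : R = 0 := by
      by_contra h; exact hR.elim ⟨0, by omega⟩
    subst this; simp
  have ha0 : 0 ≤ a := (norm_nonneg _).trans (hv k)
  have hω : 0 ≤ ω := ha0.trans ha
  calc _ = ‖∑ p, E p • (Φ (w p.1) (w p.2) - Φ (v p.1) (v p.2))‖ := by
        simp only [pairForm, smul_sub, Finset.sum_sub_distrib]
    _ ≤ ∑ p, |E p| * (12 * a * ω) := by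
        refine (norm_sum_le _ _).trans (Finset.sum_le_sum fun p _ => ?_)
        rw [norm_smul, Real.norm_eq_abs]
        gcongr
        exact h1 p
    _ ≤ (R * ‖E‖) * (12 * a * ω) := by
        rw [← Finset.sum_mul]
        gcongr
        exact sum_abs_le_mul_norm E
    _ = _ := by ring

theorem sum_prod_eq_sum_lt {M : Type*} [AddCommMonoid M] (f : Fin R × Fin R → M)
    (hf : ∀ i, f (i, i) = 0) :
    ∑ p, f p = ∑ p : {p : Fin R × Fin R // p.1 < p.2}, (f p.1 + f p.1.swap) := by
  have h1 : ∑ p : Fin R × Fin R, f p = ∑ p : Fin R × Fin R,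
      ((if p.1 < p.2 then f p else 0) + if p.2 < p.1 then f p else 0) := by
    refine Finset.sum_congr rfl fun p _ => ?_
    rcases lt_trichotomy p.1 p.2 with h | h | h
    · simp [h, h.not_gt]
    · have : p = (p.1, p.1) := by ext <;> simp [h]
      rw [this]; simp [hf]
    · simp [h, h.not_gt]
  have h2 : ∑ p : Fin R × Fin R, (if p.2 < p.1 then f p else 0) =
      ∑ p : Fin R × Fin R, (if p.1 < p.2 then f p.swap else 0) := by
    rw [← Equiv.sum_comp (Equiv.prodComm (Fin R) (Fin R))]
    rfl
  rw [h1, Finset.sum_add_distrib, h2, ← Finset.sum_add_distrib]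
  rw [← Finset.sum_subtype (Finset.univ.filter fun p : Fin R × Fin R => p.1 < p.2) (by simp)
    (fun p => f p + f p.swap), Finset.sum_filter]
  refine Finset.sum_congr rfl fun p _ => ?_
  split_ifs <;> simp

theorem pairForm_eq_sum_lt (Φ : H →ₗ[ℝ] H →ₗ[ℝ] H₂) (hsymm : ∀ x y, Φ x y = Φ y x) (u : Fin R → H)
    (hu : ∀ i, Φ (u i) (u i) = 0) (c : EuclideanSpace ℝ (Fin R × Fin R)) :
    pairForm Φ u c =
      ∑ p : {p : Fin R × Fin R // p.1 < p.2}, (c p.1 + c p.1.swap) • Φ (u p.1.1) (u p.1.2) := by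
  rw [pairForm, sum_prod_eq_sum_lt _ (by simp [hu])]
  refine Finset.sum_congr rfl fun p _ => ?_
  rw [add_smul]
  simp [hsymm (u p.1.2) (u p.1.1)]

/-- The congruence is applied one side at a time, to rows and then to columns; each side costs a
factor 1 - δ in the squared norm. -/
theorem le_norm_conjCoord_sq (q : Fin R → EuclideanSpace ℝ (Fin R)) {δ : ℝ} (hδ1 : δ ≤ 1)
    (h : ∀ z, |∑ i, inner ℝ (q i) z ^ 2 - ‖z‖ ^ 2| ≤ δ * ‖z‖ ^ 2)
    (E : EuclideanSpace ℝ (Fin R × Fin R)) :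
    (1 - δ) ^ 2 * ‖E‖ ^ 2 ≤ ‖conjCoord q E‖ ^ 2 := by
  have hlow : ∀ z, (1 - δ) * ‖z‖ ^ 2 ≤ ∑ i, inner ℝ (q i) z ^ 2 := by
    intro z; have := (abs_le.1 (h z)).1; linarith
  set y : Fin R → EuclideanSpace ℝ (Fin R) := fun j => WithLp.toLp 2 fun a => ∑ b, q j b * E (a, b)
    with hy
  set r : Fin R → EuclideanSpace ℝ (Fin R) := fun a => WithLp.toLp 2 fun b => E (a, b) with hr
  have hyr : ∀ j a, y j a = inner ℝ (q j) (r a) := by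
    intro j a
    simp [hy, hr, PiLp.inner_apply, mul_comm]
  have hc : ∀ i j, conjCoord q E (i, j) = inner ℝ (q i) (y j) := by
    intro i j
    rw [conjCoord_apply, Fintype.sum_prod_type, PiLp.inner_apply]
    refine Finset.sum_congr rfl fun a _ => ?_
    simp only [hy, Finset.sum_mul, RCLike.inner_apply, conj_trivial]
    exact Finset.sum_congr rfl fun b _ => by ring
  calc (1 - δ) ^ 2 * ‖E‖ ^ 2 = (1 - δ) * ∑ a, (1 - δ) * ‖r a‖ ^ 2 := by
        rw [← Finset.mul_sum, EuclideanSpace.real_norm_sq_eq, Fintype.sum_prod_type]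
        simp only [EuclideanSpace.real_norm_sq_eq, hr]; ring
    _ ≤ (1 - δ) * ∑ a, ∑ j, inner ℝ (q j) (r a) ^ 2 := by
        apply mul_le_mul_of_nonneg_left _ (by linarith)
        exact Finset.sum_le_sum fun a _ => hlow _
    _ = ∑ j, (1 - δ) * ‖y j‖ ^ 2 := by
        rw [Finset.sum_comm, Finset.mul_sum]
        simp only [EuclideanSpace.real_norm_sq_eq, hyr]
    _ ≤ ∑ j, ∑ i, inner ℝ (q i) (y j) ^ 2 := Finset.sum_le_sum fun j _ => hlow _
    _ = _ := by
        rw [EuclideanSpace.real_norm_sq_eq, Fintype.sum_prod_type, Finset.sum_comm]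
        simp only [hc]

/-- The matrix with entries `E (a, b)`. -/
def unflatten (E : EuclideanSpace ℝ (Fin R × Fin R)) : Matrix (Fin R) (Fin R) ℝ :=
  Matrix.of fun a b => E (a, b)

theorem inner_symPart_unflatten (q : Fin R → EuclideanSpace ℝ (Fin R))
    (E : EuclideanSpace ℝ (Fin R × Fin R)) (i j : Fin R) :
    inner ℝ (q i) ((symPart (unflatten E)).toEuclideanLin (q j)) =
      (conjCoord q E (i, j) + conjCoord q E (j, i)) / 2 := by
  have h1 : conjCoord q E (i, j) = ∑ a, ∑ b, q i a * q j b * E (a, b) := by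
    rw [conjCoord_apply, Fintype.sum_prod_type]
  have h2 : conjCoord q E (j, i) = ∑ a, ∑ b, q i a * q j b * E (b, a) := by
    rw [conjCoord_apply, Fintype.sum_prod_type, Finset.sum_comm]
    exact Finset.sum_congr rfl fun a _ => Finset.sum_congr rfl fun b _ => by ring
  rw [h1, h2, ← Finset.sum_add_distrib, PiLp.inner_apply, Finset.sum_div]
  refine Finset.sum_congr rfl fun a _ => ?_
  rw [← Finset.sum_add_distrib, Finset.sum_div, toEuclideanLin_coord]
  simp only [symPart, unflatten, Matrix.smul_apply, Matrix.add_apply,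
    Matrix.transpose_apply, Matrix.of_apply, smul_eq_mul, RCLike.inner_apply, conj_trivial,
    Finset.sum_mul]
  exact Finset.sum_congr rfl fun b _ => by ring

/-- Symmetrization does not increase the Frobenius norm, which dominates the operator norm. -/
theorem norm_symPart_unflatten_apply_le (E : EuclideanSpace ℝ (Fin R × Fin R))
    (z : EuclideanSpace ℝ (Fin R)) :
    ‖(symPart (unflatten E)).toEuclideanLin z‖ ≤ ‖E‖ * ‖z‖ := by
  refine le_of_sq_le_sq ?_ (by positivity)
  have hE : ∑ a, ∑ b, ((E (a, b) + E (b, a)) / 2) ^ 2 ≤ ‖E‖ ^ 2 := by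
    have h1 : ‖E‖ ^ 2 = ∑ a, ∑ b, E (a, b) ^ 2 := by
      rw [EuclideanSpace.real_norm_sq_eq, Fintype.sum_prod_type]
    have h2 : ‖E‖ ^ 2 = ∑ a, ∑ b, E (b, a) ^ 2 := by rw [h1, Finset.sum_comm]
    have h3 : ‖E‖ ^ 2 = ∑ a, ∑ b, (E (a, b) ^ 2 + E (b, a) ^ 2) / 2 := by
      simp only [← Finset.sum_div, Finset.sum_add_distrib]
      rw [← h1, ← h2]; ring
    rw [h3]
    refine Finset.sum_le_sum fun a _ => Finset.sum_le_sum fun b _ => ?_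
    nlinarith [sq_nonneg (E (a, b) - E (b, a))]
  rw [EuclideanSpace.real_norm_sq_eq, mul_pow]
  calc _ ≤ ∑ a, (∑ b, ((E (a, b) + E (b, a)) / 2) ^ 2) * ∑ b, z b ^ 2 := by
        refine Finset.sum_le_sum fun a _ => ?_
        rw [toEuclideanLin_coord]
        simp only [symPart, unflatten, Matrix.smul_apply,
          Matrix.add_apply, Matrix.transpose_apply, Matrix.of_apply, smul_eq_mul]
        have : ∀ b, 2⁻¹ * (E (a, b) + E (b, a)) = (E (a, b) + E (b, a)) / 2 := fun b => by ring
        simp only [this]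
        exact Finset.sum_mul_sq_le_sq_mul_sq _ _ _
    _ ≤ _ := by
        rw [← Finset.sum_mul, ← EuclideanSpace.real_norm_sq_eq]
        gcongr

set_option maxHeartbeats 1000000 in
/-- The vectors spanning the smallest part of the detector's spectrum are, as symmetric matrices,
nearly diagonalized by `q`, and together they separate the vectors `q i`. -/
theorem exists_separating_near_diagonal [FiniteDimensional ℝ H]
    (Φ : H →ₗ[ℝ] H →ₗ[ℝ] H₂) (hΦ : ∀ x y, ‖Φ x y‖ ≤ 4 * ‖x‖ * ‖y‖)
    (hsymm : ∀ x y, Φ x y = Φ y x) (u w : Fin R → H) (hu : ∀ i, Φ (u i) (u i) = 0)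
    (q : Fin R → EuclideanSpace ℝ (Fin R)) {σM α ω₀ δ U : ℝ} (hσM : 0 < σM)
    (hdet : ∀ y : {p : Fin R × Fin R // p.1 < p.2} → ℝ,
      σM ^ 2 * ∑ p, y p ^ 2 ≤ ‖∑ p, y p • Φ (u p.1.1) (u p.1.2)‖ ^ 2)
    (hα : α ≤ ω₀) (hα0 : 0 ≤ α) (hw : ∀ k, ‖w k‖ ≤ ω₀) (hwu : ∀ k, ‖w k - ∑ i, q i k • u i‖ ≤ α)
    (hU : ∀ i, ‖u i‖ ≤ U) (hδ0 : 0 ≤ δ) (hδ : δ ≤ 1 / 8)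
    (hframe : ∀ z, |∑ i, inner ℝ (q i) z ^ 2 - ‖z‖ ^ 2| ≤ δ * ‖z‖ ^ 2)
    (horth : ∀ i j, |inner ℝ (q i) (q j) - if i = j then 1 else 0| ≤ δ)
    (hsmall : 3 * (12 * R * α * ω₀) + 16 * R ^ 2 * δ * U ^ 2 ≤ σM / 6)
    {K : ℕ} (hK : K = Fintype.card {p : Fin R × Fin R // p.1 < p.2}) (hKR : 2 * K + R = R * R)
    (b : OrthonormalBasis (Fin (R * R)) ℝ (EuclideanSpace ℝ (Fin R × Fin R)))
    {lam : Fin (R * R) → ℝ} (hlam : Antitone lam)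
    (hform : ∀ E, ‖pairForm Φ w E‖ ^ 2 = ∑ t, lam t * inner ℝ (b t) E ^ 2) :
    (∀ t : Fin (R * R), K ≤ t → ∀ j,
      ‖(symPart (unflatten (b t))).toEuclideanLin (q j) -
        inner ℝ (q j) ((symPart (unflatten (b t))).toEuclideanLin (q j)) • q j‖ ≤
        2 * δ + 4 * R * (12 * R * α * ω₀) / σM) ∧
    ∀ i j, i ≠ j → ∃ t : Fin (R * R), K ≤ t ∧
      (1 : ℝ) / R ≤ |inner ℝ (q i) ((symPart (unflatten (b t))).toEuclideanLin (q i)) -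
        inner ℝ (q j) ((symPart (unflatten (b t))).toEuclideanLin (q j))| := by
  set ω := 12 * R * α * ω₀ with hω
  have hω₀ : 0 ≤ ω₀ := hα0.trans hα
  have hω0 : 0 ≤ ω := by positivity
  have hRU : 0 ≤ 16 * (R : ℝ) ^ 2 * δ * U ^ 2 := by positivity
  have hkey : ∀ E, ‖pairForm Φ w E - pairForm Φ u (conjCoord q E)‖ ≤ ω * ‖E‖ := by
    intro E
    rw [pairForm_conjCoord]
    exact norm_pairForm_sub_le Φ hΦ w _ hα hw hwu E
  have hsplit := pairForm_eq_sum_lt Φ hsymm u hu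
  have hdetE : ∀ c : EuclideanSpace ℝ (Fin R × Fin R),
      σM ^ 2 * ∑ p : {p : Fin R × Fin R // p.1 < p.2}, (c p.1 + c p.1.swap) ^ 2 ≤
        ‖pairForm Φ u c‖ ^ 2 := by
    intro c; rw [hsplit]; exact hdet _
  -- the small eigenvalues
  have hbot : ∀ t : Fin (R * R), K ≤ t → lam t ≤ ω ^ 2 := by
    intro t ht
    -- The kernel of φ has codimension at most K. It consists of the E whose congruent QᵀEQ has no
    -- symmetric off-diagonal part, so the exact detector vanishes there and only the error ω
    -- remains.
    let φ : EuclideanSpace ℝ (Fin R × Fin R) →ₗ[ℝ] ({p : Fin R × Fin R // p.1 < p.2} → ℝ) :=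
      LinearMap.pi fun p : {p : Fin R × Fin R // p.1 < p.2} => (LinearMap.proj (R := ℝ) (φ := fun _ : Fin R × Fin R => ℝ) p.1 +
          LinearMap.proj (R := ℝ) (φ := fun _ : Fin R × Fin R => ℝ) p.1.swap) ∘ₗ
        (WithLp.linearEquiv 2 ℝ (Fin R × Fin R → ℝ)).toLinearMap ∘ₗ conjCoord q
    refine eigenvalue_le_of_form_le b hlam (LinearMap.ker φ) _ t ?_ ?_
    · have := finrank_le_card_add_finrank_of_ker φ
      rw [← hK] at this
      simp only [finrank_euclideanSpace, Fintype.card_prod, Fintype.card_fin] at this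
      omega
    · intro E hE
      have h1 : pairForm Φ u (conjCoord q E) = 0 := by
        rw [hsplit]
        refine Finset.sum_eq_zero fun p _ => ?_
        have := congrFun (LinearMap.mem_ker.1 hE) p
        simp only [φ, LinearMap.pi_apply, LinearMap.comp_apply, LinearMap.add_apply,
          LinearMap.proj_apply, Pi.zero_apply] at this
        rw [show conjCoord q E p.1 + conjCoord q E p.1.swap = 0 from this, zero_smul]
      have h2 := hkey E
      rw [h1, sub_zero] at h2
      rw [← hform, ← mul_pow]
      exact pow_le_pow_left₀ (norm_nonneg _) h2 2
  -- the large eigenvalues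
  have htop : ∀ t : Fin (R * R), t < K → (σM / 4) ^ 2 ≤ lam t := by
    intro t ht
    -- Now QᵀEQ is required to be symmetric with zero diagonal. These are at most K + R conditions,
    -- and R² = 2K + R leaves a space of dimension at least K. On it the exact detector is at least
    -- (σM/2)‖E‖, of which the error ω takes at most half.
    let φ : EuclideanSpace ℝ (Fin R × Fin R) →ₗ[ℝ]
        ({p : Fin R × Fin R // p.1 < p.2} ⊕ Fin R → ℝ) :=
      LinearMap.pi fun s => Sum.elim
        (fun p : {p : Fin R × Fin R // p.1 < p.2} => (LinearMap.proj (R := ℝ) (φ := fun _ : Fin R × Fin R => ℝ) p.1 -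
          LinearMap.proj (R := ℝ) (φ := fun _ : Fin R × Fin R => ℝ) p.1.swap) ∘ₗ
          (WithLp.linearEquiv 2 ℝ (Fin R × Fin R → ℝ)).toLinearMap ∘ₗ conjCoord q)
        (fun i => (LinearMap.proj (i, i) : (Fin R × Fin R → ℝ) →ₗ[ℝ] ℝ) ∘ₗ
          (WithLp.linearEquiv 2 ℝ (Fin R × Fin R → ℝ)).toLinearMap ∘ₗ conjCoord q) s
    refine le_eigenvalue_of_le_form b hlam (LinearMap.ker φ) _ t ?_ ?_
    · have := finrank_le_card_add_finrank_of_ker φ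
      rw [Fintype.card_sum, ← hK] at this
      simp only [finrank_euclideanSpace, Fintype.card_prod, Fintype.card_fin] at this
      omega
    · intro E hE
      have h1 : ∀ p : {p : Fin R × Fin R // p.1 < p.2},
          conjCoord q E p.1 - conjCoord q E p.1.swap = 0 := fun p =>
        congrFun (LinearMap.mem_ker.1 hE) (Sum.inl p)
      have h2 : ∀ i, conjCoord q E (i, i) = 0 := fun i =>
        congrFun (LinearMap.mem_ker.1 hE) (Sum.inr i)
      have h3 : 2 * ‖conjCoord q E‖ ^ 2 = ∑ p : {p : Fin R × Fin R // p.1 < p.2},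
          (conjCoord q E p.1 + conjCoord q E p.1.swap) ^ 2 := by
        rw [EuclideanSpace.real_norm_sq_eq, sum_prod_eq_sum_lt _ (by simp [h2]), Finset.mul_sum]
        refine Finset.sum_congr rfl fun p _ => ?_
        rw [← sub_eq_zero.1 (h1 p)]; ring
      have h4 := hdetE (conjCoord q E)
      rw [← h3] at h4
      have h5 := le_norm_conjCoord_sq q (by linarith) hframe E
      have h6 : (σM / 2 * ‖E‖) ^ 2 ≤ ‖pairForm Φ u (conjCoord q E)‖ ^ 2 := by
        refine le_trans ?_ h4
        have : (1 : ℝ) / 4 ≤ (1 - δ) ^ 2 := by nlinarith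
        have h7 : 1 / 4 * ‖E‖ ^ 2 ≤ ‖conjCoord q E‖ ^ 2 :=
          le_trans (mul_le_mul_of_nonneg_right this (sq_nonneg _)) h5
        calc _ = σM ^ 2 * (1 / 4 * ‖E‖ ^ 2) := by ring
          _ ≤ σM ^ 2 * (2 * ‖conjCoord q E‖ ^ 2) := by
              apply mul_le_mul_of_nonneg_left _ (sq_nonneg _); nlinarith [sq_nonneg ‖E‖]
      have h7 := le_of_sq_le_sq h6 (norm_nonneg _)
      have h8 := norm_sub_norm_le (pairForm Φ u (conjCoord q E)) (pairForm Φ w E)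
      rw [norm_sub_rev] at h8
      have h9 := hkey E
      rw [← hform, ← mul_pow]
      refine pow_le_pow_left₀ (by positivity) ?_ 2
      have h10 : ω ≤ σM / 4 := by linarith
      nlinarith [norm_nonneg E]
  have hqn : ∀ i, ‖q i‖ ^ 2 ≤ 1 + δ := by
    intro i
    have := (abs_le.1 (horth i i)).2
    rw [real_inner_self_eq_norm_sq] at this
    simp at this; linarith
  have hqn2 : ∀ i, ‖q i‖ ≤ 2 := fun i => by nlinarith [hqn i, norm_nonneg (q i)]
  have hoff : ∀ i j, i ≠ j → |inner ℝ (q i) (q j)| ≤ δ := by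
    intro i j hij; simpa [hij] using horth i j
  constructor
  · intro t ht j
    have hbn : ‖b t‖ = 1 := b.orthonormal.1 t
    have h1 : ‖pairForm Φ w (b t)‖ ≤ ω := by
      refine le_of_sq_le_sq ?_ hω0
      rw [hform]
      calc _ = lam t := by
            rw [Finset.sum_eq_single t]
            · rw [real_inner_self_eq_norm_sq, hbn]; ring
            · intro s _ hs
              rw [b.orthonormal.2 hs]; ring
            · simp
        _ ≤ _ := hbot t ht
    have h2 := hkey (b t)
    rw [hbn, mul_one] at h2
    have h3 : ‖pairForm Φ u (conjCoord q (b t))‖ ≤ 2 * ω := by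
      have := norm_sub_norm_le (pairForm Φ u (conjCoord q (b t))) (pairForm Φ w (b t))
      rw [norm_sub_rev] at this
      linarith
    -- Independence of the detector values of distinct pairs: a small combination has small
    -- coefficients, which are the symmetrized off-diagonal entries.
    have h4 : ∀ p : {p : Fin R × Fin R // p.1 < p.2},
        |conjCoord q (b t) p.1 + conjCoord q (b t) p.1.swap| ≤ 2 * ω / σM := by
      intro p
      refine abs_le_of_sq_le_sq ?_ (by positivity)
      rw [div_pow, le_div_iff₀ (by positivity), mul_comm]
      have h5 := hdetE (conjCoord q (b t))
      have h6 := Finset.single_le_sum (f := fun p : {p : Fin R × Fin R // p.1 < p.2} =>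
        (conjCoord q (b t) p.1 + conjCoord q (b t) p.1.swap) ^ 2)
        (fun _ _ => sq_nonneg _) (Finset.mem_univ p)
      calc _ ≤ _ := mul_le_mul_of_nonneg_left h6 (sq_nonneg σM)
        _ ≤ _ := h5
        _ ≤ _ := pow_le_pow_left₀ (norm_nonneg _) h3 2
    set y := (symPart (unflatten (b t))).toEuclideanLin (q j) with hy
    have h5 : ∀ i, i ≠ j → |inner ℝ (q i) y| ≤ 2 * ω / σM := by
      intro i hij
      rw [hy, inner_symPart_unflatten]
      have h6 : |conjCoord q (b t) (i, j) + conjCoord q (b t) (j, i)| ≤ 2 * ω / σM := by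
        rcases lt_or_gt_of_ne hij with h | h
        · exact h4 ⟨(i, j), h⟩
        · rw [add_comm]; exact h4 ⟨(j, i), h⟩
      rw [abs_div, abs_two]
      linarith [abs_nonneg (conjCoord q (b t) (i, j) + conjCoord q (b t) (j, i))]
    have h6 : ‖y‖ ≤ 2 := by
      have := norm_symPart_unflatten_apply_le (b t) (q j)
      rw [hbn, one_mul] at this
      exact this.trans (hqn2 j)
    have h7 := norm_sub_frame_le q hδ0 hframe y
    have h8 : y - inner ℝ (q j) y • q j = (y - ∑ i, inner ℝ (q i) y • q i) +
        ∑ i ∈ Finset.univ.erase j, inner ℝ (q i) y • q i := by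
      rw [← Finset.add_sum_erase _ _ (Finset.mem_univ j)]; abel
    rw [h8]
    refine (norm_add_le _ _).trans (add_le_add (h7.trans (by nlinarith)) ?_)
    calc _ ≤ ∑ i ∈ Finset.univ.erase j, 2 * ω / σM * 2 := by
          refine (norm_sum_le _ _).trans (Finset.sum_le_sum fun i hi => ?_)
          rw [norm_smul, Real.norm_eq_abs]
          have := h5 i (Finset.ne_of_mem_erase hi)
          gcongr
          exact hqn2 i
      _ ≤ ∑ i : Fin R, 2 * ω / σM * 2 :=
          Finset.sum_le_sum_of_subset_of_nonneg (Finset.subset_univ _) fun _ _ _ => by positivity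
      _ = _ := by simp; ring
  · intro i j hij
    -- The matrix q_i q_iᵀ - q_j q_jᵀ nearly lies in the kernel of the detector, and its inner
    -- product with E is the difference of the diagonal entries i and j of QᵀEQ. If no bottom
    -- eigenvector separated i from j, then X would be nearly orthogonal to the bottom eigenspace,
    -- and so could not be nearly in the kernel.
    set X : EuclideanSpace ℝ (Fin R × Fin R) :=
      WithLp.toLp 2 fun p => q i p.1 * q i p.2 - q j p.1 * q j p.2 with hX
    have hR1 : (1 : ℝ) ≤ R := by exact_mod_cast i.pos
    have hbX : ∀ E : EuclideanSpace ℝ (Fin R × Fin R), inner ℝ E X =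
        conjCoord q E (i, i) - conjCoord q E (j, j) := by
      intro E
      rw [conjCoord_apply, conjCoord_apply, ← Finset.sum_sub_distrib, PiLp.inner_apply]
      refine Finset.sum_congr rfl fun p _ => ?_
      simp [hX]; ring
    have hprod : ∀ a c a' c' : Fin R, ∑ p : Fin R × Fin R, (q a p.1 * q c p.2) * (q a' p.1 * q c' p.2)
        = inner ℝ (q a) (q a') * inner ℝ (q c) (q c') := by
      intro a c a' c'
      rw [Fintype.sum_prod_type, PiLp.inner_apply, PiLp.inner_apply, Finset.sum_mul_sum]
      refine Finset.sum_congr rfl fun x _ => Finset.sum_congr rfl fun y _ => ?_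
      simp; ring
    have hcX : ∀ a c, conjCoord q X (a, c) = inner ℝ (q a) (q i) * inner ℝ (q c) (q i) -
        inner ℝ (q a) (q j) * inner ℝ (q c) (q j) := by
      intro a c
      rw [conjCoord_apply, ← hprod, ← hprod, ← Finset.sum_sub_distrib]
      refine Finset.sum_congr rfl fun p _ => ?_
      simp [hX]; ring
    have hXn : ‖X‖ ^ 2 = (‖q i‖ ^ 2) ^ 2 + (‖q j‖ ^ 2) ^ 2 - 2 * inner ℝ (q i) (q j) ^ 2 := by
      rw [← real_inner_self_eq_norm_sq, hbX, hcX, hcX]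
      simp only [real_inner_self_eq_norm_sq]
      rw [real_inner_comm (q i) (q j)]; ring
    have hqlow : ∀ i, 1 - δ ≤ ‖q i‖ ^ 2 := by
      intro i
      have := (abs_le.1 (horth i i)).1
      rw [real_inner_self_eq_norm_sq] at this
      simp at this; linarith
    have hij2 : inner ℝ (q i) (q j) ^ 2 ≤ δ ^ 2 := by
      rw [← sq_abs]; exact pow_le_pow_left₀ (abs_nonneg _) (hoff i j hij) 2
    have hXlow : 3 / 2 ≤ ‖X‖ ^ 2 := by
      rw [hXn]
      nlinarith [hqlow i, hqlow j]
    have hXup : ‖X‖ ≤ 3 := by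
      refine le_of_sq_le_sq ?_ (by norm_num)
      rw [hXn]
      nlinarith [hqn i, hqn j, hqlow i, hqlow j, sq_nonneg (inner ℝ (q i) (q j))]
    have hcoff : ∀ a c, a ≠ c → |conjCoord q X (a, c)| ≤ 4 * δ := by
      intro a c hac
      have hany : ∀ a c, |inner ℝ (q a) (q c)| ≤ 2 := by
        intro a c
        have := horth a c
        split_ifs at this with h
        · rw [abs_le] at *; constructor <;> linarith
        · rw [sub_zero] at this; linarith
      have hmul : ∀ k, |inner ℝ (q a) (q k) * inner ℝ (q c) (q k)| ≤ 2 * δ := by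
        intro k
        rw [abs_mul]
        by_cases hak : a = k
        · have : c ≠ k := fun h => hac (hak.trans h.symm)
          have h1 := hoff c k this
          have h2 := hany a k
          exact mul_le_mul h2 h1 (abs_nonneg _) (by norm_num)
        · have h1 := hoff a k hak
          have h2 := hany c k
          rw [mul_comm]
          exact mul_le_mul h2 h1 (abs_nonneg _) (by norm_num)
      rw [hcX]
      have h1 := abs_le.1 (hmul i)
      have h2 := abs_le.1 (hmul j)
      exact abs_le.2 ⟨by linarith, by linarith⟩
    have hLu : ‖pairForm Φ u (conjCoord q X)‖ ≤ 16 * R ^ 2 * δ * U ^ 2 := by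
      have hU0 : 0 ≤ U := (norm_nonneg _).trans (hU i)
      rw [pairForm]
      calc _ ≤ ∑ p : Fin R × Fin R, 16 * δ * U ^ 2 := by
            refine (norm_sum_le _ _).trans (Finset.sum_le_sum fun p _ => ?_)
            by_cases hp : p.1 = p.2
            · rw [hp, hu, smul_zero, norm_zero]; positivity
            · rw [norm_smul, Real.norm_eq_abs]
              calc _ ≤ (4 * δ) * (4 * U * U) := by
                    refine mul_le_mul (hcoff p.1 p.2 hp) ?_ (norm_nonneg _) (by positivity)
                    refine (hΦ _ _).trans ?_
                    gcongr
                    · exact hU _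
                    · exact hU _
                _ = _ := by ring
        _ = _ := by simp; ring
    have hLX : ‖pairForm Φ w X‖ ≤ σM / 6 := by
      have h1 := norm_sub_norm_le (pairForm Φ w X) (pairForm Φ u (conjCoord q X))
      have h2 := hkey X
      have h3 : ω * ‖X‖ ≤ ω * 3 := by gcongr
      linarith
    by_contra hcon
    push Not at hcon
    have hsum := b.sum_sq_inner X
    have hfX := hform X
    have hlam0 : ∀ t, 0 ≤ lam t := by
      intro t
      have h1 := hform (b t)
      rw [Finset.sum_eq_single t] at h1
      · rw [real_inner_self_eq_norm_sq, b.orthonormal.1] at h1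
        nlinarith [sq_nonneg ‖pairForm Φ w (b t)‖]
      · intro s _ hs
        rw [b.orthonormal.2 hs]; ring
      · simp
    -- Top eigenvectors are charged to the detector value of X and bottom ones to the negated claim,
    -- 1/R² each. Summation gives ‖X‖² ≤ 16/36 + 1, against the lower bound 3/2.
    have hterm : ∀ t, inner ℝ (b t) X ^ 2 ≤
        16 / σM ^ 2 * (lam t * inner ℝ (b t) X ^ 2) + 1 / (R * R) := by
      intro t
      have h0 : 0 ≤ 16 / σM ^ 2 * (lam t * inner ℝ (b t) X ^ 2) :=
        mul_nonneg (by positivity) (mul_nonneg (hlam0 t) (sq_nonneg _))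
      have h0' : (0 : ℝ) ≤ 1 / (R * R) := by positivity
      by_cases ht : t < K
      · have h1 : 1 ≤ 16 / σM ^ 2 * lam t := by
          have := htop t ht
          rw [div_mul_eq_mul_div, one_le_div (by positivity)]
          nlinarith
        nlinarith [sq_nonneg (inner ℝ (b t) X)]
      · have h1 := hcon t (not_lt.1 ht)
        rw [inner_symPart_unflatten, inner_symPart_unflatten, add_self_div_two, add_self_div_two,
          ← hbX] at h1
        have h2 : inner ℝ (b t) X ^ 2 ≤ (1 / (R : ℝ)) ^ 2 := by
          rw [← sq_abs]; exact pow_le_pow_left₀ (abs_nonneg _) h1.le 2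
        have h3 : (1 / (R : ℝ)) ^ 2 = 1 / (R * R) := by rw [div_pow, one_pow, sq]
        linarith
    have htot := Finset.sum_le_sum fun t (_ : t ∈ Finset.univ) => hterm t
    rw [Finset.sum_add_distrib, ← Finset.mul_sum, ← hfX, hsum] at htot
    have h1 : ∑ t : Fin (R * R), (1 : ℝ) / (R * R) = 1 := by
      simp only [Finset.sum_const, Finset.card_univ, Fintype.card_fin, nsmul_eq_mul, Nat.cast_mul]
      field_simp
    rw [h1] at htot
    have h2 : 16 / σM ^ 2 * ‖pairForm Φ w X‖ ^ 2 ≤ 16 / 36 := by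
      have : ‖pairForm Φ w X‖ ^ 2 ≤ (σM / 6) ^ 2 := pow_le_pow_left₀ (norm_nonneg _) hLX 2
      calc _ ≤ 16 / σM ^ 2 * (σM / 6) ^ 2 := by gcongr
        _ = _ := by field_simp; norm_num
    linarith

end Detector

/-! ### Joint approximate diagonalization by splitting -/

section Splitting

variable {R : ℕ}

theorem toEuclideanLin_mul_apply (A B : Matrix (Fin R) (Fin R) ℝ) (z : EuclideanSpace ℝ (Fin R)) :
    (A * B).toEuclideanLin z = A.toEuclideanLin (B.toEuclideanLin z) := by
  rw [Matrix.toEuclideanLin, Matrix.toLpLin_mul_same]; rfl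

theorem toEuclideanLin_sub_apply (A B : Matrix (Fin R) (Fin R) ℝ) (z : EuclideanSpace ℝ (Fin R)) :
    (A - B).toEuclideanLin z = A.toEuclideanLin z - B.toEuclideanLin z := by
  rw [map_sub]; rfl

/-- The orthogonal projection to the eigenvectors number `0, …, m` of the symmetric part of `S`. -/
def eigenProj (S : Matrix (Fin R) (Fin R) ℝ) (m : ℕ) : Matrix (Fin R) (Fin R) ℝ :=
  Matrix.of fun a b => ∑ k : Fin R,
    if k.val ≤ m then symEigenvector S k a * symEigenvector S k b else 0

/-- The eigenbasis of the symmetric part of `S`. -/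
def symBasis (S : Matrix (Fin R) (Fin R) ℝ) : OrthonormalBasis (Fin R) ℝ (EuclideanSpace ℝ (Fin R)) :=
  (symPart_isSymmetric S).eigenvectorBasis finrank_euclideanSpace_fin

theorem symBasis_apply (S : Matrix (Fin R) (Fin R) ℝ) (k : Fin R) :
    symBasis S k = symEigenvector S k := rfl

theorem symEigenvalue_antitone (S : Matrix (Fin R) (Fin R) ℝ) : Antitone (symEigenvalue S) :=
  (symPart_isSymmetric S).eigenvalues_antitone finrank_euclideanSpace_fin

theorem symPart_apply_symBasis (S : Matrix (Fin R) (Fin R) ℝ) (k : Fin R) :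
    (symPart S).toEuclideanLin (symBasis S k) = symEigenvalue S k • symBasis S k :=
  (symPart_isSymmetric S).apply_eigenvectorBasis finrank_euclideanSpace_fin k

theorem inner_symBasis_symPart (S : Matrix (Fin R) (Fin R) ℝ) (k : Fin R)
    (z : EuclideanSpace ℝ (Fin R)) :
    inner ℝ (symBasis S k) ((symPart S).toEuclideanLin z) =
      symEigenvalue S k * inner ℝ (symBasis S k) z := by
  rw [← symPart_isSymmetric, symPart_apply_symBasis, inner_smul_left, conj_trivial]

theorem eigenProj_apply (S : Matrix (Fin R) (Fin R) ℝ) (m : ℕ) (z : EuclideanSpace ℝ (Fin R)) :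
    (eigenProj S m).toEuclideanLin z =
      ∑ k : Fin R, (if k.val ≤ m then inner ℝ (symBasis S k) z else 0) • symBasis S k := by
  ext a
  rw [toEuclideanLin_coord]
  simp only [eigenProj, Matrix.of_apply, Finset.sum_mul, WithLp.ofLp_sum, Finset.sum_apply,
    PiLp.smul_apply, smul_eq_mul]
  rw [Finset.sum_comm]
  refine Finset.sum_congr rfl fun k _ => ?_
  split_ifs
  · rw [PiLp.inner_apply, Finset.sum_mul]
    refine Finset.sum_congr rfl fun b _ => ?_
    simp [symBasis_apply]; ring
  · simp

theorem inner_symBasis_eigenProj (S : Matrix (Fin R) (Fin R) ℝ) (m : ℕ)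
    (z : EuclideanSpace ℝ (Fin R)) (k : Fin R) :
    inner ℝ (symBasis S k) ((eigenProj S m).toEuclideanLin z) =
      if k.val ≤ m then inner ℝ (symBasis S k) z else 0 := by
  rw [eigenProj_apply, (symBasis S).orthonormal.inner_right_fintype]

theorem norm_eigenProj_apply_le (S : Matrix (Fin R) (Fin R) ℝ) (m : ℕ)
    (z : EuclideanSpace ℝ (Fin R)) : ‖(eigenProj S m).toEuclideanLin z‖ ≤ ‖z‖ := by
  refine le_of_sq_le_sq ?_ (norm_nonneg _)
  rw [← (symBasis S).sum_sq_inner, ← (symBasis S).sum_sq_inner]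
  refine Finset.sum_le_sum fun k _ => ?_
  rw [inner_symBasis_eigenProj]
  split_ifs
  · exact le_rfl
  · rw [zero_pow two_ne_zero]; exact sq_nonneg _

theorem norm_sub_eigenProj_apply_le (S : Matrix (Fin R) (Fin R) ℝ) (m : ℕ)
    (z : EuclideanSpace ℝ (Fin R)) : ‖z - (eigenProj S m).toEuclideanLin z‖ ≤ ‖z‖ := by
  refine le_of_sq_le_sq ?_ (norm_nonneg _)
  rw [← (symBasis S).sum_sq_inner, ← (symBasis S).sum_sq_inner]
  refine Finset.sum_le_sum fun k _ => ?_
  rw [inner_sub_right, inner_symBasis_eigenProj]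
  split_ifs
  · simp; positivity
  · simp

/-- The midpoint of the eigenvalues number `m` and `m + 1`. -/
def eigenMid (S : Matrix (Fin R) (Fin R) ℝ) (m : Fin R) (m' : Fin R) : ℝ :=
  (symEigenvalue S m + symEigenvalue S m') / 2

section Gap

variable (S : Matrix (Fin R) (Fin R) ℝ) {m m' : Fin R} (hm : m'.val = m.val + 1) {τ : ℝ} (hτ : 0 < τ)
  (hgap : τ < symEigenvalue S m - symEigenvalue S m') (z : EuclideanSpace ℝ (Fin R)) {d ε : ℝ}
  (hz : ‖(symPart S).toEuclideanLin z - d • z‖ ≤ ε)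
include hτ hz

/-- The residual has coordinate (λ_k - d)⟨b_k, z⟩ along the eigenvector b_k. So a vector with a
small residual has little mass on eigenvectors whose eigenvalue is far from d. -/
theorem sum_sq_inner_le_of_residual (p : Fin R → Prop) [DecidablePred p]
    (hp : ∀ k, p k → τ / 2 ≤ |symEigenvalue S k - d|) :
    ∑ k, (if p k then inner ℝ (symBasis S k) z else 0) ^ 2 ≤ (2 * ε / τ) ^ 2 := by
  have h1 : ∀ k, inner ℝ (symBasis S k) ((symPart S).toEuclideanLin z - d • z) =
      (symEigenvalue S k - d) * inner ℝ (symBasis S k) z := by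
    intro k
    rw [inner_sub_right, inner_symBasis_symPart, inner_smul_right]; ring
  have h2 : ∑ k, (if p k then inner ℝ (symBasis S k) z else 0) ^ 2 ≤
      ∑ k, (2 / τ) ^ 2 * inner ℝ (symBasis S k) ((symPart S).toEuclideanLin z - d • z) ^ 2 := by
    refine Finset.sum_le_sum fun k _ => ?_
    split_ifs with hk
    · rw [h1, mul_pow]
      have h3 : 1 ≤ (2 / τ) ^ 2 * (symEigenvalue S k - d) ^ 2 := by
        rw [← mul_pow, ← sq_abs, abs_mul, abs_of_pos (by positivity : 0 < 2 / τ)]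
        apply one_le_pow₀
        rw [div_mul_eq_mul_div, one_le_div hτ]
        linarith [hp k hk]
      nlinarith [sq_nonneg (inner ℝ (symBasis S k) z)]
    · rw [zero_pow two_ne_zero]; positivity
  rw [← Finset.mul_sum, (symBasis S).sum_sq_inner] at h2
  refine h2.trans ?_
  rw [mul_div_assoc, mul_comm 2, div_mul_eq_mul_div, mul_div_assoc, mul_pow, mul_comm]
  gcongr

include hgap

/-- The decision threshold is the midpoint of the gap. Wherever d lies, even inside the gap, all
eigenvalues on the opposite side are at distance at least τ/2, so an approximate eigenvector is
never cut in two. -/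
theorem norm_eigenProj_apply_le_of_le_mid (hd : d ≤ eigenMid S m m') :
    ‖(eigenProj S m).toEuclideanLin z‖ ≤ 2 * ε / τ := by
  have hε : 0 ≤ ε := (norm_nonneg _).trans hz
  refine le_of_sq_le_sq ?_ (by positivity)
  rw [← (symBasis S).sum_sq_inner]
  simp only [inner_symBasis_eigenProj]
  refine sum_sq_inner_le_of_residual S hτ z hz (fun k : Fin R => k.val ≤ m) fun k hk => ?_
  have h1 := symEigenvalue_antitone S (show k ≤ m from hk)
  rw [eigenMid] at hd
  exact le_trans (by linarith) (le_abs_self _)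

include hm in
theorem norm_sub_eigenProj_apply_le_of_mid_lt (hd : eigenMid S m m' < d) :
    ‖(eigenProj S m).toEuclideanLin z - z‖ ≤ 2 * ε / τ := by
  have hε : 0 ≤ ε := (norm_nonneg _).trans hz
  rw [norm_sub_rev]
  refine le_of_sq_le_sq ?_ (by positivity)
  rw [← (symBasis S).sum_sq_inner]
  have h0 : ∀ k, inner ℝ (symBasis S k) (z - (eigenProj S m).toEuclideanLin z) =
      if ¬ k.val ≤ m then inner ℝ (symBasis S k) z else 0 := by
    intro k
    rw [inner_sub_right, inner_symBasis_eigenProj]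
    by_cases h : k.val ≤ m <;> simp [h]
  simp only [h0]
  refine sum_sq_inner_le_of_residual S hτ z hz (fun k : Fin R => ¬ k.val ≤ m) fun k hk => ?_
  have h1 := symEigenvalue_antitone S (show m' ≤ k from by rw [Fin.le_def]; omega)
  rw [eigenMid] at hd
  rw [abs_sub_comm]
  exact le_trans (by linarith) (le_abs_self _)

end Gap

/-- An approximate eigenvalue is close to an eigenvalue. -/
theorem exists_symEigenvalue_near (S : Matrix (Fin R) (Fin R) ℝ) (z : EuclideanSpace ℝ (Fin R))
    {d ε : ℝ} (hz : ‖(symPart S).toEuclideanLin z - d • z‖ ≤ ε) (hn : 1 / 2 < ‖z‖) :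
    ∃ k, |symEigenvalue S k - d| ≤ 2 * ε := by
  by_contra hcon
  push Not at hcon
  have hε : 0 ≤ ε := (norm_nonneg _).trans hz
  rcases hε.eq_or_lt with rfl | hpos
  · have hz0 : ‖z‖ ^ 2 = 0 := by
      rw [← (symBasis S).sum_sq_inner]
      refine Finset.sum_eq_zero fun k _ => ?_
      have h0 : (symPart S).toEuclideanLin z = d • z := by
        rw [← sub_eq_zero]; exact norm_le_zero_iff.1 hz
      have h1 := inner_symBasis_symPart S k z
      rw [h0, inner_smul_right] at h1
      have h2 := hcon k
      rw [mul_zero, abs_pos] at h2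
      have : (symEigenvalue S k - d) * inner ℝ (symBasis S k) z = 0 := by rw [sub_mul, h1, sub_self]
      rw [(mul_eq_zero.1 this).resolve_left h2]; ring
    nlinarith
  · have h1 := sum_sq_inner_le_of_residual S (τ := 4 * ε) (by positivity) z hz (fun _ => True)
      (fun k _ => by linarith [hcon k])
    simp only [if_true, (symBasis S).sum_sq_inner] at h1
    have h2 : 2 * ε / (4 * ε) = 1 / 2 := by field_simp; norm_num
    rw [h2] at h1
    have := le_of_sq_le_sq h1 (by norm_num)
    linarith

/-- Two well separated approximate eigenvalues are separated by a gap in the spectrum. -/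
theorem exists_gap_between (S : Matrix (Fin R) (Fin R) ℝ) (z z' : EuclideanSpace ℝ (Fin R))
    {d d' ε : ℝ} (hz : ‖(symPart S).toEuclideanLin z - d • z‖ ≤ ε)
    (hz' : ‖(symPart S).toEuclideanLin z' - d' • z'‖ ≤ ε) (hn : 1 / 2 < ‖z‖) (hn' : 1 / 2 < ‖z'‖)
    (hε : 8 * ε ≤ 1 / R ^ 2) (hd : 1 / R ≤ d - d') :
    ∃ m m' : Fin R, m'.val = m.val + 1 ∧ 1 / (R : ℝ) ^ 2 < symEigenvalue S m - symEigenvalue S m' ∧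
      eigenMid S m m' < d ∧ d' ≤ eigenMid S m m' := by
  obtain ⟨s, hs⟩ := exists_symEigenvalue_near S z hz hn
  obtain ⟨t, ht⟩ := exists_symEigenvalue_near S z' hz' hn'
  have hRpos : (0 : ℝ) < R := by exact_mod_cast s.pos
  have hs' := abs_le.1 hs
  have ht' := abs_le.1 ht
  have hR2 : 1 / (R : ℝ) = R * (1 / R ^ 2) := by field_simp
  have hε0 : 0 < 1 / (R : ℝ) ^ 2 := by positivity
  set τ := 1 / (R : ℝ) ^ 2 with hτ
  set f : ℕ → ℝ := fun k => if h : k < R then symEigenvalue S ⟨k, h⟩ else 0 with hf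
  have hfv : ∀ k : Fin R, f k = symEigenvalue S k := fun k => by simp [hf]
  have hdiff : (R - 1 : ℝ) * τ < f s - f t := by
    rw [hfv, hfv]; nlinarith
  have hst : s.val ≤ t.val := by
    by_contra h
    have := symEigenvalue_antitone S (show t ≤ s from by rw [Fin.le_def]; omega)
    rw [hfv, hfv] at hdiff
    have : (0 : ℝ) ≤ (R - 1) * τ := mul_nonneg (by
      have : (1 : ℝ) ≤ R := by exact_mod_cast s.pos
      linarith) hε0.le
    linarith
  -- Pigeonhole: a total drop of more than (R - 1)τ is spread over at most R - 1 consecutive steps.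
  have hex : ∃ k ∈ Finset.Ico s.val t.val, τ < f k - f (k + 1) := by
    by_contra hcon
    push Not at hcon
    have h1 : f s - f t = ∑ k ∈ Finset.Ico s.val t.val, (f k - f (k + 1)) := by
      have := Finset.sum_Ico_sub f hst
      rw [← neg_inj, neg_sub, ← this, ← Finset.sum_neg_distrib]
      simp
    have h2 : ∑ k ∈ Finset.Ico s.val t.val, (f k - f (k + 1)) ≤
        ∑ k ∈ Finset.Ico s.val t.val, τ := Finset.sum_le_sum hcon
    simp only [Finset.sum_const, Nat.card_Ico, nsmul_eq_mul] at h2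
    have h3 : ((t.val - s.val : ℕ) : ℝ) ≤ R - 1 := by
      have : t.val - s.val + 1 ≤ R := by omega
      have : ((t.val - s.val + 1 : ℕ) : ℝ) ≤ R := by exact_mod_cast this
      push_cast at this ⊢
      linarith
    have h4 : ((t.val - s.val : ℕ) : ℝ) * τ ≤ (R - 1) * τ := by gcongr
    linarith
  obtain ⟨k, hk, hkgap⟩ := hex
  rw [Finset.mem_Ico] at hk
  have hkR : k < R := by omega
  have hkR' : k + 1 < R := by omega
  have e1 : f k = symEigenvalue S ⟨k, hkR⟩ := by simp [hf, hkR]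
  have e2 : f (k + 1) = symEigenvalue S ⟨k + 1, hkR'⟩ := by simp [hf, hkR']
  rw [e1, e2] at hkgap
  have h5 := symEigenvalue_antitone S (show s ≤ ⟨k, hkR⟩ from hk.1)
  have h6 := symEigenvalue_antitone S (show (⟨k + 1, hkR'⟩ : Fin R) ≤ t from by
    rw [Fin.le_def]; exact hk.2)
  -- The midpoint is more than τ/2 away from the eigenvalues s and t, which approximate d and d' to
  -- within 2ε ≤ τ/4.
  refine ⟨⟨k, hkR⟩, ⟨k + 1, hkR'⟩, rfl, hkgap, ?_, ?_⟩ <;> rw [eigenMid] <;> linarith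

/-! ### Operators acting on a nearly orthonormal family as coordinate projections -/

/-- Up to an error `e`, `X` fixes the vectors `q j` with `j ∈ C` and kills the others. -/
def ActsAs (q : Fin R → EuclideanSpace ℝ (Fin R)) (X : Matrix (Fin R) (Fin R) ℝ)
    (C : Finset (Fin R)) (e : ℝ) : Prop :=
  ∀ j, ‖X.toEuclideanLin (q j) - (if j ∈ C then (1 : ℝ) else 0) • q j‖ ≤ e

theorem ActsAs.mono {q : Fin R → EuclideanSpace ℝ (Fin R)} {X : Matrix (Fin R) (Fin R) ℝ}
    {C : Finset (Fin R)} {e e' : ℝ} (h : ActsAs q X C e) (he : e ≤ e') : ActsAs q X C e' :=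
  fun j => (h j).trans he

theorem ActsAs.one (q : Fin R → EuclideanSpace ℝ (Fin R)) : ActsAs q 1 Finset.univ 0 := by
  intro j; simp

/-- `X` does not increase norms by more than a factor `ρ`. -/
def NormLe (X : Matrix (Fin R) (Fin R) ℝ) (ρ : ℝ) : Prop := ∀ z, ‖X.toEuclideanLin z‖ ≤ ρ * ‖z‖

theorem NormLe.one : NormLe (1 : Matrix (Fin R) (Fin R) ℝ) 1 := fun z => by
  simp

theorem NormLe.sub {X Y : Matrix (Fin R) (Fin R) ℝ} {a b : ℝ} (hX : NormLe X a) (hY : NormLe Y b) :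
    NormLe (X - Y) (a + b) := fun z => by
  rw [toEuclideanLin_sub_apply, add_mul]
  exact (norm_sub_le _ _).trans (add_le_add (hX z) (hY z))

theorem NormLe.mul {X Y : Matrix (Fin R) (Fin R) ℝ} {a b : ℝ} (ha : 0 ≤ a) (hX : NormLe X a)
    (hY : NormLe Y b) : NormLe (X * Y) (a * b) := fun z => by
  rw [toEuclideanLin_mul_apply, mul_assoc]
  exact (hX _).trans (mul_le_mul_of_nonneg_left (hY z) ha)

/-- The accumulated error is multiplied only by the norm of the new left factor. For orthogonal
projections this norm is at most 1, so errors of successive splittings merely add up. -/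
theorem ActsAs.mul {q : Fin R → EuclideanSpace ℝ (Fin R)} {X P : Matrix (Fin R) (Fin R) ℝ}
    {C D : Finset (Fin R)} {e e' ρ : ℝ} (hρ : 0 ≤ ρ) (hP : ActsAs q P D e') (hPn : NormLe P ρ)
    (hX : ActsAs q X C e) : ActsAs q (P * X) (D ∩ C) (ρ * e + e') := by
  intro j
  have hs : (if j ∈ D ∩ C then (1 : ℝ) else 0) =
      (if j ∈ C then (1 : ℝ) else 0) * (if j ∈ D then 1 else 0) := by
    by_cases h1 : j ∈ C <;> by_cases h2 : j ∈ D <;> simp [h1, h2]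
  have e1 : (P * X).toEuclideanLin (q j) - (if j ∈ D ∩ C then (1 : ℝ) else 0) • q j =
      P.toEuclideanLin (X.toEuclideanLin (q j) - (if j ∈ C then (1 : ℝ) else 0) • q j) +
        (if j ∈ C then (1 : ℝ) else 0) •
          (P.toEuclideanLin (q j) - (if j ∈ D then (1 : ℝ) else 0) • q j) := by
    rw [toEuclideanLin_mul_apply, map_sub, map_smul, hs, smul_sub, smul_smul]; abel
  rw [e1]
  refine (norm_add_le _ _).trans (add_le_add ((hPn _).trans ?_) ?_)
  · exact mul_le_mul_of_nonneg_left (hX j) hρ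
  · rw [norm_smul]
    have h0 := (norm_nonneg _).trans (hP j)
    by_cases hc : j ∈ C
    · rw [if_pos hc, norm_one, one_mul]; exact hP j
    · rw [if_neg hc, norm_zero, zero_mul]; exact h0

theorem ActsAs.sub {q : Fin R → EuclideanSpace ℝ (Fin R)} {X Y : Matrix (Fin R) (Fin R) ℝ}
    {C D : Finset (Fin R)} {e e' : ℝ} (hX : ActsAs q X C e) (hY : ActsAs q Y D e') (hDC : D ⊆ C) :
    ActsAs q (X - Y) (C \ D) (e + e') := by
  intro j
  have hs : (if j ∈ C \ D then (1 : ℝ) else 0) =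
      (if j ∈ C then (1 : ℝ) else 0) - (if j ∈ D then 1 else 0) := by
    by_cases h2 : j ∈ D
    · simp [h2, hDC h2]
    · by_cases h1 : j ∈ C <;> simp [h1, h2]
  have e1 : (X - Y).toEuclideanLin (q j) - (if j ∈ C \ D then (1 : ℝ) else 0) • q j =
      (X.toEuclideanLin (q j) - (if j ∈ C then (1 : ℝ) else 0) • q j) -
        (Y.toEuclideanLin (q j) - (if j ∈ D then (1 : ℝ) else 0) • q j) := by
    rw [toEuclideanLin_sub_apply, hs, sub_smul]; abel
  rw [e1]
  exact (norm_sub_le _ _).trans (add_le_add (hX j) (hY j))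

/-- The sum of the squares of the entries. -/
def entrySq (Z : Matrix (Fin R) (Fin R) ℝ) : ℝ := ∑ a, ∑ b, Z a b ^ 2

theorem norm_apply_sq_le_entrySq (Z : Matrix (Fin R) (Fin R) ℝ) (z : EuclideanSpace ℝ (Fin R)) :
    ‖Z.toEuclideanLin z‖ ^ 2 ≤ entrySq Z * ‖z‖ ^ 2 := by
  rw [EuclideanSpace.real_norm_sq_eq, EuclideanSpace.real_norm_sq_eq, entrySq, Finset.sum_mul]
  refine Finset.sum_le_sum fun a _ => ?_
  rw [toEuclideanLin_coord]
  exact Finset.sum_mul_sq_le_sq_mul_sq _ _ _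

/-- The frame inequality is applied to every row of Z. -/
theorem entrySq_le_of_frame {q : Fin R → EuclideanSpace ℝ (Fin R)} {δ : ℝ}
    (hframe : ∀ z, |∑ i, inner ℝ (q i) z ^ 2 - ‖z‖ ^ 2| ≤ δ * ‖z‖ ^ 2)
    (Z : Matrix (Fin R) (Fin R) ℝ) :
    (1 - δ) * entrySq Z ≤ ∑ j, ‖Z.toEuclideanLin (q j)‖ ^ 2 := by
  have h1 : ∀ a, (1 - δ) * ∑ b, Z a b ^ 2 ≤ ∑ j, (Z.toEuclideanLin (q j) a) ^ 2 := by
    intro a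
    have h2 := (abs_le.1 (hframe (WithLp.toLp 2 (Z a)))).1
    rw [EuclideanSpace.real_norm_sq_eq] at h2
    have h3 : ∀ j, inner ℝ (q j) (WithLp.toLp 2 (Z a)) = Z.toEuclideanLin (q j) a := by
      intro j
      rw [toEuclideanLin_coord, PiLp.inner_apply]; simp
    simp only [h3] at h2
    linarith
  rw [entrySq, Finset.mul_sum]
  refine (Finset.sum_le_sum fun a _ => h1 a).trans (le_of_eq ?_)
  rw [Finset.sum_comm]
  simp only [EuclideanSpace.real_norm_sq_eq]

/-- A near projection to the coordinates in C has almost no entries when C is empty, and otherwise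
nearly fixes some almost unit vector. So a computable quantity decides whether the unknown set C is
empty, with a wide margin around 1/2. -/
theorem half_lt_entrySq_iff {q : Fin R → EuclideanSpace ℝ (Fin R)} {δ e : ℝ} (hδ : δ ≤ 1 / 8)
    (hframe : ∀ z, |∑ i, inner ℝ (q i) z ^ 2 - ‖z‖ ^ 2| ≤ δ * ‖z‖ ^ 2)
    (horth : ∀ i j, |inner ℝ (q i) (q j) - if i = j then 1 else 0| ≤ δ)
    {Z : Matrix (Fin R) (Fin R) ℝ} {C : Finset (Fin R)} (hZ : ActsAs q Z C e)
    (he : 20 * R * e ≤ 1) (he0 : 0 ≤ e) : 1 / 2 < entrySq Z ↔ C.Nonempty := by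
  constructor
  · intro h
    by_contra hC
    rw [Finset.not_nonempty_iff_eq_empty] at hC
    subst hC
    have h1 : ∑ j, ‖Z.toEuclideanLin (q j)‖ ^ 2 ≤ ∑ j : Fin R, e ^ 2 := by
      refine Finset.sum_le_sum fun j _ => ?_
      have := hZ j
      simp only [Finset.notMem_empty, if_false, zero_smul, sub_zero] at this
      exact pow_le_pow_left₀ (norm_nonneg _) this 2
    have h2 := entrySq_le_of_frame hframe Z
    simp only [Finset.sum_const, Finset.card_univ, Fintype.card_fin, nsmul_eq_mul] at h1
    rcases Nat.eq_zero_or_pos R with h0 | h0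
    · subst h0; simp [entrySq] at h; linarith
    have hR : (1 : ℝ) ≤ R := by exact_mod_cast h0
    have h3 : (R : ℝ) * e ≤ 1 / 20 := by linarith
    have h4 : e ≤ 1 / 20 := by nlinarith
    have h5 : (R : ℝ) * e ^ 2 ≤ 1 / 20 * (1 / 20) := by
      rw [sq, ← mul_assoc]; exact mul_le_mul h3 h4 he0 (by norm_num)
    nlinarith
  · rintro ⟨j, hj⟩
    have hR : (1 : ℝ) ≤ R := by exact_mod_cast j.pos
    have h4 : e ≤ 1 / 20 := by nlinarith
    have h1 := hZ j
    rw [if_pos hj, one_smul] at h1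
    have h2 := norm_sub_norm_le (q j) (Z.toEuclideanLin (q j))
    rw [norm_sub_rev] at h2
    have h3 := norm_apply_sq_le_entrySq Z (q j)
    have h5 := abs_le.1 (horth j j)
    rw [real_inner_self_eq_norm_sq, if_pos rfl] at h5
    have h6 : 9 / 10 ≤ ‖q j‖ := le_of_sq_le_sq (by nlinarith) (norm_nonneg _)
    by_contra hcon
    push Not at hcon
    have h7 : (‖q j‖ - 1 / 20) ^ 2 ≤ ‖Z.toEuclideanLin (q j)‖ ^ 2 :=
      pow_le_pow_left₀ (by linarith) (by linarith) 2
    nlinarith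

/-- If `X` acts as the projection to one coordinate, it is close to `z ↦ ⟪q i, z⟫ q i`. -/
theorem norm_apply_sub_rankOne_le {q : Fin R → EuclideanSpace ℝ (Fin R)} {δ e : ℝ} (hδ0 : 0 ≤ δ)
    (hδ : δ ≤ 1 / 8)
    (hframe : ∀ z, |∑ i, inner ℝ (q i) z ^ 2 - ‖z‖ ^ 2| ≤ δ * ‖z‖ ^ 2)
    (horth : ∀ i j, |inner ℝ (q i) (q j) - if i = j then 1 else 0| ≤ δ)
    {X : Matrix (Fin R) (Fin R) ℝ} {i : Fin R} (hX : ActsAs q X {i} e) (hXn : NormLe X 1)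
    (z : EuclideanSpace ℝ (Fin R)) :
    ‖X.toEuclideanLin z - inner ℝ (q i) z • q i‖ ≤ (δ + 2 * R * e) * ‖z‖ := by
  have he0 : 0 ≤ e := (norm_nonneg _).trans (hX i)
  have hqn2 : ∀ i, ‖q i‖ ≤ 2 := by
    intro i
    have := (abs_le.1 (horth i i)).2
    rw [real_inner_self_eq_norm_sq, if_pos rfl] at this
    nlinarith [norm_nonneg (q i)]
  -- Expand z in the family q and apply X term by term; the unexpanded remainder is small by the
  -- frame bound and X does not enlarge it.
  have e1 : X.toEuclideanLin z - inner ℝ (q i) z • q i =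
      X.toEuclideanLin (z - ∑ j, inner ℝ (q j) z • q j) +
        ∑ j, inner ℝ (q j) z • (X.toEuclideanLin (q j) -
          (if j ∈ ({i} : Finset (Fin R)) then (1 : ℝ) else 0) • q j) := by
    simp only [smul_sub, Finset.sum_sub_distrib, map_sub, map_sum, map_smul, Finset.mem_singleton,
      ite_smul, one_smul, zero_smul, smul_ite, smul_zero, Finset.sum_ite_eq', Finset.mem_univ,
      if_true]
    abel
  rw [e1, add_mul]
  refine (norm_add_le _ _).trans (add_le_add ?_ ?_)
  · have := hXn (z - ∑ j, inner ℝ (q j) z • q j)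
    rw [one_mul] at this
    exact this.trans (norm_sub_frame_le q hδ0 hframe z)
  · calc _ ≤ ∑ j : Fin R, 2 * ‖z‖ * e := by
          refine (norm_sum_le _ _).trans (Finset.sum_le_sum fun j _ => ?_)
          rw [norm_smul]
          refine mul_le_mul ((norm_inner_le_norm _ _).trans ?_) (hX j) (norm_nonneg _) (by positivity)
          gcongr
          exact hqn2 j
      _ = _ := by simp; ring

end Splitting

/-! ### Invariant of a pass and the choice of a branch -/

section Passes

variable {R : ℕ}

/-- The data of approximate joint diagonalization: the symmetric parts of the matrices `S t`, `t < T`,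
are nearly diagonalized by the nearly orthonormal family `q`, with approximate eigenvalues `d t j`,
and together they separate the family. -/
structure NearlyJointlyDiagonal (q : Fin R → EuclideanSpace ℝ (Fin R)) (δ : ℝ) (T : ℕ)
    (S : ℕ → Matrix (Fin R) (Fin R) ℝ) (d : ℕ → Fin R → ℝ) (e : ℝ) : Prop where
  nonneg : 0 ≤ δ
  le : δ ≤ 1 / 8
  frame : ∀ z, |∑ i, inner ℝ (q i) z ^ 2 - ‖z‖ ^ 2| ≤ δ * ‖z‖ ^ 2
  orth : ∀ i j, |inner ℝ (q i) (q j) - if i = j then 1 else 0| ≤ δ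
  residual : ∀ t < T, ∀ j,
    ‖(symPart (S t)).toEuclideanLin (q j) - d t j • q j‖ ≤ e / (2 * (R : ℝ) ^ 2)
  separates : ∀ i j, i ≠ j → ∃ t < T, 1 / (R : ℝ) ≤ |d t i - d t j|
  count_le : T ≤ R * R
  error_nonneg : 0 ≤ e
  error_le : 100 * (R : ℝ) ^ 5 * e ≤ 1

/-- There is a spectral gap between the eigenvalues number `m` and `m + 1`. -/
def HasGap (S : Matrix (Fin R) (Fin R) ℝ) (m m' : Fin R) : Prop :=
  m'.val = m.val + 1 ∧ 1 / (R : ℝ) ^ 2 < symEigenvalue S m - symEigenvalue S m'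

/-- `X` nearly projects to the coordinates in a class which meets `U` and which respects all the
gaps of `S t`, `t < k`, and the gaps of `S k` before `m`. -/
def ClassInv (q : Fin R → EuclideanSpace ℝ (Fin R)) (S : ℕ → Matrix (Fin R) (Fin R) ℝ)
    (d : ℕ → Fin R → ℝ) (e : ℝ) (U : Finset (Fin R)) (k m : ℕ) (X : Matrix (Fin R) (Fin R) ℝ) :
    Prop :=
  ∃ C : Finset (Fin R), NormLe X 1 ∧ ActsAs q X C ((k * R + m) * e) ∧ (C ∩ U).Nonempty ∧
    ∀ i ∈ C, ∀ j ∈ C, ∀ t a b, HasGap (S t) a b → (t < k ∨ t = k ∧ a.val < m) →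
      (eigenMid (S t) a b < d t i ↔ eigenMid (S t) a b < d t j)

theorem ClassInv.start (q : Fin R → EuclideanSpace ℝ (Fin R)) (S : ℕ → Matrix (Fin R) (Fin R) ℝ)
    (d : ℕ → Fin R → ℝ) (e : ℝ) {U : Finset (Fin R)} (hU : U.Nonempty) :
    ClassInv q S d e U 0 0 1 :=
  ⟨Finset.univ, NormLe.one, by simpa using ActsAs.one q, by simpa using hU, by simp⟩

/-- A gap after eigenvalue m needs m + 1 < R, so R - 1 steps exhaust the gaps of one matrix.
Rounding their number up to R makes the error after k matrices simply k R e. -/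
theorem ClassInv.next {q : Fin R → EuclideanSpace ℝ (Fin R)} {S : ℕ → Matrix (Fin R) (Fin R) ℝ}
    {d : ℕ → Fin R → ℝ} {e : ℝ} (he : 0 ≤ e) {U : Finset (Fin R)} {k : ℕ}
    {X : Matrix (Fin R) (Fin R) ℝ}
    (h : ClassInv q S d e U k (R - 1) X) : ClassInv q S d e U (k + 1) 0 X := by
  obtain ⟨C, h1, h2, h3, h4⟩ := h
  refine ⟨C, h1, h2.mono ?_, h3, fun i hi j hj t a b hg ht => h4 i hi j hj t a b hg ?_⟩
  · have : ((R - 1 : ℕ) : ℝ) ≤ R := by exact_mod_cast Nat.sub_le R 1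
    apply mul_le_mul_of_nonneg_right _ he
    push_cast
    linarith
  · have := hg.1
    have := b.2
    omega

theorem ClassInv.skip {q : Fin R → EuclideanSpace ℝ (Fin R)} {S : ℕ → Matrix (Fin R) (Fin R) ℝ}
    {d : ℕ → Fin R → ℝ} {e : ℝ} (he : 0 ≤ e) {U : Finset (Fin R)} {k m : ℕ}
    {X : Matrix (Fin R) (Fin R) ℝ} (h : ClassInv q S d e U k m X)
    (hno : ∀ a b, a.val = m → ¬ HasGap (S k) a b) : ClassInv q S d e U k (m + 1) X := by
  obtain ⟨C, h1, h2, h3, h4⟩ := h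
  refine ⟨C, h1, h2.mono ?_, h3, fun i hi j hj t a b hg ht => h4 i hi j hj t a b hg ?_⟩
  · apply mul_le_mul_of_nonneg_right _ he
    push_cast; linarith
  · rcases ht with ht | ⟨rfl, ht⟩
    · exact .inl ht
    · right
      refine ⟨rfl, lt_of_le_of_ne (by omega) fun h => hno a b h hg⟩

namespace NearlyJointlyDiagonal

variable {q : Fin R → EuclideanSpace ℝ (Fin R)} {δ : ℝ} {T : ℕ}
  {S : ℕ → Matrix (Fin R) (Fin R) ℝ} {d : ℕ → Fin R → ℝ} {e : ℝ}

/-- The residual e/(2R²) in the structure is calibrated to the gap 1/R²: a spectral projection at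
such a gap has error exactly e. -/
theorem actsAs_eigenProj (h : NearlyJointlyDiagonal q δ T S d e) {t : ℕ} (ht : t < T) {a b : Fin R}
    (hg : HasGap (S t) a b) :
    ActsAs q (eigenProj (S t) a) (Finset.univ.filter fun j => eigenMid (S t) a b < d t j) e := by
  intro j
  have hR : (1 : ℝ) ≤ R := by exact_mod_cast j.pos
  have hτ : 0 < 1 / (R : ℝ) ^ 2 := by positivity
  have he : 2 * (e / (2 * (R : ℝ) ^ 2)) / (1 / (R : ℝ) ^ 2) = e := by field_simp
  by_cases hd : eigenMid (S t) a b < d t j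
  · have := norm_sub_eigenProj_apply_le_of_mid_lt (S t) hg.1 hτ hg.2 (q j) (h.residual t ht j) hd
    rw [he] at this
    simpa [hd] using this
  · have := norm_eigenProj_apply_le_of_le_mid (S t) hτ hg.2 (q j) (h.residual t ht j)
      (not_lt.1 hd)
    rw [he] at this
    simpa [hd] using this

/-- `Rem` nearly projects to the set U of components not yet found, so the product tested nearly
projects to U ∩ D ∩ C. If this set is nonempty, the half D ∩ C is kept. Otherwise the complementary
half of C meets U, because C does. Following a single branch keeps the number of steps polynomial.
-/
theorem split (h : NearlyJointlyDiagonal q δ T S d e) {U : Finset (Fin R)} {k m p : ℕ} (hk : k < T)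
    (hp : p ≤ R) {X Rem : Matrix (Fin R) (Fin R) ℝ} (hX : ClassInv q S d e U k m X)
    (hRem : ActsAs q Rem U (p * (R : ℝ) ^ 3 * e)) (hRn : NormLe Rem (1 + p))
    {a b : Fin R} (ha : a.val = m) (hg : HasGap (S k) a b) :
    (1 / 2 < entrySq (Rem * (eigenProj (S k) a * X)) →
      ClassInv q S d e U k (m + 1) (eigenProj (S k) a * X)) ∧
    (¬ 1 / 2 < entrySq (Rem * (eigenProj (S k) a * X)) →
      ClassInv q S d e U k (m + 1) (X - eigenProj (S k) a * X)) := by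
  obtain ⟨C, h1, h2, h3, h4⟩ := hX
  set P := eigenProj (S k) a with hP
  set D := Finset.univ.filter fun j => eigenMid (S k) a b < d k j with hD
  have hR : (1 : ℝ) ≤ R := by exact_mod_cast a.pos
  have he0 := h.error_nonneg
  have hPa : ActsAs q P D e := h.actsAs_eigenProj hk hg
  have hPn : NormLe P 1 := fun z => by
    rw [one_mul]; exact norm_eigenProj_apply_le _ _ z
  have hPn' : NormLe (1 - P) 1 := fun z => by
    rw [one_mul, toEuclideanLin_sub_apply]
    simpa using norm_sub_eigenProj_apply_le (S k) a z
  have hPa' : ActsAs q (1 - P) Dᶜ e := by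
    have := (ActsAs.one q).sub hPa (Finset.subset_univ D)
    rwa [zero_add, ← Finset.compl_eq_univ_sdiff] at this
  have hY : ActsAs q (P * X) (D ∩ C) (1 * ((k * R + m) * e) + e) := hPa.mul zero_le_one hPn h2
  have hXY : X - P * X = (1 - P) * X := by rw [sub_mul, one_mul]
  have hY' : ActsAs q (X - P * X) (Dᶜ ∩ C) (1 * ((k * R + m) * e) + e) := by
    rw [hXY]; exact hPa'.mul zero_le_one hPn' h2
  have hYn : NormLe (P * X) 1 := by simpa using hPn.mul zero_le_one h1
  have hYn' : NormLe (X - P * X) 1 := by rw [hXY]; simpa using hPn'.mul zero_le_one h1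
  have herr : 1 * ((k * R + m) * e) + e = (k * R + (m + 1 : ℕ)) * e := by push_cast; ring
  rw [herr] at hY hY'
  have hZ := hRem.mul (by positivity) hRn hY
  -- There are at most R³ splittings before this test, and p ≤ R. The error of the product is
  -- therefore at most 3R⁴e, and 20R times this is below 100R⁵e ≤ 1.
  have hiff := half_lt_entrySq_iff h.le h.frame h.orth hZ (by
    have hkR : (k : ℝ) + 1 ≤ R * R := by
      have : k + 1 ≤ R * R := by have := h.count_le; omega
      exact_mod_cast this
    have hmR : ((m + 1 : ℕ) : ℝ) ≤ R := by exact_mod_cast (show m + 1 ≤ R by omega)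
    have hpR : (p : ℝ) ≤ R := by exact_mod_cast hp
    have h5 : (k : ℝ) * R + (m + 1 : ℕ) ≤ R ^ 3 := by nlinarith
    calc 20 * R * ((1 + p) * ((k * R + (m + 1 : ℕ)) * e) + p * (R : ℝ) ^ 3 * e)
        ≤ 20 * R * ((R + R) * (R ^ 3 * e) + R * (R : ℝ) ^ 3 * e) := by gcongr
      _ = 60 * (R : ℝ) ^ 5 * e := by ring
      _ ≤ 100 * (R : ℝ) ^ 5 * e := by
          have : 0 ≤ (R : ℝ) ^ 5 * e := by positivity
          nlinarith
      _ ≤ 1 := h.error_le) (by positivity)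
  have hagree : ∀ C' ⊆ C, (∀ i ∈ C', ∀ j ∈ C', (i ∈ D ↔ j ∈ D)) →
      ∀ i ∈ C', ∀ j ∈ C', ∀ t a' b', HasGap (S t) a' b' → (t < k ∨ t = k ∧ a'.val < m + 1) →
        (eigenMid (S t) a' b' < d t i ↔ eigenMid (S t) a' b' < d t j) := by
    intro C' hC' hDC i hi j hj t a' b' hg' ht
    by_cases hlast : t = k ∧ a'.val = m
    · obtain ⟨rfl, ha'⟩ := hlast
      have hb := hg.1
      have hb' := hg'.1
      obtain rfl : a' = a := Fin.ext (by omega)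
      obtain rfl : b' = b := Fin.ext (by omega)
      simpa [hD] using hDC i hi j hj
    · exact h4 i (hC' hi) j (hC' hj) t a' b' hg' (by omega)
  constructor
  · intro hlt
    have hne := hiff.1 hlt
    refine ⟨D ∩ C, hYn, hY, ?_, hagree _ Finset.inter_subset_right ?_⟩
    · rwa [Finset.inter_comm]
    · intro i hi j hj
      simp only [Finset.mem_inter] at hi hj
      simp [hi.1, hj.1]
  · intro hlt
    have hne := mt hiff.2 hlt
    refine ⟨Dᶜ ∩ C, hYn', hY', ?_, hagree _ Finset.inter_subset_right ?_⟩
    · obtain ⟨i, hi⟩ := h3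
      rw [Finset.mem_inter] at hi
      refine ⟨i, ?_⟩
      by_cases hiD : i ∈ D
      · exact absurd ⟨i, by simp [hi.1, hi.2, hiD]⟩ hne
      · simp [hi.1, hi.2, hiD]
    · intro i hi j hj
      simp only [Finset.mem_inter, Finset.mem_compl] at hi hj
      simp [hi.1, hj.1]

/-- Two indices in the final class would differ by at least 1/R in some `d t`. Then a gap of `S t`
lies between them, with its midpoint separating the two values, contrary to the invariant that the
class lies on one side of every gap. -/
theorem exists_single (h : NearlyJointlyDiagonal q δ T S d e) {U : Finset (Fin R)}
    {X : Matrix (Fin R) (Fin R) ℝ} (hX : ClassInv q S d e U T 0 X) :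
    ∃ i ∈ U, ActsAs q X {i} ((R : ℝ) ^ 3 * e) ∧ NormLe X 1 := by
  obtain ⟨C, h1, h2, ⟨i, hi⟩, h4⟩ := hX
  rw [Finset.mem_inter] at hi
  have hR : (1 : ℝ) ≤ R := by exact_mod_cast i.pos
  have he0 := h.error_nonneg
  have hqn : ∀ j, 1 / 2 < ‖q j‖ := by
    intro j
    have h5 := (abs_le.1 (h.orth j j)).1
    rw [real_inner_self_eq_norm_sq, if_pos rfl] at h5
    have := h.le
    by_contra hcon
    push Not at hcon
    nlinarith [norm_nonneg (q j)]
  have hlt : ∀ t < T, ∀ i j, 1 / (R : ℝ) ≤ d t i - d t j →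
      ∃ a b, HasGap (S t) a b ∧ eigenMid (S t) a b < d t i ∧ d t j ≤ eigenMid (S t) a b := by
    intro t ht i j hij
    obtain ⟨a, b, h5, h6, h7, h8⟩ := exists_gap_between (S t) (q i) (q j) (h.residual t ht i)
      (h.residual t ht j) (hqn i) (hqn j) (by
        rw [mul_div_assoc', div_le_div_iff₀ (by positivity) (by positivity)]
        have h9 : 8 * e ≤ 2 := by
          have h10 : (1 : ℝ) ≤ R ^ 5 := one_le_pow₀ hR
          have := h.error_le
          nlinarith
        nlinarith [sq_nonneg (R : ℝ)]) hij
    exact ⟨a, b, ⟨h5, h6⟩, h7, h8⟩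
  have hC : C = {i} := by
    refine Finset.eq_singleton_iff_unique_mem.2 ⟨hi.1, fun j hj => ?_⟩
    by_contra hne
    obtain ⟨t, ht, hsep⟩ := h.separates i j (Ne.symm hne)
    rcases le_abs.1 hsep with hs | hs
    · obtain ⟨a, b, hg, h7, h8⟩ := hlt t ht i j hs
      have := (h4 i hi.1 j hj t a b hg (.inl ht)).1 h7
      linarith
    · obtain ⟨a, b, hg, h7, h8⟩ := hlt t ht j i (by linarith)
      have := (h4 j hj i hi.1 t a b hg (.inl ht)).1 h7
      linarith
  subst hC
  refine ⟨i, hi.2, h2.mono ?_, h1⟩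
  apply mul_le_mul_of_nonneg_right _ he0
  have : (T : ℝ) ≤ R * R := by exact_mod_cast h.count_le
  simp only [Nat.cast_zero, add_zero]
  calc (T : ℝ) * R ≤ (R * R) * R := by gcongr
    _ = _ := by ring

end NearlyJointlyDiagonal

end Passes

/-! ### Reading off the components -/

section Reading

/-- The intermediate matrix is p pᵀ with p = ∑_k q_i(k) w_k. The first error term comes from X ≈ q_i
q_iᵀ. The second comes from p ≈ u_i, which uses the approximation of w_k by the u_j and the near
orthonormality of q. -/
theorem abs_entry_sub_le {ι : Type*} [Fintype ι] {R : ℕ}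
    (u w : Fin R → EuclideanSpace ℝ ι) (q : Fin R → EuclideanSpace ℝ (Fin R))
    {α ω₀ δ U ζ : ℝ} (hα0 : 0 ≤ α) (hω₀ : 0 ≤ ω₀) (hδ0 : 0 ≤ δ) (hδ : δ ≤ 1 / 8)
    (hwu : ∀ k, ‖w k - ∑ i, q i k • u i‖ ≤ α)
    (hW : ∀ x : EuclideanSpace ℝ ι, ∑ k, inner ℝ (w k) x ^ 2 ≤ ω₀ ^ 2 * ‖x‖ ^ 2)
    (hU : ∀ i, ‖u i‖ ≤ U)
    (horth : ∀ i j, |inner ℝ (q i) (q j) - if i = j then 1 else 0| ≤ δ)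
    {X : Matrix (Fin R) (Fin R) ℝ} {i : Fin R}
    (hX : ∀ z, ‖X.toEuclideanLin z - inner ℝ (q i) z • q i‖ ≤ ζ * ‖z‖) (x y : ι) :
    |∑ k, w k x * ∑ l, X k l * w l y - u i x * u i y| ≤
      ζ * ω₀ ^ 2 + (2 * R * α + δ * R * U) * (2 * U + (2 * R * α + δ * R * U)) := by
  classical
  set ν := 2 * R * α + δ * R * U with hν
  have hU0 : 0 ≤ U := (norm_nonneg _).trans (hU i)
  have hν0 : 0 ≤ ν := by positivity
  set row : ι → EuclideanSpace ℝ (Fin R) := fun x => WithLp.toLp 2 fun k => w k x with hrow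
  have hrown : ∀ x, ‖row x‖ ≤ ω₀ := by
    intro x
    refine le_of_sq_le_sq ?_ hω₀
    have := hW (EuclideanSpace.single x 1)
    simpa [EuclideanSpace.inner_single_right, EuclideanSpace.real_norm_sq_eq, hrow] using this
  have hζ0 : 0 ≤ ζ * ω₀ := by
    by_cases h0 : row x = 0
    all_goals
      have h1 := (norm_nonneg _).trans (hX (q i))
      have h2 : 0 < ‖q i‖ := by
        have h5 := (abs_le.1 (horth i i)).1
        rw [real_inner_self_eq_norm_sq, if_pos rfl] at h5
        by_contra hcon
        have : ‖q i‖ = 0 := le_antisymm (not_lt.1 hcon) (norm_nonneg _)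
        rw [this] at h5; norm_num at h5; linarith
      have h3 : 0 ≤ ζ := by
        by_contra hcon; push Not at hcon; nlinarith
      positivity
  set p := ∑ k, q i k • w k with hp
  have hqn2 : ‖q i‖ ≤ 2 := by
    have := (abs_le.1 (horth i i)).2
    rw [real_inner_self_eq_norm_sq, if_pos rfl] at this
    nlinarith [norm_nonneg (q i)]
  have hpu : ‖p - u i‖ ≤ ν := by
    have e1 : p - u i = ∑ k, q i k • (w k - ∑ j, q j k • u j) +
        ∑ j, (inner ℝ (q i) (q j) - if i = j then 1 else 0) • u j := by
      have e2 : ∑ k, q i k • ∑ j, q j k • u j = ∑ j, inner ℝ (q i) (q j) • u j := by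
        simp only [Finset.smul_sum, smul_smul]
        rw [Finset.sum_comm]
        refine Finset.sum_congr rfl fun j _ => ?_
        rw [← Finset.sum_smul, PiLp.inner_apply]
        congr 1
        refine Finset.sum_congr rfl fun k _ => ?_
        simp [mul_comm]
      simp only [smul_sub, Finset.sum_sub_distrib, sub_smul, e2, ite_smul, one_smul, zero_smul,
        Finset.sum_ite_eq, Finset.mem_univ, if_true]
      rw [hp]; abel
    rw [e1]
    refine (norm_add_le _ _).trans (add_le_add ?_ ?_)
    · calc _ ≤ ∑ k : Fin R, 2 * α := by
            refine (norm_sum_le _ _).trans (Finset.sum_le_sum fun k _ => ?_)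
            rw [norm_smul]
            exact mul_le_mul ((PiLp.norm_apply_le (q i) k).trans hqn2) (hwu k) (norm_nonneg _)
              (by norm_num)
        _ = _ := by simp; ring
    · calc _ ≤ ∑ j : Fin R, δ * U := by
            refine (norm_sum_le _ _).trans (Finset.sum_le_sum fun j _ => ?_)
            rw [norm_smul, Real.norm_eq_abs]
            exact mul_le_mul (horth i j) (hU j) (norm_nonneg _) hδ0
        _ = _ := by simp; ring
  have hpx : ∀ x, p x = inner ℝ (q i) (row x) := by
    intro x
    rw [hp, PiLp.inner_apply]
    simp [hrow, mul_comm]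
  have e1 : ∑ k, w k x * ∑ l, X k l * w l y - p x * p y =
      inner ℝ (row x) (X.toEuclideanLin (row y) - inner ℝ (q i) (row y) • q i) := by
    rw [inner_sub_right, inner_smul_right, real_inner_comm (q i) (row x), ← hpx, ← hpx, mul_comm (p y),
      PiLp.inner_apply]
    congr 1
    refine Finset.sum_congr rfl fun k _ => ?_
    rw [toEuclideanLin_coord]
    simp [hrow, mul_comm]
  have h1 : |∑ k, w k x * ∑ l, X k l * w l y - p x * p y| ≤ ζ * ω₀ ^ 2 := by
    rw [e1]
    calc _ ≤ ‖row x‖ * ‖X.toEuclideanLin (row y) - inner ℝ (q i) (row y) • q i‖ :=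
          abs_real_inner_le_norm _ _
      _ ≤ ω₀ * (ζ * ω₀) := by
          refine mul_le_mul (hrown x) ((hX _).trans ?_) (norm_nonneg _) hω₀
          have h1 := (norm_nonneg _).trans (hX (q i))
          by_cases hζ : 0 ≤ ζ
          · exact mul_le_mul_of_nonneg_left (hrown y) hζ
          · push Not at hζ
            have : ζ * ‖row y‖ ≤ 0 := mul_nonpos_of_nonpos_of_nonneg hζ.le (norm_nonneg _)
            linarith
      _ = _ := by ring
  have hcx : ∀ x, |p x - u i x| ≤ ν := fun x => by
    have := (PiLp.norm_apply_le (p - u i) x).trans hpu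
    simpa using this
  have hux : ∀ x, |u i x| ≤ U := fun x => by
    have := (PiLp.norm_apply_le (u i) x).trans (hU i)
    simpa using this
  have h2 : |p x * p y - u i x * u i y| ≤ ν * (2 * U + ν) := by
    have e2 : p x * p y - u i x * u i y =
        (p x - u i x) * (p y - u i y) + (p x - u i x) * u i y + u i x * (p y - u i y) := by ring
    rw [e2]
    calc _ ≤ |p x - u i x| * |p y - u i y| + |p x - u i x| * |u i y| + |u i x| * |p y - u i y| := by
          refine (abs_add_le _ _).trans (add_le_add ((abs_add_le _ _).trans ?_) ?_)
          · rw [abs_mul, abs_mul]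
          · rw [abs_mul]
      _ ≤ ν * ν + ν * U + U * ν := by
          gcongr
          · exact hcx x
          · exact hcx y
          · exact hcx x
          · exact hux y
          · exact hux x
          · exact hcx y
      _ = _ := by ring
  calc _ = |(∑ k, w k x * ∑ l, X k l * w l y - p x * p y) + (p x * p y - u i x * u i y)| := by
        congr 1; ring
    _ ≤ _ := (abs_add_le _ _).trans (add_le_add h1 h2)

/-- A vector is determined up to sign, in a stable way, by the largest diagonal entry of its
even tensor power and the corresponding slice. -/
theorem exists_sign_abs_sub_le {n L : ℕ} (hL : Even L) (hL0 : 2 ≤ L) (a : Fin n → ℝ) {θ A₀ : ℝ}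
    (hA₀ : 0 < A₀) (hmax : ∃ m, |a m| = A₀) (hle : ∀ m, |a m| ≤ A₀) (hθ : 16 * θ ≤ A₀ ^ L)
    (D F : Fin n → ℝ) (j : Fin n) (hD : ∀ m, |D m - a m ^ L| ≤ θ) (hj : ∀ m, D m ≤ D j)
    (hF : ∀ m, |F m - a m * a j ^ (L - 1)| ≤ θ) :
    ∃ s : ℝ, (s = 1 ∨ s = -1) ∧ ∀ m,
      |a m - s * (F m / D j * (max (D j) 0) ^ ((L : ℝ)⁻¹))| ≤ 24 * (θ / A₀ ^ L) * A₀ := by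
  have hθ0 : 0 ≤ θ := (abs_nonneg _).trans (hD j)
  set A := |a j| with hA
  have hAL : a j ^ L = A ^ L := (hL.pow_abs (a j)).symm
  have hA0L : 0 < A₀ ^ L := by positivity
  -- The index j maximizes only the perturbed diagonal, so a_j may fail to be the largest
  -- coordinate, but its power misses the maximum by at most 2θ.
  have hAlow : A₀ ^ L ≤ A ^ L + 2 * θ := by
    obtain ⟨m, hm⟩ := hmax
    have h1 := (abs_le.1 (hD m)).1
    have h2 := (abs_le.1 (hD j)).2
    have h3 : a m ^ L = A₀ ^ L := by rw [← hm, hL.pow_abs]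
    rw [h3] at h1
    rw [hAL] at h2
    linarith [hj m]
  have hAL2 : A₀ ^ L ≤ 2 * A ^ L := by linarith
  have hAθ : 4 * θ ≤ A ^ L := by linarith
  have hALpos : 0 < A ^ L := by linarith
  have hApos : 0 < A := by
    rcases (abs_nonneg (a j)).eq_or_lt with h | h
    · rw [← hA] at h
      rw [← h, zero_pow (by omega)] at hALpos
      exact absurd hALpos (lt_irrefl _)
    · exact h
  have hA0A : A₀ ≤ 2 * A := by
    by_contra hcon
    push Not at hcon
    have h1 : (2 * A) ^ L ≤ A₀ ^ L := pow_le_pow_left₀ (by positivity) hcon.le L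
    rw [mul_pow] at h1
    have h2 : (2 : ℝ) ^ 2 ≤ 2 ^ L := pow_le_pow_right₀ (by norm_num) hL0
    nlinarith
  have hAA0 : A ≤ A₀ := hle j
  have hDj := abs_le.1 (hD j)
  rw [hAL] at hDj
  have hDpos : A ^ L / 2 ≤ D j := by linarith
  have hDpos' : 0 < D j := by linarith
  rw [max_eq_left hDpos'.le]
  set r := D j ^ ((L : ℝ)⁻¹) with hr
  have hr0 : 0 ≤ r := by positivity
  have hrL : r ^ L = D j := Real.rpow_inv_natCast_pow hDpos'.le (by omega)
  have hAsucc : A ^ L = A ^ (L - 1) * A := by rw [← pow_succ]; congr 1; omega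
  -- Factor r^L - A^L by the geometric sum, which is at least A^{L-1}: away from zero the root is
  -- Lipschitz.
  have hrA : |r - A| ≤ θ / A ^ L * A := by
    have h1 : |r - A| * A ^ (L - 1) ≤ |r ^ L - A ^ L| := by
      have hgeom := (Commute.all r A).mul_geom_sum₂ L
      rw [← hgeom, abs_mul]
      refine mul_le_mul_of_nonneg_left ?_ (abs_nonneg _)
      have h2 : A ^ (L - 1) ≤ ∑ i ∈ Finset.range L, r ^ i * A ^ (L - 1 - i) := by
        have := Finset.single_le_sum (f := fun i => r ^ i * A ^ (L - 1 - i))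
          (fun i _ => by positivity) (Finset.mem_range.2 (show 0 < L by omega))
        simpa using this
      exact h2.trans (le_abs_self _)
    rw [hrL] at h1
    have h3 : |D j - A ^ L| ≤ θ := by rw [← hAL]; exact hD j
    have h4 : |r - A| * A ^ (L - 1) ≤ θ := h1.trans h3
    rw [hAsucc, div_mul_eq_mul_div, mul_div_mul_right _ _ hApos.ne', le_div_iff₀ (by positivity)]
    exact h4
  -- The sign of a_j is lost in the even power D and survives in the odd power a_j^{L-1} of the
  -- slice F.
  set s : ℝ := if 0 ≤ a j then 1 else -1 with hs
  have hsa : s * a j = A := by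
    rw [hs, hA]; split_ifs with h
    · rw [abs_of_nonneg h]; ring
    · rw [abs_of_neg (not_le.1 h)]; ring
  have hs1 : s = 1 ∨ s = -1 := by rw [hs]; split_ifs <;> simp
  have hss : s * s = 1 := by rcases hs1 with h | h <;> rw [h] <;> ring
  have hsabs : |s| = 1 := by rcases hs1 with h | h <;> rw [h] <;> simp
  have hpow : a j ^ (L - 1) = s * A ^ (L - 1) := by
    have h1 : a j = s * A := by rw [← hsa, ← mul_assoc, hss, one_mul]
    have h2 : s ^ (L - 1) = s := by
      have hodd : Odd (L - 1) := Nat.Even.sub_odd (by omega) hL odd_one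
      rcases hs1 with h | h <;> rw [h]
      · simp
      · exact hodd.neg_one_pow
    rw [h1, mul_pow, h2]
  refine ⟨s, hs1, fun m => ?_⟩
  -- The error is split into that of the root r and that of the ratio F/D.
  have e1 : a m - s * (F m / D j * r) = -(s * (F m / D j * (r - A))) -
      s * A * (F m / D j - a m * a j ^ (L - 1) / A ^ L) := by
    rw [hpow, hAsucc]
    field_simp
    ring_nf
    rw [show s ^ 2 = 1 by rw [sq, hss]]
    ring
  have hG : |a m * a j ^ (L - 1)| ≤ 2 * A ^ L := by
    rw [abs_mul, hpow, abs_mul, hsabs, one_mul, abs_of_nonneg (by positivity : 0 ≤ A ^ (L - 1)),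
      hAsucc]
    have : |a m| ≤ 2 * A := (hle m).trans hA0A
    calc _ ≤ 2 * A * A ^ (L - 1) := by gcongr
      _ = _ := by ring
  have hFm : |F m| ≤ 3 * A ^ L := by
    have h1 := abs_le.1 (hF m)
    have h2 := abs_le.1 hG
    exact abs_le.2 ⟨by linarith, by linarith⟩
  have h6 : |F m / D j| ≤ 6 := by
    rw [abs_div, abs_of_pos hDpos', div_le_iff₀ hDpos']
    linarith
  have h7 : |F m / D j - a m * a j ^ (L - 1) / A ^ L| ≤ 6 * (θ / A ^ L) := by
    set G := a m * a j ^ (L - 1) with hGdef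
    have e2 : F m / D j - G / A ^ L = (F m - G) / D j + G * (A ^ L - D j) / (D j * A ^ L) := by
      field_simp; ring
    have h8 : |(F m - G) / D j| ≤ 2 * (θ / A ^ L) := by
      rw [abs_div, abs_of_pos hDpos', mul_div_assoc', div_le_div_iff₀ hDpos' hALpos]
      have := hF m
      nlinarith
    have h9 : |G * (A ^ L - D j) / (D j * A ^ L)| ≤ 4 * (θ / A ^ L) := by
      rw [abs_div, abs_of_pos (by positivity : 0 < D j * A ^ L), mul_div_assoc',
        div_le_div_iff₀ (by positivity) hALpos, abs_mul]
      have h10 : |A ^ L - D j| ≤ θ := by rw [abs_sub_comm, ← hAL]; exact hD j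
      have h11 : |G| * |A ^ L - D j| ≤ 2 * A ^ L * θ :=
        mul_le_mul hG h10 (abs_nonneg _) (by positivity)
      calc _ ≤ 2 * A ^ L * θ * A ^ L := by gcongr
        _ = 4 * θ * (A ^ L / 2 * A ^ L) := by ring
        _ ≤ _ := by gcongr
    rw [e2]
    exact (abs_add_le _ _).trans (by linarith)
  have h12 : θ / A ^ L ≤ 2 * (θ / A₀ ^ L) := by
    rw [mul_div_assoc', div_le_div_iff₀ hALpos hA0L]
    nlinarith
  rw [e1]
  calc _ ≤ |s * (F m / D j * (r - A))| + |s * A * (F m / D j - a m * a j ^ (L - 1) / A ^ L)| := by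
        rw [sub_eq_add_neg]
        refine (abs_add_le _ _).trans ?_
        rw [abs_neg, abs_neg]
    _ ≤ 6 * (θ / A ^ L * A) + A * (6 * (θ / A ^ L)) := by
        rw [abs_mul, abs_mul, abs_mul, abs_mul, hsabs, one_mul, one_mul, abs_of_pos hApos]
        gcongr
    _ = 12 * (θ / A ^ L) * A := by ring
    _ ≤ 12 * (2 * (θ / A₀ ^ L)) * A₀ := by gcongr
    _ = _ := by ring

end Reading

/-! ### Flattening tensors -/

section Flatten

variable {n l R : ℕ}

/-- The vector of entries of a tensor, multi-indices being read as numbers in base `n`. -/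
def flatVec (X : Tensor l n) : EuclideanSpace ℝ (Fin (n ^ l)) :=
  WithLp.toLp 2 fun x => X (finFunctionFinEquiv.symm x)

theorem flatVec_apply (X : Tensor l n) (x : Fin (n ^ l)) :
    flatVec X x = X (finFunctionFinEquiv.symm x) := rfl

theorem norm_flatVec_sq (X : Tensor l n) : ‖flatVec X‖ ^ 2 = ∑ I, X I ^ 2 := by
  rw [EuclideanSpace.real_norm_sq_eq]
  exact Equiv.sum_comp finFunctionFinEquiv.symm fun I => X I ^ 2

theorem inner_flatVec (X Y : Tensor l n) : inner ℝ (flatVec X) (flatVec Y) = ∑ I, X I * Y I := by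
  rw [PiLp.inner_apply]
  simp only [flatVec_apply, RCLike.inner_apply, conj_trivial]
  rw [Equiv.sum_comp finFunctionFinEquiv.symm fun I => Y I * X I]
  exact Finset.sum_congr rfl fun _ _ => mul_comm _ _

theorem flat_index_lt (i j : Fin (n ^ l)) : i.val * n ^ l + j.val < n ^ (2 * l) := by
  have h1 := i.2
  have h2 := j.2
  have h3 : n ^ (2 * l) = n ^ l * n ^ l := by rw [two_mul, pow_add]
  rw [h3]
  nlinarith

/-- The square matrix of entries of a tensor of even order. -/
def flatMat (T : Tensor (2 * l) n) : Matrix (Fin (n ^ l)) (Fin (n ^ l)) ℝ :=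
  Matrix.of fun i j => T (finFunctionFinEquiv.symm ⟨i.val * n ^ l + j.val, flat_index_lt i j⟩)

theorem flatMat_apply (T : Tensor (2 * l) n) (i j : Fin (n ^ l)) :
    flatMat T i j = T (finFunctionFinEquiv.symm ⟨i.val * n ^ l + j.val, flat_index_lt i j⟩) := rfl

theorem flatMat_add (T T' : Tensor (2 * l) n) : flatMat (T + T') = flatMat T + flatMat T' := rfl

/-- In base n the address i n^l + j carries the digits of j in its l low positions and those of i
above them. With this convention the input array, read row by row, already is the flattened matrix.
-/
theorem flatMat_tensorPow (a : EuclideanSpace ℝ (Fin n)) (i j : Fin (n ^ l)) :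
    flatMat (tensorPow (2 * l) a) i j = flatVec (tensorPow l a) i * flatVec (tensorPow l a) j := by
  rw [flatMat_apply, flatVec_apply, flatVec_apply, tensorPow, tensorPow, tensorPow]
  have h2 : 2 * l = l + l := two_mul l
  rw [← Equiv.prod_comp (finCongr h2.symm), Fin.prod_univ_add, mul_comm]
  congr 1
  · refine Finset.prod_congr rfl fun s _ => congrArg a (Fin.ext ?_)
    have : 0 < n ^ l := i.pos
    simp only [finFunctionFinEquiv_symm_apply_val, finCongr_apply, Fin.val_cast, Fin.val_natAdd]
    rw [pow_add, ← Nat.div_div_eq_div_mul, mul_comm, Nat.mul_add_div this, Nat.div_eq_of_lt j.2,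
      add_zero]
  · refine Finset.prod_congr rfl fun s _ => congrArg a (Fin.ext ?_)
    simp only [finFunctionFinEquiv_symm_apply_val, finCongr_apply, Fin.val_cast, Fin.val_castAdd]
    have hl : n ^ l = n ^ s.val * (n * n ^ (l - 1 - s)) := by
      rw [← pow_succ', ← pow_add]; congr 1; omega
    have hs : 0 < n ^ s.val := by
      have : 0 < n ^ l := i.pos
      rw [hl] at this
      exact Nat.pos_of_mul_pos_right this
    generalize i.val = i₀
    generalize j.val = j₀
    rw [hl, show i₀ * (n ^ s.val * (n * n ^ (l - 1 - s))) + j₀ =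
      n ^ s.val * (n * (n ^ (l - 1 - s) * i₀)) + j₀ by ring, Nat.mul_add_div hs, Nat.mul_add_mod]

theorem flatMat_momentTensor (A : Fin R → EuclideanSpace ℝ (Fin n)) (i j : Fin (n ^ l)) :
    flatMat (momentTensor (2 * l) A) i j =
      ∑ r, flatVec (tensorPow l (A r)) i * flatVec (tensorPow l (A r)) j := by
  rw [flatMat_apply, momentTensor]
  exact Finset.sum_congr rfl fun r _ => flatMat_tensorPow (A r) i j

theorem sum_flatMat_sq (T : Tensor (2 * l) n) :
    ∑ i, ∑ j, flatMat T i j ^ 2 = frobNorm T ^ 2 := by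
  rw [frobNorm, Real.sq_sqrt (Finset.sum_nonneg fun _ _ => sq_nonneg _),
    ← Equiv.sum_comp finFunctionFinEquiv.symm fun I => T I ^ 2, ← Fintype.sum_prod_type']
  have h : n ^ (2 * l) = n ^ l * n ^ l := by rw [two_mul, pow_add]
  rw [← Equiv.sum_comp (finProdFinEquiv.trans (finCongr h.symm))]
  refine Finset.sum_congr rfl fun p _ => ?_
  rw [flatMat_apply]
  congr 3
  refine Fin.ext ?_
  simp [finProdFinEquiv, mul_comm, add_comm]

/-- The norm of a matrix as an operator is at most the norm of its entries. -/
theorem norm_apply_le_frobNorm (T : Tensor (2 * l) n) (x : EuclideanSpace ℝ (Fin (n ^ l))) :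
    ‖(flatMat T).toEuclideanLin x‖ ≤ frobNorm T * ‖x‖ := by
  have h0 : 0 ≤ frobNorm T := Real.sqrt_nonneg _
  refine le_of_sq_le_sq ?_ (by positivity)
  rw [mul_pow, ← sum_flatMat_sq]
  exact norm_apply_sq_le_entrySq (flatMat T) x

theorem symPart_toEuclideanLin {d : ℕ} (M : Matrix (Fin d) (Fin d) ℝ) (x : EuclideanSpace ℝ (Fin d)) :
    (symPart M).toEuclideanLin x =
      (2⁻¹ : ℝ) • (M.toEuclideanLin x + M.transpose.toEuclideanLin x) := by
  rw [symPart, map_smul, map_add]; rfl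

theorem norm_transpose_apply_le_frobNorm (T : Tensor (2 * l) n)
    (x : EuclideanSpace ℝ (Fin (n ^ l))) :
    ‖(flatMat T).transpose.toEuclideanLin x‖ ≤ frobNorm T * ‖x‖ := by
  have h0 : 0 ≤ frobNorm T := Real.sqrt_nonneg _
  refine le_of_sq_le_sq ?_ (by positivity)
  rw [mul_pow, ← sum_flatMat_sq, Finset.sum_comm]
  exact norm_apply_sq_le_entrySq (flatMat T).transpose x

theorem flatMat_momentTensor_apply (A : Fin R → EuclideanSpace ℝ (Fin n))
    (x : EuclideanSpace ℝ (Fin (n ^ l))) :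
    (flatMat (momentTensor (2 * l) A)).toEuclideanLin x =
      ∑ r, inner ℝ (flatVec (tensorPow l (A r))) x • flatVec (tensorPow l (A r)) := by
  ext i
  rw [toEuclideanLin_coord]
  simp only [flatMat_momentTensor, Finset.sum_mul, WithLp.ofLp_sum, Finset.sum_apply,
    PiLp.smul_apply, smul_eq_mul, PiLp.inner_apply, RCLike.inner_apply, conj_trivial]
  rw [Finset.sum_comm]
  refine Finset.sum_congr rfl fun r _ => Finset.sum_congr rfl fun j _ => by ring

/-- The error tensor need not be symmetric. Symmetrization fixes the main term and averages the
error with its transpose, which obeys the same bound. -/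
theorem norm_symPart_flatMat_sub_le (A : Fin R → EuclideanSpace ℝ (Fin n))
    (Err : Tensor (2 * l) n) (x : EuclideanSpace ℝ (Fin (n ^ l))) :
    ‖(symPart (flatMat (momentTensor (2 * l) A + Err))).toEuclideanLin x -
      ∑ r, inner ℝ (flatVec (tensorPow l (A r))) x • flatVec (tensorPow l (A r))‖ ≤
      frobNorm Err * ‖x‖ := by
  have h1 := flatMat_momentTensor_apply (l := l) A
  have h2 : (flatMat (momentTensor (2 * l) A)).transpose = flatMat (momentTensor (2 * l) A) := by
    ext i j
    rw [Matrix.transpose_apply, flatMat_momentTensor, flatMat_momentTensor]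
    exact Finset.sum_congr rfl fun r _ => mul_comm _ _
  rw [symPart_toEuclideanLin, flatMat_add, Matrix.transpose_add, h2, map_add, map_add,
    LinearMap.add_apply, LinearMap.add_apply, h1]
  have h3 := norm_apply_le_frobNorm Err x
  have h4 := norm_transpose_apply_le_frobNorm Err x
  set y := ∑ r, inner ℝ (flatVec (tensorPow l (A r))) x • flatVec (tensorPow l (A r))
  have h5 : (2⁻¹ : ℝ) • (y + (flatMat Err).toEuclideanLin x +
      (y + (flatMat Err).transpose.toEuclideanLin x)) - y =
      (2⁻¹ : ℝ) • ((flatMat Err).toEuclideanLin x + (flatMat Err).transpose.toEuclideanLin x) := by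
    module
  rw [h5, norm_smul, Real.norm_eq_abs, abs_of_pos (by norm_num)]
  have := norm_add_le ((flatMat Err).toEuclideanLin x) ((flatMat Err).transpose.toEuclideanLin x)
  linarith

/-! ### Tensor powers -/

theorem sum_prod_apply (g : Fin l → Fin n → ℝ) :
    ∑ I : Fin l → Fin n, ∏ s, g s (I s) = ∏ s, ∑ x, g s x := by
  rw [Finset.prod_univ_sum, Fintype.piFinset_univ]

theorem inner_flatVec_tensorPow (a b : EuclideanSpace ℝ (Fin n)) :
    inner ℝ (flatVec (tensorPow l a)) (flatVec (tensorPow l b)) = inner ℝ a b ^ l := by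
  rw [inner_flatVec]
  simp only [tensorPow, ← Finset.prod_mul_distrib]
  rw [sum_prod_apply (fun _ x => a x * b x), Finset.prod_const, Finset.card_univ, Fintype.card_fin,
    PiLp.inner_apply]
  congr 1
  exact Finset.sum_congr rfl fun x _ => by simp [mul_comm]

theorem norm_flatVec_tensorPow (a : EuclideanSpace ℝ (Fin n)) :
    ‖flatVec (tensorPow l a)‖ = ‖a‖ ^ l := by
  refine (sq_eq_sq₀ (norm_nonneg _) (by positivity)).1 ?_
  rw [← real_inner_self_eq_norm_sq, inner_flatVec_tensorPow, real_inner_self_eq_norm_sq]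
  ring

/-- In even order the components cannot cancel: the flattened matrix is positive semidefinite, and
its form at u_r is at least ‖u_r‖⁴. So a small tensor forces small components. -/
theorem norm_pow_le_frobNorm (A : Fin R → EuclideanSpace ℝ (Fin n)) (r : Fin R) :
    ‖A r‖ ^ (2 * l) ≤ frobNorm (momentTensor (2 * l) A) := by
  set u := fun r => flatVec (tensorPow l (A r)) with hu
  have h := norm_apply_le_frobNorm (momentTensor (2 * l) A) (u r)
  have h1 : inner ℝ (u r) ((flatMat (momentTensor (2 * l) A)).toEuclideanLin (u r)) =
      ∑ i, inner ℝ (u i) (u r) ^ 2 := by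
    rw [flatMat_momentTensor_apply, inner_sum]
    refine Finset.sum_congr rfl fun i _ => ?_
    rw [inner_smul_right, real_inner_comm (u i), sq]
  have h2 : (‖u r‖ ^ 2) ^ 2 ≤ ∑ i, inner ℝ (u i) (u r) ^ 2 := by
    rw [← real_inner_self_eq_norm_sq]
    exact Finset.single_le_sum (f := fun i => inner ℝ (u i) (u r) ^ 2)
      (fun _ _ => sq_nonneg _) (Finset.mem_univ r)
  have h3 := real_inner_le_norm (u r) ((flatMat (momentTensor (2 * l) A)).toEuclideanLin (u r))
  have h4 : ‖A r‖ ^ (2 * l) = ‖u r‖ ^ 2 := by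
    rw [hu]; simp only [norm_flatVec_tensorPow]; ring
  rw [h4]
  rcases (norm_nonneg (u r)).eq_or_lt with h0 | h0
  · rw [← h0, zero_pow two_ne_zero]; exact Real.sqrt_nonneg _
  · have h5 : (‖u r‖ ^ 2) * ‖u r‖ ^ 2 ≤ frobNorm (momentTensor (2 * l) A) * ‖u r‖ ^ 2 := by
      calc _ = (‖u r‖ ^ 2) ^ 2 := by ring
        _ ≤ _ := h2
        _ ≤ ‖u r‖ * (frobNorm (momentTensor (2 * l) A) * ‖u r‖) := by
            rw [← h1]; exact h3.trans (by gcongr)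
        _ = _ := by ring
    exact le_of_mul_le_mul_right h5 (by positivity)

theorem frobNorm_add_le {m : ℕ} (T T' : Tensor m n) :
    frobNorm (T + T') ≤ frobNorm T + frobNorm T' := by
  have h : ∀ T : Tensor m n, frobNorm T = ‖(WithLp.toLp 2 T : EuclideanSpace ℝ (Fin m → Fin n))‖ := by
    intro T
    rw [EuclideanSpace.norm_eq, frobNorm]; simp
  rw [h, h, h, WithLp.toLp_add]
  exact norm_add_le _ _

theorem frobNorm_neg {m : ℕ} (T : Tensor m n) : frobNorm (-T) = frobNorm T := by
  simp [frobNorm]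

theorem frobNorm_momentTensor_le {m : ℕ} (A : Fin R → EuclideanSpace ℝ (Fin n)) :
    frobNorm (momentTensor m A) ≤ ∑ r, ‖A r‖ ^ m := by
  have h : ∀ T : Tensor m n, frobNorm T = ‖(WithLp.toLp 2 T : EuclideanSpace ℝ (Fin m → Fin n))‖ := by
    intro T
    rw [EuclideanSpace.norm_eq, frobNorm]; simp
  have h1 : ∀ a : EuclideanSpace ℝ (Fin n), frobNorm (tensorPow m a) = ‖a‖ ^ m := by
    intro a
    rw [← norm_flatVec_tensorPow, ← Real.sqrt_sq (norm_nonneg (flatVec _)), norm_flatVec_sq, frobNorm]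
  have h2 : (WithLp.toLp 2 (momentTensor m A) : EuclideanSpace ℝ (Fin m → Fin n)) =
      ∑ r, WithLp.toLp 2 (tensorPow m (A r)) := by
    ext I; simp [momentTensor]
  rw [h, h2]
  refine (norm_sum_le _ _).trans (Finset.sum_le_sum fun r _ => ?_)
  rw [← h, h1]

end Flatten

/-! ### The detector on flattened tensors and tensor powers -/

section DetectorTensor

variable {n l R : ℕ}

theorem replaceLast_replaceLast (I J : Fin l → Fin n) :
    replaceLast (replaceLast I J) (replaceLast J I) = I := by
  funext s; simp only [replaceLast]; split_ifs <;> rfl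

/-- The exchange of the last indices. -/
def exchangeLast : (Fin l → Fin n) × (Fin l → Fin n) ≃ (Fin l → Fin n) × (Fin l → Fin n) where
  toFun p := (replaceLast p.1 p.2, replaceLast p.2 p.1)
  invFun p := (replaceLast p.1 p.2, replaceLast p.2 p.1)
  left_inv p := by simp [replaceLast_replaceLast]
  right_inv p := by simp [replaceLast_replaceLast]

/-- Φ has four terms, each with sum of squares ‖X‖²‖Y‖², since the exchange of last indices permutes
the pairs of multi-indices; Cauchy–Schwarz for four terms gives another factor 4. -/
theorem sum_detectorPhi_sq_le (X Y : Tensor l n) :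
    ∑ p, detectorPhi X Y p ^ 2 ≤ 16 * ((∑ I, X I ^ 2) * ∑ I, Y I ^ 2) := by
  have h1 : ∀ X Y : Tensor l n, ∑ p : (Fin l → Fin n) × (Fin l → Fin n), (X p.1 * Y p.2) ^ 2 =
      (∑ I, X I ^ 2) * ∑ I, Y I ^ 2 := by
    intro X Y
    rw [Finset.sum_mul_sum, Fintype.sum_prod_type]
    simp only [mul_pow]
  have h2 : ∀ X Y : Tensor l n, ∑ p : (Fin l → Fin n) × (Fin l → Fin n),
      (X (replaceLast p.1 p.2) * Y (replaceLast p.2 p.1)) ^ 2 = (∑ I, X I ^ 2) * ∑ I, Y I ^ 2 := by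
    intro X Y
    rw [← h1, ← Equiv.sum_comp exchangeLast fun p => (X p.1 * Y p.2) ^ 2]
    rfl
  calc _ ≤ ∑ p : (Fin l → Fin n) × (Fin l → Fin n), 4 * ((X p.1 * Y p.2) ^ 2 +
        (X (replaceLast p.1 p.2) * Y (replaceLast p.2 p.1)) ^ 2 + (Y p.1 * X p.2) ^ 2 +
        (Y (replaceLast p.1 p.2) * X (replaceLast p.2 p.1)) ^ 2) := by
        refine Finset.sum_le_sum fun p _ => ?_
        simp only [detectorPhi, detectorPsi]
        generalize X p.1 * Y p.2 = a
        generalize X (replaceLast p.1 p.2) * Y (replaceLast p.2 p.1) = b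
        generalize Y p.1 * X p.2 = c
        generalize Y (replaceLast p.1 p.2) * X (replaceLast p.2 p.1) = d
        nlinarith [sq_nonneg (a + b), sq_nonneg (a - c), sq_nonneg (a + d), sq_nonneg (b + c),
          sq_nonneg (b - d), sq_nonneg (c + d)]
    _ = _ := by
        rw [← Finset.mul_sum, Finset.sum_add_distrib, Finset.sum_add_distrib,
          Finset.sum_add_distrib, h1, h2, h1, h2]
        ring

theorem detectorPhi_comm (X Y : Tensor l n) : detectorPhi X Y = detectorPhi Y X := by
  funext p; simp only [detectorPhi, detectorPsi]; ring

/-- For a tensor power the exchange of indices only permutes the factors of the product. -/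
theorem detectorPhi_tensorPow_self (a : EuclideanSpace ℝ (Fin n))
    (p : (Fin l → Fin n) × (Fin l → Fin n)) :
    detectorPhi (tensorPow l a) (tensorPow l a) p = 0 := by
  have : tensorPow l a p.1 * tensorPow l a p.2 =
      tensorPow l a (replaceLast p.1 p.2) * tensorPow l a (replaceLast p.2 p.1) := by
    simp only [tensorPow, ← Finset.prod_mul_distrib]
    refine Finset.prod_congr rfl fun s _ => ?_
    simp only [replaceLast]
    split_ifs <;> ring
  simp [detectorPhi, detectorPsi, this]

theorem sum_pairs_prod (g : Fin l → Fin n × Fin n → ℝ) :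
    ∑ p : (Fin l → Fin n) × (Fin l → Fin n), ∏ s, g s (p.1 s, p.2 s) = ∏ s, ∑ x, g s x := by
  rw [Finset.prod_univ_sum, Fintype.piFinset_univ,
    ← Equiv.sum_comp (Equiv.arrowProdEquivProdArrow (Fin l) (fun _ => Fin n) (fun _ => Fin n)).symm]
  rfl

/-- On tensor powers Φ factors as (∏ a(i_s) b(j_s) - ∏ b(i_s) a(j_s)) over the first m indices,
times the 2 × 2 minor of a, b at the last indices. Expanding the square of the first factor leaves
three sums which split over the positions s. -/
theorem sum_detectorPhi_tensorPow_sq (m : ℕ) (a b : EuclideanSpace ℝ (Fin n)) :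
    ∑ p, detectorPhi (tensorPow (m + 1) a) (tensorPow (m + 1) b) p ^ 2 =
      4 * ((‖a‖ ^ 2 * ‖b‖ ^ 2) ^ m - (inner ℝ a b ^ 2) ^ m) *
        (‖a‖ ^ 2 * ‖b‖ ^ 2 - inner ℝ a b ^ 2) := by
  set P := ‖a‖ ^ 2 * ‖b‖ ^ 2 with hP
  set C := inner ℝ a b ^ 2 with hC
  set w : Fin n × Fin n → ℝ := fun x => (a x.1 * b x.2 - a x.2 * b x.1) ^ 2 with hw
  set f : Fin n × Fin n → ℝ := fun x => a x.1 ^ 2 * b x.2 ^ 2 with hf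
  set f' : Fin n × Fin n → ℝ := fun x => b x.1 ^ 2 * a x.2 ^ 2 with hf'
  set h : Fin n × Fin n → ℝ := fun x => (a x.1 * b x.1) * (a x.2 * b x.2) with hh
  have hfP : ∑ x, f x = P := by
    rw [hP, EuclideanSpace.real_norm_sq_eq, EuclideanSpace.real_norm_sq_eq, Finset.sum_mul_sum,
      Fintype.sum_prod_type]
  have hfP' : ∑ x, f' x = P := by
    rw [hP, mul_comm, EuclideanSpace.real_norm_sq_eq, EuclideanSpace.real_norm_sq_eq,
      Finset.sum_mul_sum, Fintype.sum_prod_type]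
  have hhC : ∑ x, h x = C := by
    rw [hC, PiLp.inner_apply, sq, Finset.sum_mul_sum, Fintype.sum_prod_type]
    refine Finset.sum_congr rfl fun x _ => Finset.sum_congr rfl fun y _ => ?_
    simp [hh, mul_comm]
  have hwW : ∑ x, w x = 2 * (P - C) := by
    have : ∀ x, w x = f x + f' x - 2 * h x := by intro x; simp only [hw, hf, hf', hh]; ring
    simp only [this]
    rw [Finset.sum_sub_distrib, Finset.sum_add_distrib, ← Finset.mul_sum, hfP, hfP', hhC]
    ring
  have key : ∀ φ : Fin n × Fin n → ℝ,
      ∑ p : (Fin (m + 1) → Fin n) × (Fin (m + 1) → Fin n),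
        (∏ s : Fin m, φ (p.1 s.castSucc, p.2 s.castSucc)) * w (p.1 (Fin.last m), p.2 (Fin.last m)) =
        (∑ x, φ x) ^ m * (2 * (P - C)) := by
    intro φ
    have := sum_pairs_prod (n := n) (Fin.lastCases (motive := fun _ => Fin n × Fin n → ℝ) w fun _ => φ : Fin (m + 1) → _)
    simp only [Fin.prod_univ_castSucc, Fin.lastCases_castSucc, Fin.lastCases_last,
      Finset.prod_const, Finset.card_univ, Fintype.card_fin] at this
    rw [this, hwW]
  have hΦ : ∀ p : (Fin (m + 1) → Fin n) × (Fin (m + 1) → Fin n),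
      detectorPhi (tensorPow (m + 1) a) (tensorPow (m + 1) b) p ^ 2 =
      (∏ s : Fin m, f (p.1 s.castSucc, p.2 s.castSucc)) * w (p.1 (Fin.last m), p.2 (Fin.last m)) +
      (∏ s : Fin m, f' (p.1 s.castSucc, p.2 s.castSucc)) * w (p.1 (Fin.last m), p.2 (Fin.last m)) -
      2 * ((∏ s : Fin m, h (p.1 s.castSucc, p.2 s.castSucc)) *
        w (p.1 (Fin.last m), p.2 (Fin.last m))) := by
    intro p
    have hlast : ∀ s : Fin m, ¬ (s.val + 1 = m + 1) := fun s => by omega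
    simp only [detectorPhi, detectorPsi, tensorPow, Fin.prod_univ_castSucc, replaceLast,
      Fin.val_castSucc, Fin.val_last, hlast, if_true, if_false, hf, hf', hh, hw,
      Finset.prod_mul_distrib, Finset.prod_pow]
    ring
  simp only [hΦ]
  rw [Finset.sum_sub_distrib, Finset.sum_add_distrib, ← Finset.mul_sum, key, key, key, hfP, hfP',
    hhC]
  ring

/-- The detector as a bilinear map on flattened tensors. -/
def detectorBilin (l n : ℕ) : EuclideanSpace ℝ (Fin (n ^ l)) →ₗ[ℝ] EuclideanSpace ℝ (Fin (n ^ l))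
    →ₗ[ℝ] EuclideanSpace ℝ (Fin (n ^ l) × Fin (n ^ l)) :=
  LinearMap.mk₂ ℝ (fun x y => WithLp.toLp 2 fun p =>
      detectorPhi (fun I => x (finFunctionFinEquiv I)) (fun I => y (finFunctionFinEquiv I))
        (finFunctionFinEquiv.symm p.1, finFunctionFinEquiv.symm p.2))
    (fun x x' y => by ext p; simp [detectorPhi, detectorPsi]; ring)
    (fun c x y => by ext p; simp [detectorPhi, detectorPsi]; ring)
    (fun x y y' => by ext p; simp [detectorPhi, detectorPsi]; ring)
    (fun c x y => by ext p; simp [detectorPhi, detectorPsi]; ring)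

theorem detectorBilin_apply (x y : EuclideanSpace ℝ (Fin (n ^ l))) (p : Fin (n ^ l) × Fin (n ^ l)) :
    detectorBilin l n x y p =
      detectorPhi (fun I => x (finFunctionFinEquiv I)) (fun I => y (finFunctionFinEquiv I))
        (finFunctionFinEquiv.symm p.1, finFunctionFinEquiv.symm p.2) := rfl

theorem detectorBilin_flatVec (X Y : Tensor l n) (p : Fin (n ^ l) × Fin (n ^ l)) :
    detectorBilin l n (flatVec X) (flatVec Y) p =
      detectorPhi X Y (finFunctionFinEquiv.symm p.1, finFunctionFinEquiv.symm p.2) := by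
  rw [detectorBilin_apply]
  simp only [flatVec_apply, Equiv.symm_apply_apply]

theorem sum_flat_pairs (f : (Fin l → Fin n) × (Fin l → Fin n) → ℝ) :
    ∑ p : Fin (n ^ l) × Fin (n ^ l),
      f (finFunctionFinEquiv.symm p.1, finFunctionFinEquiv.symm p.2) = ∑ p, f p :=
  Equiv.sum_comp (finFunctionFinEquiv.symm.prodCongr finFunctionFinEquiv.symm) f

theorem norm_detectorBilin_le (x y : EuclideanSpace ℝ (Fin (n ^ l))) :
    ‖detectorBilin l n x y‖ ≤ 4 * ‖x‖ * ‖y‖ := by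
  refine le_of_sq_le_sq ?_ (by positivity)
  rw [EuclideanSpace.real_norm_sq_eq]
  simp only [detectorBilin_apply]
  rw [sum_flat_pairs fun p => detectorPhi (fun I => x (finFunctionFinEquiv I))
    (fun I => y (finFunctionFinEquiv I)) p ^ 2]
  refine (sum_detectorPhi_sq_le _ _).trans (le_of_eq ?_)
  rw [Equiv.sum_comp finFunctionFinEquiv fun i => x i ^ 2,
    Equiv.sum_comp finFunctionFinEquiv fun i => y i ^ 2, ← EuclideanSpace.real_norm_sq_eq,
    ← EuclideanSpace.real_norm_sq_eq]
  ring

theorem detectorBilin_comm (x y : EuclideanSpace ℝ (Fin (n ^ l))) :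
    detectorBilin l n x y = detectorBilin l n y x := by
  ext p; rw [detectorBilin_apply, detectorPhi_comm, ← detectorBilin_apply]

theorem detectorBilin_tensorPow_self (a : EuclideanSpace ℝ (Fin n)) :
    detectorBilin l n (flatVec (tensorPow l a)) (flatVec (tensorPow l a)) = 0 := by
  ext p; rw [detectorBilin_flatVec, detectorPhi_tensorPow_self]; rfl

/-! ### Index arithmetic -/

/-- The last index of a multi-index is the most significant digit of its address. Exchanging last
indices therefore exchanges the leading digits i₁ and j₁, which is how the program evaluates the
detector. -/
theorem finFunctionFinEquiv_replaceLast {i₁ i₀ j₁ j₀ : ℕ} (hl : 1 ≤ l)  (hi₀ : i₀ < n ^ (l - 1)) (hj₀ : j₀ < n ^ (l - 1))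
    (hi : i₁ * n ^ (l - 1) + i₀ < n ^ l) (hj : j₁ * n ^ (l - 1) + j₀ < n ^ l)
    (hji : j₁ * n ^ (l - 1) + i₀ < n ^ l) :
    finFunctionFinEquiv (replaceLast (finFunctionFinEquiv.symm ⟨i₁ * n ^ (l - 1) + i₀, hi⟩)
      (finFunctionFinEquiv.symm ⟨j₁ * n ^ (l - 1) + j₀, hj⟩)) = ⟨j₁ * n ^ (l - 1) + i₀, hji⟩ := by
  refine (Equiv.eq_symm_apply _).1 ?_
  funext s
  refine Fin.ext ?_
  simp only [replaceLast]
  have hpos : 0 < n ^ (l - 1) := by omega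
  split_ifs with hs
  · have hs' : s.val = l - 1 := by omega
    simp only [finFunctionFinEquiv_symm_apply_val, hs']
    rw [mul_comm, Nat.mul_add_div hpos, Nat.mul_add_div hpos, Nat.div_eq_of_lt hi₀,
      Nat.div_eq_of_lt hj₀]
  · simp only [finFunctionFinEquiv_symm_apply_val]
    have hs1 : n ^ (l - 1) = n ^ s.val * (n * n ^ (l - 2 - s)) := by
      rw [← pow_succ', ← pow_add]; congr 1; omega
    have hsp : 0 < n ^ s.val := by
      rw [hs1] at hpos
      exact Nat.pos_of_mul_pos_right hpos
    have : ∀ i, (i * n ^ (l - 1) + i₀) / n ^ s.val % n = i₀ / n ^ s.val % n := by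
      intro i
      rw [hs1, show i * (n ^ s.val * (n * n ^ (l - 2 - s))) + i₀ =
        n ^ s.val * (n * (n ^ (l - 2 - s) * i)) + i₀ by ring, Nat.mul_add_div hsp, Nat.mul_add_mod]
    rw [this, this]

theorem flat_lt (hl : 1 ≤ l) {i₁ i₀ : ℕ} (hi₁ : i₁ < n) (hi₀ : i₀ < n ^ (l - 1)) :
    i₁ * n ^ (l - 1) + i₀ < n ^ l := by
  have : n ^ l = n * n ^ (l - 1) := by rw [← pow_succ']; congr 1; omega
  rw [this]
  nlinarith

theorem detectorBilin_apply_flat (hl : 1 ≤ l) {i₁ i₀ j₁ j₀ : ℕ} (hi₁ : i₁ < n) (hj₁ : j₁ < n)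
    (hi₀ : i₀ < n ^ (l - 1)) (hj₀ : j₀ < n ^ (l - 1)) (x y : EuclideanSpace ℝ (Fin (n ^ l))) :
    detectorBilin l n x y (⟨_, flat_lt hl hi₁ hi₀⟩, ⟨_, flat_lt hl hj₁ hj₀⟩) =
      x ⟨_, flat_lt hl hi₁ hi₀⟩ * y ⟨_, flat_lt hl hj₁ hj₀⟩ -
      x ⟨_, flat_lt hl hj₁ hi₀⟩ * y ⟨_, flat_lt hl hi₁ hj₀⟩ +
      (y ⟨_, flat_lt hl hi₁ hi₀⟩ * x ⟨_, flat_lt hl hj₁ hj₀⟩ -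
      y ⟨_, flat_lt hl hj₁ hi₀⟩ * x ⟨_, flat_lt hl hi₁ hj₀⟩) := by
  rw [detectorBilin_apply]
  simp only [detectorPhi, detectorPsi, Equiv.apply_symm_apply]
  rw [finFunctionFinEquiv_replaceLast hl hi₀ hj₀ _ _ (flat_lt hl hj₁ hi₀),
    finFunctionFinEquiv_replaceLast hl hj₀ hi₀ _ _ (flat_lt hl hi₁ hj₀)]

theorem finFunctionFinEquiv_const (j : Fin n) :
    (finFunctionFinEquiv (fun _ : Fin l => j)).val = j * ∑ s ∈ Finset.range l, n ^ s := by
  rw [finFunctionFinEquiv_apply, Finset.sum_range, Finset.mul_sum]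

theorem flatVec_tensorPow_const (a : EuclideanSpace ℝ (Fin n)) (j : Fin n) (x : Fin (n ^ l))
    (hx : x.val = j * ∑ s ∈ Finset.range l, n ^ s) : flatVec (tensorPow l a) x = a j ^ l := by
  obtain rfl : x = finFunctionFinEquiv (fun _ : Fin l => j) :=
    Fin.ext (hx.trans (finFunctionFinEquiv_const j).symm)
  simp [flatVec_apply, tensorPow]

theorem finFunctionFinEquiv_cons (hl : 1 ≤ l) (i j : Fin n) :
    (finFunctionFinEquiv (fun s : Fin l => if s.val = 0 then i else j)).val =
      i + j * (∑ s ∈ Finset.range l, n ^ s - 1) := by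
  obtain ⟨m, rfl⟩ : ∃ m, l = m + 1 := ⟨l - 1, by omega⟩
  rw [finFunctionFinEquiv_apply, Fin.sum_univ_succ, Finset.sum_range_succ', pow_zero,
    Nat.add_sub_cancel, Finset.sum_range, Finset.mul_sum]
  simp

theorem flatVec_tensorPow_cons (hl : 1 ≤ l) (a : EuclideanSpace ℝ (Fin n)) (i j : Fin n)
    (x : Fin (n ^ l)) (hx : x.val = i + j * (∑ s ∈ Finset.range l, n ^ s - 1)) :
    flatVec (tensorPow l a) x = a i * a j ^ (l - 1) := by
  obtain rfl : x = finFunctionFinEquiv (fun s : Fin l => if s.val = 0 then i else j) :=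
    Fin.ext (hx.trans (finFunctionFinEquiv_cons hl i j).symm)
  obtain ⟨m, rfl⟩ : ∃ m, l = m + 1 := ⟨l - 1, by omega⟩
  rw [flatVec_apply, Equiv.symm_apply_apply, tensorPow, Fin.prod_univ_succ]
  simp

/-! ### Condition numbers and flattened tensors -/

theorem norm_khatriRaoPow_apply (A : Fin R → EuclideanSpace ℝ (Fin n))
    (c : EuclideanSpace ℝ (Fin R)) :
    ‖(khatriRaoPow l A).toEuclideanLin c‖ = ‖∑ r, c r • flatVec (tensorPow l (A r))‖ := by
  refine (sq_eq_sq₀ (norm_nonneg _) (norm_nonneg _)).1 ?_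
  rw [EuclideanSpace.real_norm_sq_eq, EuclideanSpace.real_norm_sq_eq,
    ← Equiv.sum_comp finFunctionFinEquiv.symm]
  refine Finset.sum_congr rfl fun x _ => ?_
  rw [toEuclideanLin_coord]
  simp only [khatriRaoPow, Matrix.of_apply, WithLp.ofLp_sum, Finset.sum_apply, PiLp.smul_apply,
    smul_eq_mul, flatVec_apply]
  congr 1
  exact Finset.sum_congr rfl fun r _ => mul_comm _ _

theorem norm_detectorMatrix_apply (A : Fin R → EuclideanSpace ℝ (Fin n))
    (y : EuclideanSpace ℝ {q : Fin R × Fin R // q.1 < q.2}) :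
    ‖(detectorMatrix l A).toEuclideanLin y‖ =
      ‖∑ p, y p • detectorBilin l n (flatVec (tensorPow l (A p.1.1)))
        (flatVec (tensorPow l (A p.1.2)))‖ := by
  refine (sq_eq_sq₀ (norm_nonneg _) (norm_nonneg _)).1 ?_
  rw [EuclideanSpace.real_norm_sq_eq, EuclideanSpace.real_norm_sq_eq,
    ← sum_flat_pairs]
  refine Finset.sum_congr rfl fun x _ => ?_
  rw [toEuclideanLin_coord]
  simp only [detectorMatrix, Matrix.of_apply, WithLp.ofLp_sum, Finset.sum_apply, PiLp.smul_apply,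
    smul_eq_mul, detectorBilin_flatVec]
  congr 1
  exact Finset.sum_congr rfl fun r _ => mul_comm _ _

/-- Elementary mean value estimate; it compares the Gram determinant of the tensor powers with that
of the vectors. -/
theorem pow_sub_pow_le_mul {P C : ℝ} (hC : 0 ≤ C) (hCP : C ≤ P) (m : ℕ) :
    P ^ (m + 1) - C ^ (m + 1) ≤ (m + 1) * P ^ m * (P - C) := by
  induction m with
  | zero => simp
  | succ m ih =>
    have h1 : C ^ (m + 1) ≤ P ^ (m + 1) := pow_le_pow_left₀ hC hCP _
    have h0 : 0 ≤ P := hC.trans hCP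
    calc P ^ (m + 1 + 1) - C ^ (m + 1 + 1) =
          P * (P ^ (m + 1) - C ^ (m + 1)) + C ^ (m + 1) * (P - C) := by ring
      _ ≤ P * ((m + 1) * P ^ m * (P - C)) + P ^ (m + 1) * (P - C) := by
          have : 0 ≤ P - C := by linarith
          gcongr
      _ = _ := by push_cast; ring

/-- Two tensor powers which are far from parallel have a large detector value. -/
theorem le_norm_detectorBilin_sq (hl : 2 ≤ l) (a b : EuclideanSpace ℝ (Fin n)) {σ κ : ℝ}
    (hσ : 0 < σ)
    (hlow : ∀ s t : ℝ, σ ^ 2 * (s ^ 2 + t ^ 2) ≤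
      ‖s • flatVec (tensorPow l a) + t • flatVec (tensorPow l b)‖ ^ 2)
    (hκ : 0 < κ) (ha : ‖flatVec (tensorPow l a)‖ ≤ κ * σ) (hb : ‖flatVec (tensorPow l b)‖ ≤ κ * σ) :
    (2 * σ ^ 2 / (l * κ ^ 2)) ^ 2 ≤
      ‖detectorBilin l n (flatVec (tensorPow l a)) (flatVec (tensorPow l b))‖ ^ 2 := by
  obtain ⟨m, rfl⟩ : ∃ m, l = m + 2 := ⟨l - 2, by omega⟩
  set x := flatVec (tensorPow (m + 2) a) with hx
  set y := flatVec (tensorPow (m + 2) b) with hy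
  have hΦ : ‖detectorBilin (m + 2) n x y‖ ^ 2 =
      4 * ((‖a‖ ^ 2 * ‖b‖ ^ 2) ^ (m + 1) - (inner ℝ a b ^ 2) ^ (m + 1)) *
        (‖a‖ ^ 2 * ‖b‖ ^ 2 - inner ℝ a b ^ 2) := by
    rw [EuclideanSpace.real_norm_sq_eq, ← sum_detectorPhi_tensorPow_sq]
    simp only [hx, hy, detectorBilin_flatVec]
    rw [sum_flat_pairs fun p =>
      detectorPhi (tensorPow (m + 2) a) (tensorPow (m + 2) b) p ^ 2]
  rw [hΦ]
  set P := ‖a‖ ^ 2 * ‖b‖ ^ 2 with hP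
  set C := inner ℝ a b ^ 2 with hC
  have hC0 : 0 ≤ C := sq_nonneg _
  have hCP : C ≤ P := by
    rw [hC, hP, ← mul_pow, ← sq_abs]
    exact pow_le_pow_left₀ (abs_nonneg _) (abs_real_inner_le_norm a b) 2
  have hPl : ‖x‖ ^ 2 * ‖y‖ ^ 2 = P ^ (m + 2) := by
    rw [hx, hy, norm_flatVec_tensorPow, norm_flatVec_tensorPow, hP]; ring
  have hCl : inner ℝ x y ^ 2 = C ^ (m + 2) := by
    rw [hx, hy, inner_flatVec_tensorPow, hC]; ring
  have hyσ : σ ^ 2 ≤ ‖y‖ ^ 2 := by simpa using hlow 0 1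
  have hy0 : 0 < ‖y‖ ^ 2 := lt_of_lt_of_le (by positivity) hyσ
  -- The right side is the Gram determinant of x and y. It is reached by testing the lower bound on
  -- ‖y‖² x - ⟨x, y⟩ y, the part of x orthogonal to y up to scale.
  have hgram : σ ^ 4 ≤ P ^ (m + 2) - C ^ (m + 2) := by
    have h1 := hlow (‖y‖ ^ 2) (-inner ℝ x y)
    have h2 : ‖(‖y‖ ^ 2) • x + (-inner ℝ x y) • y‖ ^ 2 =
        ‖y‖ ^ 2 * (P ^ (m + 2) - C ^ (m + 2)) := by
      rw [← hPl, ← hCl, norm_add_sq_real, norm_smul, norm_smul, inner_smul_left, inner_smul_right]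
      simp only [Real.norm_eq_abs, mul_pow, sq_abs, conj_trivial]
      ring
    rw [h2] at h1
    have h3 : ‖y‖ ^ 2 * (σ ^ 2 * ‖y‖ ^ 2) ≤ ‖y‖ ^ 2 * (P ^ (m + 2) - C ^ (m + 2)) := by
      refine le_trans ?_ h1
      nlinarith [sq_nonneg (σ * inner ℝ x y)]
    have h4 := le_of_mul_le_mul_left h3 hy0
    nlinarith [sq_nonneg σ]
  have h1 := pow_sub_pow_le_mul hC0 hCP (m + 1)
  have hPpos : 0 < P := by
    rcases (hC0.trans hCP).eq_or_lt with h | h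
    · rw [← h, zero_pow (by omega)] at hgram
      have : 0 ≤ C ^ (m + 2) := by positivity
      have : 0 < σ ^ 4 := by positivity
      linarith
    · exact h
  have hPC : σ ^ 4 / ((m + 2) * P ^ (m + 1)) ≤ P - C := by
    rw [div_le_iff₀ (by positivity)]
    push_cast at h1
    calc _ ≤ _ := hgram
      _ ≤ _ := h1
      _ = _ := by ring
  have h2 : P ^ m * (P - C) ≤ P ^ (m + 1) - C ^ (m + 1) := by
    have : C ^ m ≤ P ^ m := pow_le_pow_left₀ hC0 hCP m
    rw [pow_succ, pow_succ]
    nlinarith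
  have h0 : 0 ≤ σ ^ 4 / ((m + 2) * P ^ (m + 1)) := by positivity
  have hPκ : P ^ (m + 2) ≤ (κ * σ) ^ 4 := by
    rw [← hPl]
    calc _ ≤ (κ * σ) ^ 2 * (κ * σ) ^ 2 := by gcongr
      _ = _ := by ring
  -- The powers of P combine to P^{m+2} = ‖x‖²‖y‖² in the denominator, so the bound does not depend
  -- on the separate lengths of a and b.
  calc _ = 4 * σ ^ 8 / ((m + 2) ^ 2 * (κ * σ) ^ 4) := by
        push_cast; field_simp; norm_num
    _ ≤ 4 * σ ^ 8 / ((m + 2) ^ 2 * P ^ (m + 2)) := by gcongr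
    _ = 4 * (P ^ m * (σ ^ 4 / ((m + 2) * P ^ (m + 1)))) * (σ ^ 4 / ((m + 2) * P ^ (m + 1))) := by
        field_simp
        ring
    _ ≤ 4 * (P ^ m * (P - C)) * (P - C) := by gcongr
    _ ≤ _ := by
        have : 0 ≤ P - C := by linarith
        gcongr

/-- What finite condition numbers say about the flattened tensor powers. -/
theorem exists_stretch_of_condNumber (hl : 2 ≤ l) (hR : R ≠ 0)
    (A : Fin R → EuclideanSpace ℝ (Fin n))
    (hU : condNumber (khatriRaoPow l A) ≠ ⊤) (hM : condNumber (detectorMatrix l A) ≠ ⊤) :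
    ∃ σ : ℝ, 0 < σ ∧
      (∀ c : EuclideanSpace ℝ (Fin R), σ * ‖c‖ ≤ ‖∑ i, c i • flatVec (tensorPow l (A i))‖) ∧
      (∀ c : EuclideanSpace ℝ (Fin R), ‖∑ i, c i • flatVec (tensorPow l (A i))‖ ≤
        (condNumber (khatriRaoPow l A)).toReal * σ * ‖c‖) ∧
      (∀ y : {p : Fin R × Fin R // p.1 < p.2} → ℝ,
        (2 * σ ^ 2 / (l * (condNumber (khatriRaoPow l A)).toReal ^ 2 *
          (condNumber (detectorMatrix l A)).toReal)) ^ 2 * ∑ p, y p ^ 2 ≤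
        ‖∑ p, y p • detectorBilin l n (flatVec (tensorPow l (A p.1.1)))
          (flatVec (tensorPow l (A p.1.2)))‖ ^ 2) ∧ R ≤ n ^ l := by
  obtain ⟨σ, hσ, hκ, hlow, hup⟩ := exists_stretch_of_condNumber_ne_top _ (by simpa using hR) hU
  simp only [norm_khatriRaoPow_apply] at hlow hup
  refine ⟨σ, hσ, hlow, hup, fun y => ?_, ?_⟩
  · set κ := (condNumber (khatriRaoPow l A)).toReal
    set κM := (condNumber (detectorMatrix l A)).toReal with hκM
    have hκM1 : 1 ≤ κM := one_le_condNumber_toReal _ hM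
    by_cases h0 : Fintype.card {q : Fin R × Fin R // q.1 < q.2} = 0
    · have : IsEmpty {q : Fin R × Fin R // q.1 < q.2} := Fintype.card_eq_zero_iff.1 h0
      simp
    obtain ⟨τ, hτ, -, hlowM, hupM⟩ := exists_stretch_of_condNumber_ne_top _ h0 hM
    simp only [norm_detectorMatrix_apply] at hlowM hupM
    obtain ⟨⟨⟨i, j⟩, hij⟩⟩ := Fintype.card_pos_iff.1 (Nat.pos_of_ne_zero h0)
    have hij' : i ≠ j := ne_of_lt hij
    -- κ_M bounds only the ratio of the extreme singular values. One column fixes the scale: its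
    -- norm is at most κ_M times the smallest singular value τ, and at least the bound of
    -- `le_norm_detectorBilin_sq`.
    have hcol := hupM (EuclideanSpace.single ⟨(i, j), hij⟩ 1)
    simp only [PiLp.single_apply, ite_smul, one_smul, zero_smul, Finset.sum_ite_eq',
      Finset.mem_univ, if_true, PiLp.norm_single, norm_one, mul_one] at hcol
    have hun : ∀ i, ‖flatVec (tensorPow l (A i))‖ ≤ κ * σ := by
      intro i
      simpa [PiLp.single_apply, ite_smul] using hup (EuclideanSpace.single i 1)
    have hpair := le_norm_detectorBilin_sq hl (A i) (A j) (σ := σ) (κ := κ) hσ (by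
      intro s t
      have h1 := hlow (EuclideanSpace.single i s + EuclideanSpace.single j t)
      have h2 : ∑ r, (EuclideanSpace.single i s + EuclideanSpace.single j t :
          EuclideanSpace ℝ (Fin R)) r • flatVec (tensorPow l (A r)) =
          s • flatVec (tensorPow l (A i)) + t • flatVec (tensorPow l (A j)) := by
        simp [PiLp.single_apply, add_smul, ite_smul, Finset.sum_add_distrib]
      rw [h2] at h1
      have h3 : ‖(EuclideanSpace.single i s + EuclideanSpace.single j t :
          EuclideanSpace ℝ (Fin R))‖ ^ 2 = s ^ 2 + t ^ 2 := by
        rw [norm_add_sq_real, PiLp.norm_single, PiLp.norm_single,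
          EuclideanSpace.inner_single_left]
        simp [hij']
      rw [← h3, ← mul_pow]
      exact pow_le_pow_left₀ (by positivity) h1 2) (by linarith) (hun i) (hun j)
    have hl0 : (0 : ℝ) < l := by exact_mod_cast (show 0 < l by omega)
    have h5 : 2 * σ ^ 2 / (l * κ ^ 2) ≤ κM * τ :=
      (le_of_sq_le_sq hpair (norm_nonneg _)).trans hcol
    have h6 : 2 * σ ^ 2 / (l * κ ^ 2 * κM) ≤ τ := by
      rw [← div_div, div_le_iff₀ (by linarith)]
      linarith
    have h7 := hlowM (WithLp.toLp 2 y)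
    have h8 : ‖(WithLp.toLp 2 y : EuclideanSpace ℝ {q : Fin R × Fin R // q.1 < q.2})‖ ^ 2 =
        ∑ p, y p ^ 2 := EuclideanSpace.real_norm_sq_eq _
    rw [← h8, ← mul_pow]
    refine pow_le_pow_left₀ (by positivity) (le_trans ?_ h7) 2
    gcongr
  · let φ : EuclideanSpace ℝ (Fin R) →ₗ[ℝ] EuclideanSpace ℝ (Fin (n ^ l)) :=
      { toFun := fun c => ∑ i, c i • flatVec (tensorPow l (A i))
        map_add' := fun c c' => by simp [add_smul, Finset.sum_add_distrib]
        map_smul' := fun t c => by simp [mul_smul, Finset.smul_sum] }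
    have hφ : Function.Injective φ := by
      rw [← LinearMap.ker_eq_bot, LinearMap.ker_eq_bot']
      intro c hc
      have := hlow c
      rw [show ∑ i, c i • flatVec (tensorPow l (A i)) = φ c from rfl, hc, norm_zero] at this
      have h1 : ‖c‖ ≤ 0 := by
        by_contra hcon
        push Not at hcon
        have := mul_pos hσ hcon
        linarith
      exact norm_le_zero_iff.1 h1
    have := LinearMap.finrank_le_finrank_of_injective hφ
    simpa using this

theorem sum_range_eq_card_pairs (R : ℕ) :
    ∑ i ∈ Finset.range R, i = Fintype.card {p : Fin R × Fin R // p.1 < p.2} := by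
  have h : ∀ j : Fin R, (Finset.univ.filter fun i : Fin R => i < j).card = j := by
    intro j
    rw [show (Finset.univ.filter fun i : Fin R => i < j) = Finset.Iio j by ext; simp, Fin.card_Iio]
  rw [Fintype.card_subtype, Finset.sum_range]
  rw [Finset.card_filter, Fintype.sum_prod_type, Finset.sum_comm]
  refine Finset.sum_congr rfl fun j _ => ?_
  rw [← Finset.card_filter, h]

theorem two_mul_sum_range_add (R : ℕ) : 2 * ∑ i ∈ Finset.range R, i + R = R * R := by
  rw [mul_comm, Finset.sum_range_id_mul_two]
  cases R with
  | zero => rfl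
  | succ R => simp; ring

end DetectorTensor

/-! ### The error budget -/

section Budget

variable {n l R : ℕ}

/-- The loss exponent of the error bound in the condition numbers. -/
def lossExponent (l : ℕ) : ℕ := 46 + 32 * l + 4 * l ^ 2

theorem two_mul_pow_le {B : ℝ} (hB : 2 ≤ B) (hR : (R : ℝ) ≤ B ^ l) :
    2 * (2 * (R : ℝ)) ^ (2 * l) ≤ B ^ lossExponent l := by
  calc 2 * (2 * (R : ℝ)) ^ (2 * l) ≤ B * (B * B ^ l) ^ (2 * l) := by gcongr
    _ = B ^ (1 + (l + 1) * (2 * l)) := by rw [← pow_succ', ← pow_mul, ← pow_succ', add_comm]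
    _ ≤ _ := pow_le_pow_right₀ (by linarith) (by unfold lossExponent; nlinarith)

/-- All errors are linear in √η/σ, and t = σ^{1/l} is the natural length of a component. Put ρ =
ε/t. Since the tensor is not small, ρ is at most V = 4R²κ²; the hypothesis on η says √η/σ ≤ ρ^l/D.
Writing ρ^l = ρ · ρ^{l-1} and bounding only ρ^{l-1} by V^{l-1} yields the absolute bound ε, and
bounding the last ρ as well yields the relative bound 1. -/
theorem budget (hn : 2 ≤ n) (hl : 2 ≤ l) (hR1 : 1 ≤ R) (hRN : R ≤ n ^ l) {κ κM η σ ε τ t : ℝ}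
    (hκ : 1 ≤ κ) (hκM : 1 ≤ κM) (hη0 : 0 ≤ η) (hσ : 0 < σ) (hε : 0 < ε) (ht : 0 < t)
    (htσ : t ^ l = σ) (hτ : τ ≤ R * κ ^ 2 * σ ^ 2 + η) (hετ : ε ^ (2 * l) ≤ (2 * R) ^ (2 * l) * τ)
    (hη : η ≤ ε ^ (2 * l) / (n * κ * κM) ^ lossExponent l) :
    50000 * ((n : ℝ) ^ l) ^ 11 * l * κ ^ 6 * κM * (√η / σ) ≤ 1 ∧
      50000 * ((n : ℝ) ^ l) ^ 11 * l * κ ^ 6 * κM * (√η / σ) * t ≤ ε := by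
  set B := n * κ * κM with hB
  have hn' : (2 : ℝ) ≤ n := by exact_mod_cast hn
  have hR' : (1 : ℝ) ≤ R := by exact_mod_cast hR1
  have hl' : (1 : ℝ) ≤ l := by exact_mod_cast (show 1 ≤ l by omega)
  have hnκ : (n : ℝ) ≤ n * κ := le_mul_of_one_le_right (by linarith) hκ
  have hκn : κ ≤ n * κ := le_mul_of_one_le_left (by linarith) (by linarith)
  have hnB : (n : ℝ) ≤ B := hnκ.trans (le_mul_of_one_le_right (by positivity) hκM)
  have hκB : κ ≤ B := hκn.trans (le_mul_of_one_le_right (by positivity) hκM)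
  have hκMB : κM ≤ B := le_mul_of_one_le_left (by linarith) (by linarith)
  have hB2 : 2 ≤ B := hn'.trans hnB
  have hB0 : 0 < B := by linarith
  have hNB : (n : ℝ) ^ l ≤ B ^ l := by gcongr
  have hRN' : (R : ℝ) ≤ (n : ℝ) ^ l := by exact_mod_cast hRN
  have hRB : (R : ℝ) ≤ B ^ l := hRN'.trans hNB
  have hlB : (l : ℝ) ≤ B ^ l := by
    calc (l : ℝ) ≤ (2 : ℝ) ^ l := by exact_mod_cast Nat.lt_two_pow_self.le
      _ ≤ _ := by gcongr
  set V : ℝ := 4 * R ^ 2 * κ ^ 2 with hV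
  set Z : ℝ := 50000 * ((n : ℝ) ^ l) ^ 11 * l * κ ^ 6 * κM with hZ
  -- The exponent is half of `lossExponent l`, because η enters through its square root. It collects
  -- the factors of Z V^l: 16 for the constant, 11l + l for the dimension and l, 6 + 1 for the
  -- condition numbers, and (2l + 4) l for V^l.
  set D : ℝ := B ^ (23 + 16 * l + 2 * l ^ 2) with hD
  have hD0 : 0 < D := by positivity
  have hZ0 : 0 < Z := by positivity
  have hV0 : 0 < V := by positivity
  have hZV : Z * V ^ l ≤ D := by
    have hVB : V ≤ B ^ (2 * l + 4) := by
      calc V ≤ B ^ 2 * (B ^ l) ^ 2 * B ^ 2 := by rw [hV]; gcongr; nlinarith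
        _ = _ := by ring
    have h5 : (50000 : ℝ) ≤ B ^ 16 := by
      calc (50000 : ℝ) ≤ 2 ^ 16 := by norm_num
        _ ≤ _ := by gcongr
    calc Z * V ^ l ≤ B ^ 16 * (B ^ l) ^ 11 * B ^ l * B ^ 6 * B * (B ^ (2 * l + 4)) ^ l := by
          rw [hZ]; gcongr
      _ = D := by rw [hD]; ring
  have hηB : η * B ^ lossExponent l ≤ ε ^ (2 * l) := (le_div_iff₀ (by positivity)).1 hη
  set M : ℝ := (2 * (R : ℝ)) ^ (2 * l) with hM
  have hM0 : 0 < M := by positivity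
  have h2M := two_mul_pow_le hB2 hRB
  -- The hypotheses give 2Mη ≤ M(Rκ²σ² + η), and η on the right is absorbed.
  have hησ : η ≤ R * κ ^ 2 * σ ^ 2 := by
    have h1 : η * (2 * M) ≤ M * (R * κ ^ 2 * σ ^ 2 + η) := by
      calc _ ≤ η * B ^ lossExponent l := by gcongr
        _ ≤ _ := hηB
        _ ≤ _ := hετ
        _ ≤ _ := by gcongr
    have h2 : M * η ≤ M * (R * κ ^ 2 * σ ^ 2) := by linarith
    exact le_of_mul_le_mul_left h2 hM0
  have hεV : ε ≤ V * t := by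
    refine le_of_pow_le_pow_left₀ (n := 2 * l) (by omega) (by positivity) ?_
    calc ε ^ (2 * l) ≤ M * τ := hετ
      _ ≤ M * (2 * R * κ ^ 2 * σ ^ 2) := by gcongr; linarith
      _ ≤ M * ((2 * R * κ ^ 2) ^ (2 * l) * σ ^ 2) := by
          gcongr
          have h1 : 1 ≤ 2 * R * κ ^ 2 := by
            have : 1 ≤ κ ^ 2 := one_le_pow₀ hκ
            nlinarith
          exact le_self_pow₀ h1 (by omega)
      _ = (V * t) ^ (2 * l) := by
          rw [hM, hV, ← htσ]
          simp only [mul_pow, ← pow_mul]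
          rw [show (4 : ℝ) = 2 ^ 2 by norm_num, ← pow_mul]
          ring
  set ρ := ε / t with hρ
  have hρ0 : 0 < ρ := by positivity
  have hρV : ρ ≤ V := (div_le_iff₀ ht).2 hεV
  have hξ : √η / σ ≤ ρ ^ l / D := by
    rw [div_le_div_iff₀ hσ hD0]
    refine le_of_sq_le_sq ?_ (by positivity)
    rw [mul_pow, mul_pow, Real.sq_sqrt hη0, hρ, div_pow, htσ]
    have h1 : D ^ 2 = B ^ lossExponent l := by rw [hD, ← pow_mul]; congr 1; unfold lossExponent; ring
    rw [h1]
    calc _ ≤ ε ^ (2 * l) := hηB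
      _ = _ := by field_simp; ring
  have hξ0 : 0 ≤ √η / σ := by positivity
  clear_value Z V D ρ
  obtain ⟨k, hk⟩ : ∃ k, l = k + 1 := ⟨l - 1, by omega⟩
  rw [hk] at hξ hZV
  have hρk : Z * (√η / σ) ≤ Z * V ^ k / D * ρ := by
    calc Z * (√η / σ) ≤ Z * (ρ ^ (k + 1) / D) := by gcongr
      _ = Z * ρ ^ k / D * ρ := by ring
      _ ≤ _ := by gcongr
  constructor
  · refine hρk.trans ?_
    calc _ ≤ Z * V ^ k / D * V := by gcongr
      _ = Z * V ^ (k + 1) / D := by ring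
      _ ≤ 1 := (div_le_one hD0).2 hZV
  · have hVk : Z * V ^ k / D ≤ 1 := by
      rw [div_le_one hD0]
      refine le_trans ?_ hZV
      have hV1 : 1 ≤ V := by
        rw [hV]
        have : 1 ≤ κ ^ 2 := one_le_pow₀ hκ
        have : (1 : ℝ) ≤ R ^ 2 := one_le_pow₀ hR'
        nlinarith
      rw [pow_succ, ← mul_assoc]
      exact le_mul_of_one_le_right (by positivity) hV1
    calc Z * (√η / σ) * t ≤ 1 * ρ * t := by
          exact mul_le_mul_of_nonneg_right (hρk.trans (by gcongr)) ht.le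
      _ = ε := by rw [hρ]; field_simp

end Budget

/-! ### The matrices of the algorithm -/

section Plan

variable {n l R : ℕ}

/-- The scaled leading eigenvectors of the symmetric part of a matrix. -/
def scaledEigvec {N : ℕ} (M : Matrix (Fin N) (Fin N) ℝ) (hR : R ≤ N) (k : Fin R) :
    EuclideanSpace ℝ (Fin N) :=
  √(symEigenvalue M (Fin.castLE hR k)) • symBasis M (Fin.castLE hR k)

/-- The Gram matrix of the detector values on all pairs. -/
def detectorGram (w : Fin R → EuclideanSpace ℝ (Fin (n ^ l))) :
    Matrix (Fin (R * R)) (Fin (R * R)) ℝ :=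
  Matrix.of fun p p' => inner ℝ
    (detectorBilin l n (w (finProdFinEquiv.symm p).1) (w (finProdFinEquiv.symm p).2))
    (detectorBilin l n (w (finProdFinEquiv.symm p').1) (w (finProdFinEquiv.symm p').2))

/-- The matrices in the numerical kernel of the detector. -/
def kernelMat (w : Fin R → EuclideanSpace ℝ (Fin (n ^ l))) (t : ℕ) : Matrix (Fin R) (Fin R) ℝ :=
  Matrix.of fun a b =>
    if h : ∑ i ∈ Finset.range R, i + t < R * R then
      symEigenvector (detectorGram w) ⟨_, h⟩ (finProdFinEquiv (a, b)) else 0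

/-- The entries of `W X Wᵀ`. -/
def conjEntry {N : ℕ} (w : Fin R → EuclideanSpace ℝ (Fin N)) (X : Matrix (Fin R) (Fin R) ℝ)
    (x y : Fin N) : ℝ := ∑ k, w k x * ∑ j, X k j * w j y

/-- The position of the diagonal multi-index `(j, …, j)`. -/
def diagIndex (l : ℕ) {n : ℕ} (j : Fin n) : Fin (n ^ l) := finFunctionFinEquiv fun _ => j

/-- The position of the multi-index `(i, j, …, j)`. -/
def nearDiagIndex (l : ℕ) {n : ℕ} (i j : Fin n) : Fin (n ^ l) :=
  finFunctionFinEquiv fun s => if s.val = 0 then i else j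

/-- The component read off from a matrix close to `u uᵀ`, where `u` is a flattened tensor power. -/
def readRow (H : Fin (n ^ l) → Fin (n ^ l) → ℝ) (j : Fin n) : EuclideanSpace ℝ (Fin n) :=
  WithLp.toLp 2 fun m => H (nearDiagIndex l m j) (diagIndex l j) / H (diagIndex l j) (diagIndex l j) *
    (max (H (diagIndex l j) (diagIndex l j)) 0) ^ (((2 * l : ℕ) : ℝ)⁻¹)

/-- The entrywise estimate is relative to the largest coordinate A₀. Since ‖a‖² ≤ n A₀², passing to
the norm of a costs n^l in the relative error, and one more factor n collects the coordinates. -/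
theorem exists_norm_sub_readRow_le (hl : 1 ≤ l) (a : EuclideanSpace ℝ (Fin n))
    (ha : a ≠ 0) {θ : ℝ} (hθ : 16 * (((n : ℝ) ^ l) * θ) ≤ ‖a‖ ^ (2 * l))
    (H : Fin (n ^ l) → Fin (n ^ l) → ℝ)
    (hH : ∀ x y, |H x y - flatVec (tensorPow l a) x * flatVec (tensorPow l a) y| ≤ θ)
    (j : Fin n) (hj : ∀ m, H (diagIndex l m) (diagIndex l m) ≤ H (diagIndex l j) (diagIndex l j)) :
    ∃ s : ℝ, (s = 1 ∨ s = -1) ∧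
      ‖a - s • readRow H j‖ ≤ n * (24 * ((n : ℝ) ^ l * θ / ‖a‖ ^ (2 * l)) * ‖a‖) := by
  have hθ0 : 0 ≤ θ := (abs_nonneg _).trans (hH (diagIndex l j) (diagIndex l j))
  obtain ⟨m₀, -, hm₀⟩ := Finset.exists_max_image Finset.univ (fun m => |a m|) ⟨j, Finset.mem_univ j⟩
  set A₀ := |a m₀| with hA₀
  have hle : ∀ m, |a m| ≤ A₀ := fun m => hm₀ m (Finset.mem_univ m)
  have hn : (0 : ℝ) < n := by exact_mod_cast j.pos
  have hanorm : ‖a‖ ^ 2 ≤ n * A₀ ^ 2 := by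
    rw [EuclideanSpace.real_norm_sq_eq]
    calc _ ≤ ∑ _m : Fin n, A₀ ^ 2 := Finset.sum_le_sum fun m _ => by
          rw [← sq_abs]; exact pow_le_pow_left₀ (abs_nonneg _) (hle m) 2
      _ = _ := by simp
  have hA₀0 : 0 < A₀ := by
    rcases (abs_nonneg (a m₀)).eq_or_lt with h | h
    · exfalso
      apply ha
      rw [hA₀, ← h] at hanorm
      have : ‖a‖ ^ 2 ≤ 0 := by simpa using hanorm
      exact norm_le_zero_iff.1 (by nlinarith [norm_nonneg a])
    · exact h
  have hpow : ‖a‖ ^ (2 * l) ≤ (n : ℝ) ^ l * A₀ ^ (2 * l) := by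
    rw [pow_mul, pow_mul, ← mul_pow]
    exact pow_le_pow_left₀ (sq_nonneg _) hanorm l
  have hnl : (0 : ℝ) < (n : ℝ) ^ l := by positivity
  have hA₀a : A₀ ≤ ‖a‖ := by
    rw [hA₀, ← Real.norm_eq_abs]; exact PiLp.norm_apply_le a m₀
  obtain ⟨s, hs, h⟩ := exists_sign_abs_sub_le (L := 2 * l) (by simp) (by omega) (fun m => a m) hA₀0
    ⟨m₀, rfl⟩ hle (θ := θ) (by
      refine le_of_mul_le_mul_left ?_ hnl
      linarith) (fun m => H (diagIndex l m) (diagIndex l m))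
    (fun m => H (nearDiagIndex l m j) (diagIndex l j)) j (fun m => by
      have := hH (diagIndex l m) (diagIndex l m)
      simp only [diagIndex] at this ⊢
      rw [flatVec_tensorPow_const a m _ (finFunctionFinEquiv_const m)] at this
      rw [two_mul, pow_add]; exact this) hj (fun m => by
      have := hH (nearDiagIndex l m j) (diagIndex l j)
      simp only [diagIndex, nearDiagIndex] at this ⊢
      rw [flatVec_tensorPow_const a j _ (finFunctionFinEquiv_const j),
        flatVec_tensorPow_cons hl a m j _ (finFunctionFinEquiv_cons hl m j), mul_assoc, ← pow_add]
        at this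
      rw [show 2 * l - 1 = l - 1 + l by omega]; exact this)
  refine ⟨s, hs, ?_⟩
  set Δ := 24 * (θ / A₀ ^ (2 * l)) * A₀ with hΔ
  have hΔ0 : 0 ≤ Δ := by positivity
  have h1 : ‖a - s • readRow H j‖ ≤ n * Δ := by
    refine le_of_sq_le_sq ?_ (by positivity)
    rw [EuclideanSpace.real_norm_sq_eq]
    calc _ ≤ ∑ _m : Fin n, Δ ^ 2 := Finset.sum_le_sum fun m _ => by
          rw [← sq_abs]; exact pow_le_pow_left₀ (abs_nonneg _) (h m) 2
      _ = n * Δ ^ 2 := by simp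
      _ ≤ _ := by
          have : (1 : ℝ) ≤ n := by exact_mod_cast j.pos
          rw [mul_pow (n : ℝ) Δ]
          exact mul_le_mul_of_nonneg_right (le_self_pow₀ this two_ne_zero) (sq_nonneg _)
  refine h1.trans ?_
  have ha0 : 0 < ‖a‖ := norm_pos_iff.2 ha
  have h2 : θ / A₀ ^ (2 * l) ≤ (n : ℝ) ^ l * θ / ‖a‖ ^ (2 * l) := by
    rw [div_le_div_iff₀ (by positivity) (by positivity)]
    nlinarith
  exact mul_le_mul_of_nonneg_left (mul_le_mul (mul_le_mul_of_nonneg_left h2 (by norm_num)) hA₀a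
    hA₀0.le (by positivity)) hn.le

end Plan

/-! ### Correctness of the computed matrices -/

section PlanCorrect

variable {n l R : ℕ}

/-- The eigenbasis of the Gram matrix of the detector, indexed by pairs. -/
def gramBasis (w : Fin R → EuclideanSpace ℝ (Fin (n ^ l))) :
    OrthonormalBasis (Fin (R * R)) ℝ (EuclideanSpace ℝ (Fin R × Fin R)) :=
  (symBasis (detectorGram w)).map (LinearIsometryEquiv.piLpCongrLeft 2 ℝ ℝ finProdFinEquiv.symm)

theorem gramBasis_apply (w : Fin R → EuclideanSpace ℝ (Fin (n ^ l))) (t : Fin (R * R))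
    (p : Fin R × Fin R) :
    gramBasis w t p = symEigenvector (detectorGram w) t (finProdFinEquiv p) := by
  simp [gramBasis, LinearIsometryEquiv.piLpCongrLeft_apply, symBasis_apply,
    Equiv.piCongrLeft'_apply]

theorem kernelMat_eq (w : Fin R → EuclideanSpace ℝ (Fin (n ^ l))) (t : ℕ)
    (h : ∑ i ∈ Finset.range R, i + t < R * R) : kernelMat w t = unflatten (gramBasis w ⟨_, h⟩) := by
  ext a b
  simp [kernelMat, h, unflatten, gramBasis_apply]

theorem symPart_detectorGram (w : Fin R → EuclideanSpace ℝ (Fin (n ^ l))) :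
    symPart (detectorGram w) = detectorGram w := by
  ext p p'
  simp only [symPart, detectorGram, Matrix.smul_apply, Matrix.add_apply, Matrix.transpose_apply,
    Matrix.of_apply, smul_eq_mul]
  rw [real_inner_comm (detectorBilin l n (w (finProdFinEquiv.symm p').1) _)]
  ring

theorem norm_pairForm_sq (w : Fin R → EuclideanSpace ℝ (Fin (n ^ l)))
    (E : EuclideanSpace ℝ (Fin R × Fin R)) :
    ‖pairForm (detectorBilin l n) w E‖ ^ 2 =
      ∑ t, symEigenvalue (detectorGram w) t * inner ℝ (gramBasis w t) E ^ 2 := by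
  set e := LinearIsometryEquiv.piLpCongrLeft 2 ℝ ℝ (finProdFinEquiv (m := R) (n := R)).symm with he
  set x : EuclideanSpace ℝ (Fin (R * R)) := e.symm E with hx
  have h1 := (symPart_isSymmetric (detectorGram w)).inner_apply_self finrank_euclideanSpace_fin x
  have h2 : ∀ t, inner ℝ (gramBasis w t) E = inner ℝ (symBasis (detectorGram w) t) x := by
    intro t
    rw [gramBasis, OrthonormalBasis.map_apply, hx, ← e.inner_map_map, e.apply_symm_apply]
  simp only [h2]
  refine Eq.trans ?_ h1
  rw [symPart_detectorGram]
  have hxE : ∀ p, x p = E (finProdFinEquiv.symm p) := fun p => by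
    simp [hx, he, LinearIsometryEquiv.piLpCongrLeft_symm, LinearIsometryEquiv.piLpCongrLeft_apply,
      Equiv.piCongrLeft'_apply]
  rw [← real_inner_self_eq_norm_sq, pairForm]
  rw [← Equiv.sum_comp finProdFinEquiv.symm, sum_inner, PiLp.inner_apply]
  refine Finset.sum_congr rfl fun p _ => ?_
  rw [toEuclideanLin_coord, inner_sum, RCLike.inner_apply, conj_trivial, Finset.sum_mul]
  refine Finset.sum_congr rfl fun p' _ => ?_
  rw [inner_smul_left, inner_smul_right, conj_trivial, detectorGram, Matrix.of_apply, hxE, hxE]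
  ring

/-- The program stores the squared norm of the tensor, whose 4l-th root is the 2l-th root of the
norm. -/
theorem rpow_inv_pow_eq {τ : ℝ} (hτ : 0 ≤ τ) (hl : 1 ≤ l) :
    ((τ ^ 2) ^ (((4 * l : ℕ) : ℝ)⁻¹)) ^ (2 * l) = τ := by
  have h0 : 0 ≤ (τ ^ 2) ^ (((4 * l : ℕ) : ℝ)⁻¹) := by positivity
  refine (sq_eq_sq₀ (by positivity) hτ).1 ?_
  rw [← pow_mul, show 2 * l * 2 = 4 * l by ring]
  exact Real.rpow_inv_natCast_pow (sq_nonneg τ) (by omega)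

set_option maxHeartbeats 1000000 in
/-- The matrices computed by the algorithm are nearly jointly diagonal, and the components are
recovered from the rank-one projections. -/
theorem exists_nearlyJointlyDiagonal (hn : 2 ≤ n) (hl : 2 ≤ l) (hR : R ≠ 0)
    (A : Fin R → EuclideanSpace ℝ (Fin n)) (Err : Tensor (2 * l) n)
    (hU : condNumber (khatriRaoPow l A) ≠ ⊤) (hM : condNumber (detectorMatrix l A) ≠ ⊤)
    {ε : ℝ} (hε : 0 < ε) (hErr : frobNorm Err ≤ ε ^ (2 * l) /
      (n * (condNumber (khatriRaoPow l A)).toReal * (condNumber (detectorMatrix l A)).toReal) ^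
        lossExponent l)
    (hbig : ε ≤ 2 * R * (frobNorm (momentTensor (2 * l) A + Err) ^ 2) ^ (((4 * l : ℕ) : ℝ)⁻¹)) :
    ∃ (hRN : R ≤ n ^ l) (q : Fin R → EuclideanSpace ℝ (Fin R)) (δ : ℝ) (d : ℕ → Fin R → ℝ) (e : ℝ),
      NearlyJointlyDiagonal q δ (R * R - ∑ i ∈ Finset.range R, i)
        (kernelMat (scaledEigvec (flatMat (momentTensor (2 * l) A + Err)) hRN)) d e ∧
      ∀ i X, ActsAs q X {i} ((R : ℝ) ^ 3 * e) → NormLe X 1 → ∀ j,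
        (∀ m, conjEntry (scaledEigvec (flatMat (momentTensor (2 * l) A + Err)) hRN) X
          (diagIndex l m) (diagIndex l m) ≤
          conjEntry (scaledEigvec (flatMat (momentTensor (2 * l) A + Err)) hRN) X
          (diagIndex l j) (diagIndex l j)) →
        ∃ s : ℝ, (s = 1 ∨ s = -1) ∧ ‖A i - s • readRow
          (conjEntry (scaledEigvec (flatMat (momentTensor (2 * l) A + Err)) hRN) X) j‖ ≤ ε / R := by
  obtain ⟨σ, hσ, hlow, hup, hdet, hRN⟩ := exists_stretch_of_condNumber hl hR A hU hM
  have hκ := one_le_condNumber_toReal _ hU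
  have hκM := one_le_condNumber_toReal _ hM
  set κ := (condNumber (khatriRaoPow l A)).toReal
  set κM := (condNumber (detectorMatrix l A)).toReal
  set η := frobNorm Err with hη
  set T := momentTensor (2 * l) A + Err with hT
  set u := fun r => flatVec (tensorPow l (A r)) with hu
  have hη0 : 0 ≤ η := Real.sqrt_nonneg _
  have hR1 : (1 : ℝ) ≤ R := by exact_mod_cast Nat.pos_of_ne_zero hR
  have hR0 : (0 : ℝ) < R := by linarith
  have hl1 : (1 : ℝ) ≤ l := by exact_mod_cast (show 1 ≤ l by omega)
  have hun : ∀ i, ‖u i‖ ≤ κ * σ := by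
    intro i
    simpa [PiLp.single_apply, ite_smul] using hup (EuclideanSpace.single i 1)
  have hulow : ∀ i, σ ≤ ‖u i‖ := by
    intro i
    simpa [PiLp.single_apply, ite_smul] using hlow (EuclideanSpace.single i 1)
  have huA : ∀ i, ‖u i‖ = ‖A i‖ ^ l := fun i => norm_flatVec_tensorPow _
  have hτ : frobNorm T ≤ R * κ ^ 2 * σ ^ 2 + η := by
    refine (frobNorm_add_le _ _).trans (add_le_add_left ?_ _)
    refine (frobNorm_momentTensor_le A).trans ?_
    calc _ ≤ ∑ _r : Fin R, (κ * σ) ^ 2 := Finset.sum_le_sum fun r _ => by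
          rw [mul_comm 2 l, pow_mul, ← huA]; exact pow_le_pow_left₀ (norm_nonneg _) (hun r) 2
      _ = _ := by simp; ring
  have hετ : ε ^ (2 * l) ≤ (2 * R) ^ (2 * l) * frobNorm T := by
    rw [← rpow_inv_pow_eq (τ := frobNorm T) (l := l) (Real.sqrt_nonneg _) (by omega), ← mul_pow]
    exact pow_le_pow_left₀ hε.le hbig _
  set t := σ ^ ((l : ℝ)⁻¹) with ht
  have ht0 : 0 < t := by positivity
  have htσ : t ^ l = σ := Real.rpow_inv_natCast_pow hσ.le (by omega)
  obtain ⟨hZ1, hZ2⟩ := budget hn hl (Nat.pos_of_ne_zero hR) hRN hκ hκM hη0 hσ hε ht0 htσ hτ hετ hErr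
  -- The unit of all errors. The frame defect of q is of order ξ², but inner products of the q_i are
  -- controlled only to order ξ.
  set ξ := √η / σ with hξ
  have hξ0 : 0 ≤ ξ := by positivity
  have hηξ : η = ξ ^ 2 * σ ^ 2 := by
    rw [hξ, div_pow, Real.sq_sqrt hη0]; field_simp
  have hRNr : (R : ℝ) ≤ (n : ℝ) ^ l := by exact_mod_cast hRN
  have hnN : (n : ℝ) ≤ (n : ℝ) ^ l := le_self_pow₀ (by exact_mod_cast (show 1 ≤ n by omega)) (by omega)
  set N : ℝ := (n : ℝ) ^ l with hN
  have hN1 : 1 ≤ N := hR1.trans hRNr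
  -- Every later smallness condition is a monomial dominated by the first conclusion of `budget`,
  -- using R ≤ N.
  have hbd : ∀ (c : ℝ) (a b c' b' : ℕ), 0 ≤ c → c ≤ 50000 → a + c' ≤ 11 → b ≤ 6 → b' ≤ 1 →
      c * (R : ℝ) ^ a * N ^ c' * l * κ ^ b * κM ^ b' * ξ ≤ 1 := by
    intro c a b c' b' hc0 hc ha hb hb'
    refine le_trans ?_ hZ1
    have h1 : (R : ℝ) ^ a * N ^ c' ≤ N ^ 11 := by
      calc _ ≤ N ^ a * N ^ c' := by gcongr
        _ = N ^ (a + c') := by rw [pow_add]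
        _ ≤ _ := pow_le_pow_right₀ hN1 ha
    have h2 : κ ^ b ≤ κ ^ 6 := pow_le_pow_right₀ hκ hb
    have h3 : κM ^ b' ≤ κM := by
      calc _ ≤ κM ^ 1 := pow_le_pow_right₀ hκM hb'
        _ = _ := pow_one _
    calc c * (R : ℝ) ^ a * N ^ c' * l * κ ^ b * κM ^ b' * ξ
        = c * ((R : ℝ) ^ a * N ^ c') * l * κ ^ b * κM ^ b' * ξ := by ring
      _ ≤ _ := by gcongr
  have hξsmall : ξ ≤ 1 / 50000 := by
    have := hbd 50000 0 0 0 0 (by norm_num) le_rfl (by norm_num) (by norm_num) (by norm_num)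
    simp only [pow_zero, mul_one] at this
    rw [le_div_iff₀ (by norm_num)]
    nlinarith
  have hξξ : ξ ^ 2 ≤ ξ := by nlinarith
  set M := flatMat T with hMdef
  obtain ⟨q, hq1, hq2, hq3, hq4⟩ := exists_nearly_orthogonal_coordinates hRN (symBasis M)
    (symEigenvalue_antitone M) (symPart M).toEuclideanLin (symPart_apply_symBasis M) u hσ hκ hη0
    (by rw [hηξ]; nlinarith [sq_nonneg σ]) hlow hup (norm_symPart_flatMat_sub_le A Err)
  set w := scaledEigvec M hRN with hw
  have hβ : 2 * η / σ ^ 2 = 2 * ξ ^ 2 := by rw [hηξ]; field_simp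
  have hα : 2 * η / σ = 2 * ξ ^ 2 * σ := by rw [hηξ]; field_simp
  rw [hβ] at hq1
  rw [hα] at hq2
  -- With β = 2ξ² the required inequality 4Rβ ≤ δ² reads 8Rξ² ≤ 9R²ξ².
  set δ := 3 * R * ξ with hδ
  have hδ0 : 0 ≤ δ := by positivity
  have hδ8 : δ ≤ 1 / 8 := by
    have := hbd 24 1 0 0 0 (by norm_num) (by norm_num) (by norm_num) (by norm_num) (by norm_num)
    simp only [pow_zero, pow_one, mul_one] at this
    have h2 : 24 * R * ξ ≤ 24 * R * l * ξ := by
      have : 24 * R * ξ * 1 ≤ 24 * R * ξ * l := by gcongr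
      linarith
    rw [hδ]; linarith
  have hframe : ∀ z, |∑ i, inner ℝ (q i) z ^ 2 - ‖z‖ ^ 2| ≤ δ * ‖z‖ ^ 2 := by
    intro z
    refine (hq1 z).trans ?_
    gcongr
    rw [hδ]; nlinarith
  have horth := abs_inner_sub_ite_le_of_frame q (β := 2 * ξ ^ 2) (δ := δ) (by positivity) (by
    rw [hδ]; nlinarith [sq_nonneg ξ, mul_nonneg hR0.le (sq_nonneg ξ)]) hδ0 (by linarith) hq1
  set σM := 2 * σ ^ 2 / (l * κ ^ 2 * κM) with hσM
  have hσM0 : 0 < σM := by positivity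
  have hαω : 2 * ξ ^ 2 * σ ≤ 2 * κ * σ := by
    have : ξ ^ 2 ≤ κ := by linarith
    gcongr
  have hsmall : 3 * (12 * R * (2 * ξ ^ 2 * σ) * (2 * κ * σ)) + 16 * R ^ 2 * δ * (κ * σ) ^ 2 ≤
      σM / 6 := by
    have h1 := hbd 1000 3 4 0 1 (by norm_num) (by norm_num) (by norm_num) (by norm_num) (by norm_num)
    simp only [pow_zero, pow_one, mul_one] at h1
    rw [hσM, div_div, le_div_iff₀ (by positivity), hδ]
    have h2 : ξ ^ 2 * R * κ ≤ R ^ 3 * κ ^ 2 * ξ := by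
      calc ξ ^ 2 * R * κ ≤ ξ * (R ^ 3) * κ ^ 2 := by
            gcongr
            · exact le_self_pow₀ hR1 (by norm_num)
            · exact le_self_pow₀ hκ (by norm_num)
        _ = _ := by ring
    calc _ = (144 * (ξ ^ 2 * R * κ) + 48 * (R ^ 3 * κ ^ 2 * ξ)) * (6 * l * κ ^ 2 * κM) * σ ^ 2 := by
          ring
      _ ≤ (144 * (R ^ 3 * κ ^ 2 * ξ) + 48 * (R ^ 3 * κ ^ 2 * ξ)) * (6 * l * κ ^ 2 * κM) * σ ^ 2 := by
          gcongr
      _ = 1152 * (R ^ 3 * l * κ ^ 4 * κM * ξ) * σ ^ 2 := by ring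
      _ ≤ 2 * σ ^ 2 := by
          gcongr
          linarith
  obtain ⟨hres, hsep⟩ := exists_separating_near_diagonal (detectorBilin l n) norm_detectorBilin_le
    detectorBilin_comm u w (fun i => detectorBilin_tensorPow_self (A i)) q hσM0 hdet hαω
    (by positivity) hq3 hq2 hun hδ0 hδ8 hframe horth hsmall (sum_range_eq_card_pairs R)
    (two_mul_sum_range_add R) (gramBasis w) (symEigenvalue_antitone (detectorGram w))
    (norm_pairForm_sq w)
  set K := ∑ i ∈ Finset.range R, i with hK
  have hKR : K ≤ R * R := by have := two_mul_sum_range_add R; omega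
  -- Chosen so that e/(2R²) has the coefficient 102 = 6 + 96, from 2δ = 6Rξ and from the detector
  -- error.
  set e : ℝ := 204 * R ^ 4 * l * κ ^ 3 * κM * ξ with he
  have he0 : 0 ≤ e := by positivity
  have heR : 2 * δ + 4 * R * (12 * R * (2 * ξ ^ 2 * σ) * (2 * κ * σ)) / σM ≤ e / (2 * R ^ 2) := by
    have h1 : 4 * R * (12 * R * (2 * ξ ^ 2 * σ) * (2 * κ * σ)) / σM =
        96 * R ^ 2 * l * κ ^ 3 * κM * ξ ^ 2 := by
      rw [hσM]; field_simp; ring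
    have h2 : e / (2 * R ^ 2) = 102 * R ^ 2 * l * κ ^ 3 * κM * ξ := by
      rw [he]; field_simp; ring
    rw [h1, h2, hδ]
    have h3 : R * ξ ≤ R ^ 2 * l * κ ^ 3 * κM * ξ := by
      calc R * ξ = R * 1 * 1 * 1 * ξ := by ring
        _ ≤ R ^ 2 * l * κ ^ 3 * κM * ξ := by
            gcongr
            · exact le_self_pow₀ hR1 (by norm_num)
            · exact one_le_pow₀ hκ
    have h4 : R ^ 2 * l * κ ^ 3 * κM * ξ ^ 2 ≤ R ^ 2 * l * κ ^ 3 * κM * ξ := by gcongr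
    linarith
  refine ⟨hRN, q, δ, fun t j => inner ℝ (q j) ((symPart (kernelMat w t)).toEuclideanLin (q j)), e,
    ⟨hδ0, hδ8, hframe, horth, ?_, ?_, Nat.sub_le _ _, he0, ?_⟩, ?_⟩
  · intro t ht j
    rw [kernelMat_eq w t (by omega)]
    exact (hres ⟨K + t, by omega⟩ (Nat.le_add_right _ _) j).trans heR
  · intro i j hij
    obtain ⟨t, ht, h⟩ := hsep i j hij
    have hlt := t.2
    refine ⟨t.val - K, by omega, ?_⟩
    -- Eigenvalues decrease, so the numerical kernel starts at index K, and kernel matrices are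
    -- numbered from there.
    have ht' : (⟨K + (t.val - K), by omega⟩ : Fin (R * R)) = t := Fin.ext (by simp; omega)
    rw [kernelMat_eq w (t.val - K) (by omega)]
    simp only [← hK, ht']
    exact h
  · have h1 := hbd 20400 9 3 0 1 (by norm_num) (by norm_num) (by norm_num) (by norm_num)
      (by norm_num)
    simp only [pow_zero, pow_one, mul_one] at h1
    calc 100 * (R : ℝ) ^ 5 * e = 20400 * R ^ 9 * l * κ ^ 3 * κM * ξ := by rw [he]; ring
      _ ≤ 1 := h1
  intro i X hX hXn j hj
  have hrank := norm_apply_sub_rankOne_le hδ0 hδ8 hframe horth hX hXn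
  -- The constant covers 12 + 1632 for the rank-one error and 63 for the error of p.
  set θ : ℝ := 2000 * R ^ 8 * l * κ ^ 5 * κM * ξ * σ ^ 2 with hθ
  have hH : ∀ x y, |conjEntry w X x y - u i x * u i y| ≤ θ := by
    intro x y
    have h1 := abs_entry_sub_le u w q (α := 2 * ξ ^ 2 * σ) (ω₀ := 2 * κ * σ) (δ := δ) (U := κ * σ)
      (by positivity) (by positivity) hδ0 hδ8 hq2 hq4 hun horth hrank x y
    refine h1.trans ?_
    have hν : 2 * R * (2 * ξ ^ 2 * σ) + δ * R * (κ * σ) ≤ 7 * R ^ 2 * κ * ξ * σ := by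
      have h2 : R * ξ ^ 2 * σ ≤ R ^ 2 * κ * ξ * σ := by
        calc R * ξ ^ 2 * σ = R * 1 * ξ ^ 2 * σ := by ring
          _ ≤ _ := by
            gcongr
            exact le_self_pow₀ hR1 (by norm_num)
      rw [hδ]; linarith
    have hν2 : 7 * R ^ 2 * κ * ξ * σ ≤ 7 * R ^ 2 * κ * σ := by
      have : 7 * R ^ 2 * κ * ξ * σ ≤ 7 * R ^ 2 * κ * 1 * σ := by gcongr; linarith
      linarith
    have hν0 : 0 ≤ 2 * R * (2 * ξ ^ 2 * σ) + δ * R * (κ * σ) := by positivity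
    have hκ2 : κ * σ ≤ R ^ 2 * κ * σ := by
      have : 1 * κ * σ ≤ R ^ 2 * κ * σ := by gcongr; exact one_le_pow₀ hR1
      linarith
    have hpos : 0 ≤ R ^ 2 * κ * σ := by positivity
    have hP1 : R * κ ^ 2 * ξ * σ ^ 2 ≤ R ^ 8 * l * κ ^ 5 * κM * ξ * σ ^ 2 := by
      calc R * κ ^ 2 * ξ * σ ^ 2 = R * 1 * κ ^ 2 * 1 * ξ * σ ^ 2 := by ring
        _ ≤ _ := by
          gcongr
          · exact le_self_pow₀ hR1 (by norm_num)
          · norm_num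
    have hP2 : R ^ 4 * κ ^ 2 * ξ * σ ^ 2 ≤ R ^ 8 * l * κ ^ 5 * κM * ξ * σ ^ 2 := by
      calc R ^ 4 * κ ^ 2 * ξ * σ ^ 2 = R ^ 4 * 1 * κ ^ 2 * 1 * ξ * σ ^ 2 := by ring
        _ ≤ _ := by
          gcongr
          · norm_num
          · norm_num
    have hζ : (δ + 2 * R * (R ^ 3 * e)) * (2 * κ * σ) ^ 2 ≤
        12 * (R * κ ^ 2 * ξ * σ ^ 2) + 1632 * (R ^ 8 * l * κ ^ 5 * κM * ξ * σ ^ 2) := by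
      rw [hδ, he]; exact le_of_eq (by ring)
    calc _ ≤ 12 * (R * κ ^ 2 * ξ * σ ^ 2) + 1632 * (R ^ 8 * l * κ ^ 5 * κM * ξ * σ ^ 2) +
          (7 * R ^ 2 * κ * ξ * σ) * (2 * (R ^ 2 * κ * σ) + 7 * R ^ 2 * κ * σ) := by
          refine add_le_add hζ (mul_le_mul hν ?_ (by positivity) (by positivity))
          linarith
      _ = 12 * (R * κ ^ 2 * ξ * σ ^ 2) + 1632 * (R ^ 8 * l * κ ^ 5 * κM * ξ * σ ^ 2) +
          63 * (R ^ 4 * κ ^ 2 * ξ * σ ^ 2) := by ring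
      _ ≤ θ := by
          have h0 : 0 ≤ R ^ 8 * l * κ ^ 5 * κM * ξ * σ ^ 2 := by positivity
          rw [hθ]; linarith
  have hA2 : σ ^ 2 ≤ ‖A i‖ ^ (2 * l) := by
    rw [mul_comm 2 l, pow_mul, ← huA]
    exact pow_le_pow_left₀ hσ.le (hulow i) 2
  have hAi : A i ≠ 0 := by
    intro h0
    rw [h0, norm_zero, zero_pow (by omega)] at hA2
    have : 0 < σ ^ 2 := by positivity
    linarith
  have hAκ : ‖A i‖ ≤ κ * t := by
    refine le_of_pow_le_pow_left₀ (n := l) (by omega) (by positivity) ?_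
    rw [← huA, mul_pow, htσ]
    refine (hun i).trans ?_
    gcongr
    exact le_self_pow₀ hκ (by omega)
  have hθ0 : 0 ≤ θ := by positivity
  obtain ⟨s, hs, hfin⟩ := exists_norm_sub_readRow_le (by omega) (A i) hAi (θ := θ) (by
    refine le_trans ?_ hA2
    have h1 := hbd 32000 8 5 1 1 (by norm_num) (by norm_num) (by norm_num) (by norm_num)
      (by norm_num)
    simp only [pow_one] at h1
    calc 16 * (N * θ) = (32000 * R ^ 8 * N * l * κ ^ 5 * κM * ξ) * σ ^ 2 := by rw [hθ]; ring
      _ ≤ 1 * σ ^ 2 := by gcongr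
      _ = _ := one_mul _) (conjEntry w X) hH j hj
  refine ⟨s, hs, hfin.trans ?_⟩
  rw [le_div_iff₀ hR0]
  calc n * (24 * (N * θ / ‖A i‖ ^ (2 * l)) * ‖A i‖) * R
      ≤ N * (24 * (N * θ / σ ^ 2) * (κ * t)) * N := by gcongr
    _ = 48000 * N ^ 3 * R ^ 8 * l * κ ^ 6 * κM * ξ * t := by rw [hθ]; field_simp; ring
    _ ≤ 50000 * N ^ 3 * N ^ 8 * l * κ ^ 6 * κM * ξ * t := by gcongr; norm_num
    _ = 50000 * N ^ 11 * l * κ ^ 6 * κM * ξ * t := by ring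
    _ ≤ ε := hZ2

/-- If the tensor is small, then so are the components. -/
theorem sum_norm_le_of_small (hn : 2 ≤ n) (hl : 2 ≤ l) (hR : R ≠ 0) (hRN : R ≤ n ^ l)
    (A : Fin R → EuclideanSpace ℝ (Fin n)) (Err : Tensor (2 * l) n) {κ κM : ℝ} (hκ : 1 ≤ κ)
    (hκM : 1 ≤ κM) {ε : ℝ} (hε : 0 < ε)
    (hErr : frobNorm Err ≤ ε ^ (2 * l) / (n * κ * κM) ^ lossExponent l)
    (hsmall : 2 * R * (frobNorm (momentTensor (2 * l) A + Err) ^ 2) ^ (((4 * l : ℕ) : ℝ)⁻¹) ≤ ε) :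
    ∑ i, ‖A i‖ ≤ ε := by
  set T := momentTensor (2 * l) A + Err with hT
  have hR1 : (1 : ℝ) ≤ R := by exact_mod_cast Nat.pos_of_ne_zero hR
  have hR0 : (0 : ℝ) < R := by linarith
  have hn' : (2 : ℝ) ≤ n := by exact_mod_cast hn
  have hτ : (2 * R) ^ (2 * l) * frobNorm T ≤ ε ^ (2 * l) := by
    rw [← rpow_inv_pow_eq (τ := frobNorm T) (l := l) (Real.sqrt_nonneg _) (by omega), ← mul_pow]
    exact pow_le_pow_left₀ (by positivity) hsmall _
  have hmom : frobNorm (momentTensor (2 * l) A) ≤ frobNorm T + frobNorm Err := by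
    have : momentTensor (2 * l) A = T + -Err := by rw [hT]; abel
    rw [this, ← frobNorm_neg Err]
    exact frobNorm_add_le _ _
  set B := n * κ * κM with hB
  have hnB : (n : ℝ) ≤ B := by
    have h1 : (n : ℝ) ≤ n * κ := le_mul_of_one_le_right (by linarith) hκ
    exact h1.trans (le_mul_of_one_le_right (by positivity) hκM)
  have hRB : (R : ℝ) ≤ B ^ l := by
    calc (R : ℝ) ≤ (n : ℝ) ^ l := by exact_mod_cast hRN
      _ ≤ _ := by gcongr
  have h2 := two_mul_pow_le (R := R) (l := l) (hn'.trans hnB) hRB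
  have hB0 : 0 < B := by linarith
  have hη0 : 0 ≤ frobNorm Err := Real.sqrt_nonneg _
  have hη : (2 * R) ^ (2 * l) * frobNorm Err ≤ ε ^ (2 * l) := by
    have h3 := (le_div_iff₀ (by positivity)).1 hErr
    calc _ ≤ B ^ lossExponent l * frobNorm Err := by
          gcongr
          have : 0 ≤ (2 * (R : ℝ)) ^ (2 * l) := by positivity
          linarith
      _ ≤ _ := by linarith
  have hi : ∀ i, ‖A i‖ ≤ ε / R := by
    intro i
    refine le_of_pow_le_pow_left₀ (n := 2 * l) (by omega) (by positivity) ?_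
    rw [div_pow, le_div_iff₀ (by positivity)]
    have h4 := (norm_pow_le_frobNorm A i).trans hmom
    -- The small tensor and the error contribute one ε^{2l} each; the factor 2 is absorbed by
    -- 2^{2l}.
    have h5 : (2 * (R : ℝ)) ^ (2 * l) * ‖A i‖ ^ (2 * l) ≤ 2 * ε ^ (2 * l) := by
      calc _ ≤ (2 * (R : ℝ)) ^ (2 * l) * (frobNorm T + frobNorm Err) := by gcongr
        _ ≤ _ := by linarith
    rw [mul_pow] at h5
    have h6 : (2 : ℝ) ≤ 2 ^ (2 * l) := le_self_pow₀ (by norm_num) (by omega)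
    have h7 : 0 ≤ (R : ℝ) ^ (2 * l) * ‖A i‖ ^ (2 * l) := by positivity
    nlinarith
  calc ∑ i, ‖A i‖ ≤ ∑ _i : Fin R, ε / R := Finset.sum_le_sum fun i _ => hi i
    _ = ε := by simp; field_simp

end PlanCorrect

/-! ### Matrix subprograms -/

namespace RealRAM

/-- Array `a` of the memory holds the matrix `M`, row by row. -/
def IsMat (r : ℕ → ℕ → ℝ) (a : ℕ) {p q : ℕ} (M : Matrix (Fin p) (Fin q) ℝ) : Prop :=
  ∀ i j, r a (i.val * q + j.val) = M i j

theorem IsMat.congr {r r' : ℕ → ℕ → ℝ} {a p q : ℕ} {M : Matrix (Fin p) (Fin q) ℝ}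
    (h : IsMat r a M) (h' : r' a = r a) : IsMat r' a M := fun i j => by rw [h', h]

theorem IsMat.frame {s s' : State} {a p q d : ℕ} {A : Set ℕ} {M : Matrix (Fin p) (Fin q) ℝ}
    (h : IsMat s.real a M) (hF : Frame d A s s') (ha : a ∉ A) : IsMat s'.real a M :=
  h.congr (hF.2 a ha)

theorem IsMat.readMatrix {s : State} {a d : ℕ} {M : Matrix (Fin d) (Fin d) ℝ}
    (h : IsMat s.real a M) : s.readMatrix d a = M := by
  ext i j; exact h i j

theorem Runs.fillEntries {x a : ℕ} {r d m : NExp} {e : RExp} {s : State} {S p q : ℕ}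
    (M : Matrix (Fin p) (Fin q) ℝ) (cnt : Fin p → Fin q → ℕ) (g : Fin p → Fin q → ℕ → ℝ)
    (hS : 1 ≤ S) (hpS : p ≤ S) (hqS : q ≤ S) (hcS : ∀ i j, cnt i j ≤ S)
    (hcost : r.cost ≤ 38 ∧ d.cost ≤ 38 ∧ m.cost ≤ 38 ∧ e.cost ≤ 60 ∧ a ≠ 20)
    (hr : ∀ s', Frame x {20, a} s s' → r.eval s' = p)
    (hd : ∀ s', Frame x {20, a} s s' → d.eval s' = q)
    (hm : ∀ i j s', Frame x {20, a} s s' → s'.nat x = i.val → s'.nat (x + 1) = j.val →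
      m.eval s' = cnt i j)
    (he : ∀ i j k s', k < cnt i j → Frame x {20, a} s s' → s'.nat x = i.val →
      s'.nat (x + 1) = j.val → s'.nat (x + 2) = k → e.eval s' = g i j k)
    (hM : ∀ i j, M i j = ∑ k ∈ Finset.range (cnt i j), g i j k) :
    Runs (RealRAM.fillMat x a r d m e) s (timeBound S 600) fun s' =>
      Frame x {20, a} s s' ∧ IsMat s'.real a M := by
  obtain ⟨h1, h2, h3, h4, h5⟩ := hcost
  refine (Runs.fillMat (r₀ := p) (d₀ := q)
    (fun i j => if h : i < p ∧ j < q then cnt ⟨i, h.1⟩ ⟨j, h.2⟩ else 0)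
    (fun i j k => if h : i < p ∧ j < q then g ⟨i, h.1⟩ ⟨j, h.2⟩ k else 0) hS hpS hqS ?_ h1 h2 h3 h4
    h5 hr hd ?_ ?_).imp ?_
  · intro i hi j hj
    simp only [hi, hj, and_self, dif_pos]; exact hcS _ _
  · intro i j s' hi hj hF hx hy
    simp only [hi, hj, and_self, dif_pos]
    exact hm ⟨i, hi⟩ ⟨j, hj⟩ s' hF hx hy
  · intro i j k s' hi hj hk hF hx hy hz
    simp only [hi, hj, and_self, dif_pos] at hk ⊢
    exact he ⟨i, hi⟩ ⟨j, hj⟩ k s' hk hF hx hy hz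
  · rintro s' ⟨hF, h⟩
    refine ⟨hF, fun i j => ?_⟩
    rw [h i i.2 j j.2, hM]
    simp only [i.2, j.2, and_self, dif_pos]

/-- Entries without summation. -/
theorem Runs.fillPointwise {x a : ℕ} {r d : NExp} {e : RExp} {s : State} {S p q : ℕ}
    (M : Matrix (Fin p) (Fin q) ℝ) (hS : 1 ≤ S) (hpS : p ≤ S) (hqS : q ≤ S)
    (hcost : r.cost ≤ 38 ∧ d.cost ≤ 38 ∧ e.cost ≤ 60 ∧ a ≠ 20)
    (hr : ∀ s', Frame x {20, a} s s' → r.eval s' = p)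
    (hd : ∀ s', Frame x {20, a} s s' → d.eval s' = q)
    (he : ∀ i j s', Frame x {20, a} s s' → s'.nat x = i.val →
      s'.nat (x + 1) = j.val → e.eval s' = M i j) :
    Runs (RealRAM.fillMat x a r d (.const 1) e) s (timeBound S 600) fun s' =>
      Frame x {20, a} s s' ∧ IsMat s'.real a M := by
  refine Runs.fillEntries M (fun _ _ => 1) (fun i j _ => M i j) hS hpS hqS (fun _ _ => hS)
    ⟨hcost.1, hcost.2.1, by simp [NExp.cost], hcost.2.2⟩ hr hd (fun _ _ _ _ _ _ => rfl)
    (fun i j k s' _ hF h1 h2 _ => he i j s' hF h1 h2) (by simp)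

/-- `a := 1`, the identity matrix of size `R`; register `2` holds `R`. -/
def identMat (a : ℕ) : Prog :=
  fillMat 13 a (.var 2) (.var 2)
    (.sub (.const 1) (.add (.sub (.var 13) (.var 14)) (.sub (.var 14) (.var 13)))) (.const 1)

theorem Runs.identMat {a S R : ℕ} {s : State} (hS : 1 ≤ S) (hRS : R ≤ S) (ha : a ≠ 20)
    (hR : s.nat 2 = R) : Runs (RealRAM.identMat a) s (timeBound S 600) fun s' =>
      Frame 13 {20, a} s s' ∧ IsMat s'.real a (1 : Matrix (Fin R) (Fin R) ℝ) := by
  have hR' : ∀ s', Frame 13 {20, a} s s' → s'.nat 2 = R := fun s' h => (h.1 2 (by norm_num)).trans hR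
  -- With truncated subtraction, 1 - ((i - j) + (j - i)) is 1 on the diagonal and 0 elsewhere. It
  -- serves as the number of summands, all equal to 1.
  refine Runs.fillEntries _ (fun i j => if i = j then 1 else 0) (fun _ _ _ => 1) hS hRS hRS ?_
    ⟨by simp [NExp.cost], by simp [NExp.cost], by simp [NExp.cost], by simp [RExp.cost], ha⟩
    hR' hR' ?_ ?_ ?_
  · intro i j; split_ifs <;> omega
  · intro i j s' _ h1 h2
    simp only [NExp.eval, h1, h2]
    split_ifs with h
    · subst h; simp
    · have : i.val ≠ j.val := fun h' => h (Fin.ext h')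
      omega
  · intros; simp [RExp.eval]
  · intro i j
    rw [Matrix.one_apply]; split_ifs <;> simp

/-- `a := b * c` for square matrices of size `R`. -/
def mulMat (a b c : ℕ) : Prog :=
  fillMat 13 a (.var 2) (.var 2) (.var 2)
    (.mul (.get b (.idx (.var 13) (.var 2) (.var 15))) (.get c (.idx (.var 15) (.var 2) (.var 14))))

theorem Runs.mulMat {a b c S R : ℕ} {s : State} {B C : Matrix (Fin R) (Fin R) ℝ} (hS : 1 ≤ S)
    (hRS : R ≤ S) (ha : a ≠ 20) (hR : s.nat 2 = R) (hb : b ≠ 20 ∧ b ≠ a) (hc : c ≠ 20 ∧ c ≠ a)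
    (hB : IsMat s.real b B) (hC : IsMat s.real c C) :
    Runs (RealRAM.mulMat a b c) s (timeBound S 600) fun s' =>
      Frame 13 {20, a} s s' ∧ IsMat s'.real a (B * C) := by
  have hR' : ∀ s', Frame 13 {20, a} s s' → s'.nat 2 = R := fun s' h => (h.1 2 (by norm_num)).trans hR
  refine Runs.fillEntries _ (fun _ _ => R)
    (fun i j k => if h : k < R then B i ⟨k, h⟩ * C ⟨k, h⟩ j else 0) hS hRS hRS (fun _ _ => hRS)
    ⟨by simp [NExp.cost], by simp [NExp.cost], by simp [NExp.cost], by simp [RExp.cost, NExp.cost], ha⟩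
    hR' hR' (fun _ _ s' h _ _ => hR' s' h) ?_ ?_
  · intro i j k s' hk hF h1 h2 h3
    have e1 := (hB.frame hF (by simpa using hb)) i ⟨k, hk⟩
    have e2 := (hC.frame hF (by simpa using hc)) ⟨k, hk⟩ j
    simp only [RExp.eval, NExp.eval, h1, h2, h3, hR' s' hF, dif_pos hk]
    rw [e1, e2]
  · intro i j
    rw [Matrix.mul_apply, Finset.sum_range]
    exact Finset.sum_congr rfl fun k _ => by simp

/-- `a := b` for square matrices of size `R`. -/
def copyMat (a b : ℕ) : Prog :=
  fillMat 13 a (.var 2) (.var 2) (.const 1) (.get b (.idx (.var 13) (.var 2) (.var 14)))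

theorem Runs.copyMat {a b S R : ℕ} {s : State} {B : Matrix (Fin R) (Fin R) ℝ} (hS : 1 ≤ S)
    (hRS : R ≤ S) (ha : a ≠ 20) (hR : s.nat 2 = R) (hb : b ≠ 20 ∧ b ≠ a)
    (hB : IsMat s.real b B) :
    Runs (RealRAM.copyMat a b) s (timeBound S 600) fun s' =>
      Frame 13 {20, a} s s' ∧ IsMat s'.real a B := by
  have hR' : ∀ s', Frame 13 {20, a} s s' → s'.nat 2 = R := fun s' h => (h.1 2 (by norm_num)).trans hR
  refine Runs.fillPointwise _ hS hRS hRS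
    ⟨by simp [NExp.cost], by simp [NExp.cost], by simp [RExp.cost, NExp.cost], ha⟩ hR' hR' ?_
  intro i j s' hF h1 h2
  simp only [RExp.eval, NExp.eval, h1, h2, hR' s' hF]
  exact (hB.frame hF (by simpa using hb)) i j

/-- `b := b - c` for square matrices of size `R`, with array `a` for intermediate storage. -/
def subMat (a b c : ℕ) : Prog :=
  .seq (fillMat 13 a (.var 2) (.var 2) (.const 1)
    (.sub (.get b (.idx (.var 13) (.var 2) (.var 14))) (.get c (.idx (.var 13) (.var 2) (.var 14)))))
    (copyMat b a)

theorem Runs.subMat {a b c S R : ℕ} {s : State} {B C : Matrix (Fin R) (Fin R) ℝ} (hS : 1 ≤ S)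
    (hRS : R ≤ S) (ha : a ≠ 20) (hR : s.nat 2 = R) (hb : b ≠ 20 ∧ b ≠ a) (hc : c ≠ 20 ∧ c ≠ a)
    (hB : IsMat s.real b B) (hC : IsMat s.real c C) :
    Runs (RealRAM.subMat a b c) s (timeBound S 1201) fun s' =>
      Frame 13 {20, a, b} s s' ∧ IsMat s'.real b (B - C) := by
  have hR' : ∀ s', Frame 13 {20, a} s s' → s'.nat 2 = R := fun s' h => (h.1 2 (by norm_num)).trans hR
  refine Runs.seq (b := 600) hS (Runs.fillPointwise (B - C) hS hRS hRS
    ⟨by simp [NExp.cost], by simp [NExp.cost], by simp [RExp.cost, NExp.cost], ha⟩ hR' hR' ?_)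
    ?_ le_rfl
  · intro i j s' hF h1 h2
    simp only [RExp.eval, NExp.eval, h1, h2, hR' s' hF, Matrix.sub_apply]
    rw [(hB.frame hF (by simpa using hb)) i j, (hC.frame hF (by simpa using hc)) i j]
  · rintro s1 ⟨hF1, h1⟩
    refine (Runs.copyMat hS hRS hb.1 (hR' s1 hF1) ⟨ha, Ne.symm hb.2⟩ h1).imp ?_
    rintro s2 ⟨hF2, h2⟩
    refine ⟨(hF1.weaken le_rfl ?_).trans (hF2.weaken le_rfl ?_), h2⟩
    · intro y; simp; tauto
    · intro y; simp; tauto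

/-- Spectral decomposition of the square matrix in array `a`. -/
theorem Runs.eigMat {a w v S d x : ℕ} {e : NExp} {s : State} {M : Matrix (Fin d) (Fin d) ℝ}
    (hS : 1 ≤ S) (hdS : d ≤ S) (hcost : e.cost ≤ 40) (hwv : w ≠ v) (he : e.eval s = d)
    (hM : IsMat s.real a M) :
    Runs (.eig e a w v) s (timeBound S 50) fun s' => Frame x {w, v} s s' ∧
      (∀ j : Fin d, s'.real w j = symEigenvalue M j) ∧
      IsMat s'.real v (Matrix.of fun i j => symEigenvector M j i) := by
  refine Runs.eig hS (he ▸ hdS) hcost ?_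
  rw [he]
  refine ⟨State.eig_frame s x d a w v, fun j => ?_, fun i j => ?_⟩
  · rw [State.eig_real_fst s hwv, hM.readMatrix]
  · rw [State.eig_real_snd s, hM.readMatrix]; rfl

/-! ### One splitting step -/

/-- Array `16` becomes the projection to the eigenvectors `0, …, m` stored in array `15`, where `m`
is in register `12`. -/
def projMat : Prog :=
  fillMat 13 16 (.var 2) (.var 2) (.add (.var 12) (.const 1))
    (.mul (.get 15 (.idx (.var 13) (.var 2) (.var 15))) (.get 15 (.idx (.var 14) (.var 2) (.var 15))))

theorem Runs.projMat {S R m : ℕ} {s : State} {M : Matrix (Fin R) (Fin R) ℝ} (hS : 1 ≤ S)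
    (hRS : R ≤ S) (hR : s.nat 2 = R) (hm : s.nat 12 = m) (hmR : m < R)
    (hv : IsMat s.real 15 (Matrix.of fun i j => symEigenvector M j i)) :
    Runs RealRAM.projMat s (timeBound S 600) fun s' =>
      Frame 13 {20, 16} s s' ∧ IsMat s'.real 16 (eigenProj M m) := by
  have hR' : ∀ s', Frame 13 {20, 16} s s' → s'.nat 2 = R := fun s' h => (h.1 2 (by norm_num)).trans hR
  have hm' : ∀ s', Frame 13 {20, 16} s s' → s'.nat 12 = m :=
    fun s' h => (h.1 12 (by norm_num)).trans hm
  refine Runs.fillEntries _ (fun _ _ => m + 1)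
    (fun i j k => if h : k < R then symEigenvector M ⟨k, h⟩ i * symEigenvector M ⟨k, h⟩ j else 0)
    hS hRS hRS (fun _ _ => by omega)
    ⟨by simp [NExp.cost], by simp [NExp.cost], by simp [NExp.cost], by simp [RExp.cost, NExp.cost],
      by norm_num⟩
    hR' hR' (fun _ _ s' h _ _ => by simp [NExp.eval, hm' s' h]) ?_ ?_
  · intro i j k s' hk hF h1 h2 h3
    have hk' : k < R := by omega
    have e1 := (hv.frame hF (by simp)) i ⟨k, hk'⟩
    have e2 := (hv.frame hF (by simp)) j ⟨k, hk'⟩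
    simp only [RExp.eval, NExp.eval, h1, h2, h3, hR' s' hF, dif_pos hk']
    rw [e1, e2]; rfl
  · intro i j
    rw [eigenProj, Matrix.of_apply]
    obtain ⟨F, hF⟩ : ∃ F : ℕ → ℝ, F = fun k : ℕ => if k < m + 1 then (if h : k < R then
        symEigenvector M ⟨k, h⟩ i * symEigenvector M ⟨k, h⟩ j else 0) else 0 := ⟨_, rfl⟩
    have h1 : ∀ k : Fin R, (if k.val ≤ m then symEigenvector M k i * symEigenvector M k j else 0) =
        F k := by
      intro k; simp [hF]
    rw [Finset.sum_congr rfl fun k _ => h1 k, ← Finset.sum_range F, hF]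
    rw [← Finset.sum_filter]
    refine Finset.sum_congr ?_ fun _ _ => rfl
    ext k; simp; omega

/-- One splitting step: arrays `11`, `12` hold `Rem` and `X`. -/
def splitStep : Prog :=
  .seq projMat
    (.ite (.rlt (.div (.const 1) (.mul (.get 3 (.const 0)) (.get 3 (.const 0))))
        (.sub (.get 14 (.var 12)) (.get 14 (.add (.var 12) (.const 1)))))
      (.seq (mulMat 17 16 12) (.seq (mulMat 18 11 17)
        (.seq (setSum 19 (.const 0) 13 (.mul (.var 2) (.var 2)) (.mul (.get 18 (.var 13)) (.get 18 (.var 13))))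
          (.ite (.rlt (.const (1 / 2)) (.get 19 (.const 0))) (copyMat 12 17) (subMat 21 12 17)))))
      .skip)

theorem sum_range_sq_eq_entrySq {R : ℕ} {r : ℕ → ℕ → ℝ} {a : ℕ} {Z : Matrix (Fin R) (Fin R) ℝ}
    (h : IsMat r a Z) : ∑ p ∈ Finset.range (R * R), r a p * r a p = entrySq Z := by
  rw [Finset.sum_range, ← Equiv.sum_comp finProdFinEquiv, Fintype.sum_prod_type, entrySq]
  refine Finset.sum_congr rfl fun i _ => Finset.sum_congr rfl fun j _ => ?_
  rw [← h i j, sq]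
  simp [finProdFinEquiv, add_comm, mul_comm]

theorem Runs.splitStep {S R m k p T : ℕ} {s : State} {q : Fin R → EuclideanSpace ℝ (Fin R)}
    {δ e : ℝ} {Sm : ℕ → Matrix (Fin R) (Fin R) ℝ} {d : ℕ → Fin R → ℝ} {U : Finset (Fin R)}
    {X Rem : Matrix (Fin R) (Fin R) ℝ} (hS : 1 ≤ S) (hRS : R * R ≤ S) (hR : s.nat 2 = R)
    (hm : s.nat 12 = m) (hmR : m + 1 < R) (hr : s.real 3 0 = R)
    (hJ : NearlyJointlyDiagonal q δ T Sm d e) (hk : k < T) (hp : p ≤ R)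
    (hw : ∀ j : Fin R, s.real 14 j = symEigenvalue (Sm k) j)
    (hv : IsMat s.real 15 (Matrix.of fun i j => symEigenvector (Sm k) j i))
    (hX : IsMat s.real 12 X) (hXC : ClassInv q Sm d e U k m X) (hRem : IsMat s.real 11 Rem)
    (hRemA : ActsAs q Rem U (p * (R : ℝ) ^ 3 * e)) (hRemn : NormLe Rem (1 + p)) :
    Runs RealRAM.splitStep s (timeBound S 4000) fun s' => Frame 13 {12, 16, 17, 18, 19, 20, 21} s s' ∧
      ∃ X', IsMat s'.real 12 X' ∧ ClassInv q Sm d e U k (m + 1) X' := by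
  have hRS' : R ≤ S := (Nat.le_mul_self R).trans hRS
  refine Runs.seq hS (Runs.projMat hS hRS' hR hm (by omega) hv) (b := 3390) ?_ (by norm_num)
  rintro s1 ⟨hF1, hP⟩
  have hm1 : s1.nat 12 = m := (hF1.1 12 (by norm_num)).trans hm
  have hR1 : s1.nat 2 = R := (hF1.1 2 (by norm_num)).trans hR
  have hX1 := hX.frame hF1 (by simp)
  have hRem1 := hRem.frame hF1 (by simp)
  have hFw : Frame 13 {12, 16, 17, 18, 19, 20, 21} s s1 :=
    hF1.weaken le_rfl (by intro y; simp; tauto)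
  set a : Fin R := ⟨m, by omega⟩ with ha
  set b : Fin R := ⟨m + 1, hmR⟩ with hb
  -- Array 3 holds R as a real number, since integer registers cannot enter arithmetic on reals; the
  -- test is then literally `HasGap`.
  have htest : (Test.rlt (.div (.const 1) (.mul (.get 3 (.const 0)) (.get 3 (.const 0))))
      (.sub (.get 14 (.var 12)) (.get 14 (.add (.var 12) (.const 1))))).Holds s1 ↔
      HasGap (Sm k) a b := by
    have e3 : s1.real 3 0 = R := by rw [hF1.2 3 (by simp)]; exact hr
    have e14 : s1.real 14 = s.real 14 := hF1.2 14 (by simp)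
    simp only [Test.Holds, RExp.eval, NExp.eval, hm1, e3, e14, HasGap, Rat.cast_one]
    rw [← hw a, ← hw b, sq]
    simp [ha, hb]
  refine Runs.ite (c := 3370) hS ?_ ?_ (by simp [Test.cost, RExp.cost, NExp.cost])
  · intro hb1
    have hgap := htest.1 hb1
    refine Runs.seq (b := 2760) hS (Runs.mulMat hS hRS' (by norm_num) hR1 (by norm_num)
      (by norm_num) hP hX1) ?_ (by norm_num)
    rintro s2 ⟨hF2, hY⟩
    have hR2 : s2.nat 2 = R := (hF2.1 2 (by norm_num)).trans hR1
    have hX2 := hX1.frame hF2 (by simp)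
    have hRem2 := hRem1.frame hF2 (by simp)
    refine Runs.seq (b := 2100) hS (Runs.mulMat hS hRS' (by norm_num) hR2 (by norm_num)
      (by norm_num) hRem2 hY) ?_ (by norm_num)
    rintro s3 ⟨hF3, hZ⟩
    have hR3 : s3.nat 2 = R := (hF3.1 2 (by norm_num)).trans hR2
    have hX3 := hX2.frame hF3 (by simp)
    have hY3 := hY.frame hF3 (by simp)
    refine Runs.seq (a := 400) (b := 1600) hS (Runs.setSum (S := S) (M := R * R) (p := 0)
      (A := {19, 20}) (f := fun _ => ∑ p ∈ Finset.range (R * R), s3.real 18 p * s3.real 18 p)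
      (fun p => s3.real 18 p * s3.real 18 p) hS hRS (by simp [NExp.cost]) (by simp [NExp.cost])
      (by simp [RExp.cost, NExp.cost]) (by simp) (by simp) (by norm_num) ?_ ?_ ?_ rfl) ?_
      (by norm_num)
    · intro s' hF; simp [NExp.eval, hF.1 2 (by norm_num), hR3]
    · intro s' hF; rfl
    · intro k s' _ hF hz; simp [RExp.eval, NExp.eval, hz, hF.2 18 (by simp)]
    rintro s4 ⟨hF4, h4, -⟩
    have hR4 : s4.nat 2 = R := (hF4.1 2 (by norm_num)).trans hR3
    have hX4 := hX3.frame hF4 (by simp)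
    have hY4 := hY3.frame hF4 (by simp)
    have hs4 : s4.real 19 0 = entrySq (Rem * (eigenProj (Sm k) m * X)) := by
      rw [h4 0 rfl]; exact sum_range_sq_eq_entrySq hZ
    have hF14 : Frame 13 {12, 16, 17, 18, 19, 20, 21} s s4 :=
      ((hFw.trans (hF2.weaken le_rfl (by intro y; simp; tauto))).trans
        (hF3.weaken le_rfl (by intro y; simp; tauto))).trans
        (hF4.weaken le_rfl (by intro y; simp; tauto))
    have hsplit := hJ.split hk hp hXC hRemA hRemn (a := a) rfl hgap
    refine Runs.ite (c := 1201) hS ?_ ?_ (by simp [Test.cost, RExp.cost, NExp.cost])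
    · intro h
      have h' : 1 / 2 < entrySq (Rem * (eigenProj (Sm k) a * X)) := by
        simpa [Test.Holds, RExp.eval, NExp.eval, hs4] using h
      refine ((Runs.copyMat hS hRS' (by norm_num) hR4 (by norm_num) hY4).timeLe hS
        (by norm_num)).imp ?_
      rintro s5 ⟨hF5, h5⟩
      exact ⟨hF14.trans (hF5.weaken le_rfl (by intro y; simp; tauto)), _, h5, hsplit.1 h'⟩
    · intro h
      have h' : ¬ 1 / 2 < entrySq (Rem * (eigenProj (Sm k) a * X)) := by
        simpa [Test.Holds, RExp.eval, NExp.eval, hs4] using h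
      refine (Runs.subMat hS hRS' (by norm_num) hR4 (by norm_num) (by norm_num) hX4 hY4).imp ?_
      rintro s5 ⟨hF5, h5⟩
      exact ⟨hF14.trans (hF5.weaken le_rfl (by intro y; simp; tauto)), _, h5, hsplit.2 h'⟩
  · intro hb1
    refine (Runs.skip hS ?_).timeLe hS (by norm_num)
    refine ⟨hFw, X, hX1, hXC.skip hJ.error_nonneg ?_⟩
    intro a' b' ha' hg
    obtain rfl : a' = a := Fin.ext ha'
    obtain rfl : b' = b := Fin.ext (by have := hg.1; simp [this, hb, ha])
    exact hb1 (htest.2 hg)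

end RealRAM

namespace RealRAM

/-! ### One pass: isolating and reading one component -/

/-- The integer registers after the prologue. -/
structure Env (n l R : ℕ) (s : State) : Prop where
  reg0 : s.nat 0 = n
  reg1 : s.nat 1 = l
  reg2 : s.nat 2 = R
  reg3 : s.nat 3 = n ^ (l - 1)
  reg4 : s.nat 4 = n ^ l
  reg5 : s.nat 5 = ∑ i ∈ Finset.range l, n ^ i
  reg6 : s.nat 6 = ∑ i ∈ Finset.range R, i

theorem Env.frame {n l R d : ℕ} {A : Set ℕ} {s s' : State} (h : Env n l R s) (hF : Frame d A s s')
    (hd : 7 ≤ d) : Env n l R s' :=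
  ⟨(hF.1 0 (by omega)).trans h.reg0, (hF.1 1 (by omega)).trans h.reg1,
    (hF.1 2 (by omega)).trans h.reg2, (hF.1 3 (by omega)).trans h.reg3,
    (hF.1 4 (by omega)).trans h.reg4, (hF.1 5 (by omega)).trans h.reg5,
    (hF.1 6 (by omega)).trans h.reg6⟩

/-- Array `13` becomes the matrix number `k` in the kernel of the detector, `k` in register `11`. -/
def loadKernel : Prog :=
  fillMat 13 13 (.var 2) (.var 2) (.const 1)
    (.get 10 (.idx (.idx (.var 13) (.var 2) (.var 14)) (.mul (.var 2) (.var 2))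
      (.add (.var 6) (.var 11))))

/-- The splitting steps for one matrix. -/
def kernelStep : Prog :=
  .seq loadKernel (.seq (.eig (.var 2) 13 14 15) (forN 12 (.sub (.var 2) (.const 1)) splitStep))

variable {n l R : ℕ}

theorem Runs.loadKernel {S k : ℕ} {s : State} {w : Fin R → EuclideanSpace ℝ (Fin (n ^ l))}
    (hS : 1 ≤ S) (hRS : R ≤ S) (henv : Env n l R s) (hk : s.nat 11 = k)
    (hkT : k < R * R - ∑ i ∈ Finset.range R, i)
    (h10 : IsMat s.real 10 (Matrix.of fun i j => symEigenvector (detectorGram w) j i)) :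
    Runs RealRAM.loadKernel s (timeBound S 600) fun s' =>
      Frame 13 {20, 13} s s' ∧ IsMat s'.real 13 (kernelMat w k) := by
  have henv' := fun s' (h : Frame 13 {20, 13} s s') => henv.frame h (by norm_num)
  refine Runs.fillPointwise _ hS hRS hRS
    ⟨by simp [NExp.cost], by simp [NExp.cost], by simp [RExp.cost, NExp.cost], by norm_num⟩
    (fun s' h => (henv' s' h).reg2) (fun s' h => (henv' s' h).reg2) ?_
  intro i j s' hF h1 h2
  have hlt : ∑ i ∈ Finset.range R, i + k < R * R := by omega
  -- Entry (i, j) of kernel matrix k is coordinate iR + j of the eigenvector number K + k.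
  have e1 := (h10.frame hF (by simp)) (finProdFinEquiv (i, j)) ⟨_, hlt⟩
  simp only [RExp.eval, NExp.eval, h1, h2, (henv' s' hF).reg2, (henv' s' hF).reg6,
    (hF.1 11 (by norm_num)).trans hk, kernelMat, Matrix.of_apply, dif_pos hlt]
  rw [Matrix.of_apply] at e1
  rw [← e1]
  simp [finProdFinEquiv, add_comm, mul_comm]

theorem Runs.kernelStep {S k p : ℕ} {s : State} {q : Fin R → EuclideanSpace ℝ (Fin R)}
    {δ e : ℝ} {w : Fin R → EuclideanSpace ℝ (Fin (n ^ l))} {d : ℕ → Fin R → ℝ}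
    {U : Finset (Fin R)} {X Rem : Matrix (Fin R) (Fin R) ℝ} (hS : 1 ≤ S) (hRS : R * R ≤ S)
    (henv : Env n l R s) (hk : s.nat 11 = k) (hkT : k < R * R - ∑ i ∈ Finset.range R, i)
    (hr : s.real 3 0 = R)
    (h10 : IsMat s.real 10 (Matrix.of fun i j => symEigenvector (detectorGram w) j i))
    (hJ : NearlyJointlyDiagonal q δ (R * R - ∑ i ∈ Finset.range R, i) (kernelMat w) d e)
    (hp : p ≤ R) (hX : IsMat s.real 12 X) (hXC : ClassInv q (kernelMat w) d e U k 0 X)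
    (hRem : IsMat s.real 11 Rem)
    (hRemA : ActsAs q Rem U (p * (R : ℝ) ^ 3 * e)) (hRemn : NormLe Rem (1 + p)) :
    Runs RealRAM.kernelStep s (timeBound S 5000) fun s' =>
      Frame 12 {12, 13, 14, 15, 16, 17, 18, 19, 20, 21} s s' ∧
      ∃ X', IsMat s'.real 12 X' ∧ ClassInv q (kernelMat w) d e U (k + 1) 0 X' := by
  have hRS' : R ≤ S := (Nat.le_mul_self R).trans hRS
  refine Runs.seq (b := 4300) hS (Runs.loadKernel hS hRS' henv hk hkT h10) ?_ (by norm_num)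
  rintro s1 ⟨hF1, h13⟩
  have henv1 := henv.frame hF1 (by norm_num)
  refine Runs.seq (b := 4200) hS (Runs.eigMat (x := 13) hS hRS' (by simp [NExp.cost]) (by norm_num)
    henv1.reg2 h13) ?_ (by norm_num)
  rintro s2 ⟨hF2, hw2, hv2⟩
  have henv2 := henv1.frame hF2 (by norm_num)
  have hF12 : Frame 13 {13, 14, 15, 20} s s2 :=
    (hF1.weaken le_rfl (by intro y; simp; tauto)).trans
      (hF2.weaken le_rfl (by intro y; simp; tauto))
  have hX2 := hX.frame hF12 (by simp)
  have hRem2 := hRem.frame hF12 (by simp)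
  have hr2 : s2.real 3 0 = R := by rw [hF12.2 3 (by simp)]; exact hr
  refine ((Runs.forFrame (c := 4000) (A := {12, 16, 17, 18, 19, 20, 21}) (m := R - 1) hS (by omega)
    (by simp [NExp.cost]) (fun m r => ∃ X', IsMat r 12 X' ∧ ClassInv q (kernelMat w) d e U k m X')
    ?_ ⟨X, hX2, hXC⟩ ?_).timeLe hS (by norm_num)).imp ?_
  · intro s' hF; simp [NExp.eval, (hF.1 2 (by norm_num)).trans henv2.reg2]
  · rintro m s' hm hm12 hF ⟨X', hX', hXC'⟩
    refine Runs.splitStep hS hRS ((hF.1 2 (by norm_num)).trans henv2.reg2) hm12 (by omega) ?_ hJ hkT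
      hp ?_ (hv2.frame hF (by simp)) hX' hXC' (hRem2.frame hF (by simp)) hRemA hRemn
    · rw [hF.2 3 (by simp)]; exact hr2
    · intro j; rw [hF.2 14 (by simp)]; exact hw2 j
  · rintro s' ⟨hF, X', hX', hXC'⟩
    exact ⟨(hF12.weaken (by norm_num) (by intro y; simp; tauto)).trans
      (hF.weaken (by norm_num) (by intro y; simp; tauto)), X', hX', hXC'.next hJ.error_nonneg⟩

/-- Array `24` becomes `W X Wᵀ`; arrays `6` and `12` hold `W` and `X`. -/
def conjMat : Prog :=
  .seq (fillMat 13 23 (.var 2) (.var 4) (.var 2)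
      (.mul (.get 12 (.idx (.var 13) (.var 2) (.var 15))) (.get 6 (.idx (.var 14) (.var 2) (.var 15)))))
    (fillMat 13 24 (.var 4) (.var 4) (.var 2)
      (.mul (.get 6 (.idx (.var 13) (.var 2) (.var 15))) (.get 23 (.idx (.var 15) (.var 4) (.var 14)))))

theorem Runs.conjMat {S : ℕ} {s : State} {w : Fin R → EuclideanSpace ℝ (Fin (n ^ l))}
    {X : Matrix (Fin R) (Fin R) ℝ} (hS : 1 ≤ S) (hRS : R ≤ S) (hNS : n ^ l ≤ S)
    (henv : Env n l R s) (h6 : IsMat s.real 6 (Matrix.of fun x k => w k x))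
    (hX : IsMat s.real 12 X) :
    Runs RealRAM.conjMat s (timeBound S 1201) fun s' => Frame 13 {20, 23, 24} s s' ∧
      IsMat s'.real 24 (Matrix.of (conjEntry w X)) := by
  have henv' := fun s' (h : Frame 13 {20, 23} s s') => henv.frame h (by norm_num)
  refine Runs.seq (b := 600) hS (Runs.fillEntries (Matrix.of fun k y => ∑ j, X k j * w j y)
    (fun _ _ => R) (fun k y j => if h : j < R then X k ⟨j, h⟩ * w ⟨j, h⟩ y else 0) hS hRS hNS
    (fun _ _ => hRS)
    ⟨by simp [NExp.cost], by simp [NExp.cost], by simp [NExp.cost], by simp [RExp.cost, NExp.cost],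
      by norm_num⟩
    (fun s' h => (henv' s' h).reg2) (fun s' h => (henv' s' h).reg4)
    (fun _ _ s' h _ _ => (henv' s' h).reg2) ?_ ?_) ?_ le_rfl
  · intro k y j s' hj hF h1 h2 h3
    have e1 := (hX.frame hF (by simp)) k ⟨j, hj⟩
    have e2 := (h6.frame hF (by simp)) y ⟨j, hj⟩
    simp only [RExp.eval, NExp.eval, h1, h2, h3, (henv' s' hF).reg2, dif_pos hj]
    rw [e1, e2]; rfl
  · intro k y
    rw [Matrix.of_apply, Finset.sum_range]
    exact Finset.sum_congr rfl fun j _ => by simp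
  rintro s1 ⟨hF1, h23⟩
  have henv1 := henv.frame hF1 (by norm_num)
  have h61 := h6.frame hF1 (by simp)
  have henv1' := fun s' (h : Frame 13 {20, 24} s1 s') => henv1.frame h (by norm_num)
  refine (Runs.fillEntries (r := .var 4) (d := .var 4) (m := .var 2) (Matrix.of (conjEntry w X))
    (fun _ _ => R) (fun x y k => if h : k < R then w ⟨k, h⟩ x * ∑ j, X ⟨k, h⟩ j * w j y else 0)
    hS hNS hNS (fun _ _ => hRS)
    ⟨by simp [NExp.cost], by simp [NExp.cost], by simp [NExp.cost], by simp [RExp.cost, NExp.cost],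
      by norm_num⟩
    (fun s' h => (henv1' s' h).reg4) (fun s' h => (henv1' s' h).reg4)
    (fun _ _ s' h _ _ => (henv1' s' h).reg2) ?_ ?_).imp ?_
  · intro x y k s' hk hF h1 h2 h3
    have e1 := (h23.frame hF (by simp)) ⟨k, hk⟩ y
    have e2 := (h61.frame hF (by simp)) x ⟨k, hk⟩
    simp only [RExp.eval, NExp.eval, h1, h2, h3, (henv1' s' hF).reg2, (henv1' s' hF).reg4, dif_pos hk]
    rw [e1, e2]; rfl
  · intro x y
    rw [Matrix.of_apply, Finset.sum_range]
    exact Finset.sum_congr rfl fun j _ => by simp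
  · rintro s2 ⟨hF2, h24⟩
    exact ⟨(hF1.weaken le_rfl (by intro y; simp; tauto)).trans
      (hF2.weaken le_rfl (by intro y; simp; tauto)), h24⟩

/-- The diagonal entry of array `24` at the position of `(j, …, j)`, where `j` is in register `x`. -/
def diagEntry (x : ℕ) : RExp :=
  .get 24 (.idx (.mul (.var x) (.var 5)) (.var 4) (.mul (.var x) (.var 5)))

/-- Register `11` becomes the position of the largest diagonal entry. -/
def argMax : Prog :=
  .seq (.setNat 11 (.const 0))
    (forN 12 (.var 0) (.ite (.rlt (diagEntry 11) (diagEntry 12)) (.setNat 11 (.var 12)) .skip))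

theorem Runs.argMax {S : ℕ} {s : State} (hS : 1 ≤ S) (hnS : n ≤ S) (hn : 1 ≤ n)
    (henv : Env n l R s) {H : Matrix (Fin (n ^ l)) (Fin (n ^ l)) ℝ} (hH : IsMat s.real 24 H) :
    Runs RealRAM.argMax s (timeBound S 300) fun s' => Frame 11 ∅ s s' ∧
      ∃ j : Fin n, s'.nat 11 = j ∧
        ∀ m, H (diagIndex l m) (diagIndex l m) ≤ H (diagIndex l j) (diagIndex l j) := by
  have hval : ∀ s' x (j : Fin n), Frame 11 ∅ s s' → s'.nat x = j →
      (diagEntry x).eval s' = H (diagIndex l j) (diagIndex l j) := by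
    intro s' x j hF hx
    have henv' := henv.frame hF (by norm_num)
    have e1 := (hH.frame hF (by simp)) (diagIndex l j) (diagIndex l j)
    rw [diagIndex, finFunctionFinEquiv_const] at e1
    simp only [diagEntry, RExp.eval, NExp.eval, hx, henv'.reg4, henv'.reg5]
    exact e1
  refine Runs.seq (a := 1) (b := 290) hS
    (Q' := fun s' => Frame 11 ∅ s s' ∧ s'.nat 11 = (⟨0, hn⟩ : Fin n)) ?_ ?_ (by norm_num)
  · refine Runs.setNat hS (by simp [NExp.cost]) ?_
    exact ⟨Frame.setReg (x := 11) (v := 0) le_rfl, by simp [NExp.eval]⟩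
  rintro s1 ⟨hF1, h1⟩
  refine (Runs.forN (c := 60) hS hnS (by simp [NExp.cost]) (fun i s' => Frame 11 ∅ s s' ∧
    ∃ j : Fin n, s'.nat 11 = j ∧ ∀ m : Fin n, m.val < i →
      H (diagIndex l m) (diagIndex l m) ≤ H (diagIndex l j) (diagIndex l j)) ?_ ?_ ?_
    (fun s' h _ => ?_)).timeLe hS (by norm_num)
  · refine ⟨hF1.trans (Frame.setReg (by norm_num)), ⟨0, hn⟩, ?_, by simp⟩
    rw [State.setReg_nat_of_ne _ (by norm_num)]; exact h1
  · rintro i s' - ⟨hF, -⟩ -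
    exact (henv.frame hF (by norm_num)).reg0
  · rintro i s' hi ⟨hF, j, hj, hmax⟩ hx
    have e1 := hval s' 11 j hF hj
    have e2 := hval s' 12 ⟨i, hi⟩ hF hx
    refine Runs.ite (c := 1) hS ?_ ?_ (by simp [Test.cost, diagEntry, RExp.cost, NExp.cost])
    · intro hlt
      simp only [Test.Holds, e1, e2] at hlt
      refine Runs.setNat hS (by simp [NExp.cost]) ?_
      have hF' : Frame 11 ∅ s' (s'.setReg 11 i) := Frame.setReg le_rfl
      have e0 : ({ s' with nat := Function.update s'.nat 11 (NExp.eval s' (.var 12)) } : State) =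
          s'.setReg 11 i := by simp [NExp.eval, hx, State.setReg]
      rw [e0]
      refine ⟨by rw [State.setReg_nat_of_ne _ (by norm_num)]; exact hx,
        (hF.trans hF').trans (Frame.setReg (by norm_num)), ⟨i, hi⟩, ?_, ?_⟩
      · rw [State.setReg_nat_of_ne _ (by norm_num)]; simp
      · intro m hm
        rcases Nat.lt_succ_iff_lt_or_eq.1 hm with h | h
        · exact (hmax m h).trans hlt.le
        · obtain rfl : m = ⟨i, hi⟩ := Fin.ext h
          exact le_rfl
    · intro hlt
      simp only [Test.Holds, e1, e2, not_lt] at hlt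
      refine (Runs.skip hS ?_).timeLe hS (by norm_num)
      refine ⟨hx, hF.trans (Frame.setReg (by norm_num)), j, ?_, ?_⟩
      · rw [State.setReg_nat_of_ne _ (by norm_num)]; exact hj
      · intro m hm
        rcases Nat.lt_succ_iff_lt_or_eq.1 hm with h | h
        · exact hmax m h
        · obtain rfl : m = ⟨i, hi⟩ := Fin.ext h
          exact hlt
  · obtain ⟨hF, j, hj, hmax⟩ := h
    exact ⟨hF, j, hj, fun m => hmax m m.2⟩

/-- The row of the output numbered by register `10` is read off from array `24`. -/
def writeRow : Prog :=
  forN 12 (.var 0) (.setReal 2 (.idx (.var 10) (.var 0) (.var 12))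
    (.mul (.div (.get 24 (.idx (.add (.var 12) (.mul (.var 11) (.sub (.var 5) (.const 1)))) (.var 4)
      (.mul (.var 11) (.var 5)))) (diagEntry 11)) (.root (.mul (.const 2) (.var 1)) (diagEntry 11))))

theorem Runs.writeRow {S p : ℕ} {s : State} (hS : 1 ≤ S) (hnS : n ≤ S) (hl : 1 ≤ l)
    (henv : Env n l R s)
    {H : Matrix (Fin (n ^ l)) (Fin (n ^ l)) ℝ} (hH : IsMat s.real 24 H) {j : Fin n}
    (hp : s.nat 10 = p) (hj : s.nat 11 = j) :
    Runs RealRAM.writeRow s (timeBound S 200) fun s' => Frame 12 {2} s s' ∧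
      (∀ m : Fin n, s'.real 2 (p * n + m) = readRow H j m) ∧
      ∀ p' ≠ p, ∀ m : Fin n, s'.real 2 (p' * n + m) = s.real 2 (p' * n + m) := by
  have hn : 0 < n := j.pos
  have hdiv : ∀ p (m : Fin n), (p * n + m.val) / n = p := by
    intro p m
    rw [mul_comm, Nat.mul_add_div hn, Nat.div_eq_of_lt m.2, add_zero]
  have hmod : ∀ p (m : Fin n), (p * n + m.val) % n = m := by
    intro p m
    rw [mul_comm, Nat.mul_add_mod, Nat.mod_eq_of_lt m.2]
  -- Outside row p the target is the present content of the array, so the same statement also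
  -- records that the other rows survive.
  set f : ℕ → ℝ := fun a => if a / n = p then readRow H j ⟨a % n, Nat.mod_lt _ hn⟩ else s.real 2 a
    with hf
  refine (Runs.forFill (c := 100) (A := {2}) (a := 2) (f := f) (D' := {a | ∃ m : Fin n, a = p * n + m})
    (fun i => {p * n + i}) hS hnS (by simp [NExp.cost]) ?_ ?_ ?_).imp ?_
  · intro s' hF; exact (henv.frame hF (by norm_num)).reg0
  · rintro a ⟨m, rfl⟩; exact ⟨m, m.2, rfl⟩
  · intro i s' hi hx hF
    refine Runs.setReal hS (by simp [diagEntry, RExp.cost, NExp.cost]) ?_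
    have henv' := henv.frame hF (by norm_num)
    have e10 : s'.nat 10 = p := (hF.1 10 (by norm_num)).trans hp
    have e11 : s'.nat 11 = j := (hF.1 11 (by norm_num)).trans hj
    have hH' := hH.frame hF (by simp)
    have e1 := hH' (diagIndex l j) (diagIndex l j)
    have e2 := hH' (nearDiagIndex l ⟨i, hi⟩ j) (diagIndex l j)
    rw [diagIndex, finFunctionFinEquiv_const] at e1
    rw [diagIndex, finFunctionFinEquiv_const, nearDiagIndex, finFunctionFinEquiv_cons hl] at e2
    have hval : f (p * n + i) = readRow H j ⟨i, hi⟩ := by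
      simp only [hf]
      have h1 := hdiv p ⟨i, hi⟩
      have h2 := hmod p ⟨i, hi⟩
      simp only at h1 h2
      rw [if_pos h1]
      exact congrArg (fun m => readRow H j m) (Fin.ext h2)
    have haddr : NExp.eval s' (.idx (.var 10) (.var 0) (.var 12)) = p * n + i := by
      simp [NExp.eval, e10, hx, henv'.reg0]
    rw [haddr]
    refine Fills.write (by simp) ?_
    rw [hval]
    simp only [diagEntry, RExp.eval, NExp.eval, hx, e11, henv'.reg4, henv'.reg5, henv'.reg1]
    rw [e1, e2]
    rfl
  · rintro s' ⟨hF, h1, h2⟩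
    refine ⟨hF, fun m => ?_, fun p' hp' m => ?_⟩
    · rw [h1 _ ⟨m, rfl⟩]
      simp only [hf]
      rw [if_pos (hdiv p m)]
      exact congrArg (fun m => readRow H j m) (Fin.ext (hmod p m))
    · rcases h2 (p' * n + m) with h | h
      · exact h
      · rw [h]
        simp only [hf]
        rw [if_neg (by rw [hdiv]; exact hp')]

/-- One pass. -/
def pass : Prog :=
  .seq (identMat 12) (.seq (forN 11 (.sub (.mul (.var 2) (.var 2)) (.var 6)) kernelStep)
    (.seq (subMat 22 11 12) (.seq conjMat (.seq argMax writeRow))))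

/-- Row `p` of the output was read off from a projection to a single component `i`. -/
def IsRow (q : Fin R → EuclideanSpace ℝ (Fin R)) (e : ℝ)
    (w : Fin R → EuclideanSpace ℝ (Fin (n ^ l))) (r : ℕ → ℕ → ℝ) (p : ℕ) (i : Fin R) : Prop :=
  ∃ X, ActsAs q X {i} ((R : ℝ) ^ 3 * e) ∧ NormLe X 1 ∧ ∃ j : Fin n,
    (∀ m, conjEntry w X (diagIndex l m) (diagIndex l m) ≤
      conjEntry w X (diagIndex l j) (diagIndex l j)) ∧
    ∀ m : Fin n, r 2 (p * n + m) = readRow (conjEntry w X) j m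

/-- U is the set of components not yet found. Subtracting the new projection from `Rem` removes one
index from U; it adds R³e to the error and 1 to the norm bound, so after R passes both are still
polynomial in R. -/
theorem Runs.pass {S p : ℕ} {s : State} {q : Fin R → EuclideanSpace ℝ (Fin R)}
    {δ e : ℝ} {w : Fin R → EuclideanSpace ℝ (Fin (n ^ l))} {d : ℕ → Fin R → ℝ}
    {U : Finset (Fin R)} {Rem : Matrix (Fin R) (Fin R) ℝ} (hS : 1 ≤ S) (hRS : R * R ≤ S)
    (hNS : n ^ l ≤ S) (hnS : n ≤ S) (hl : 1 ≤ l) (hn : 1 ≤ n)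
    (henv : Env n l R s) (hp : s.nat 10 = p) (hpR : p ≤ R) (hr : s.real 3 0 = R)
    (h6 : IsMat s.real 6 (Matrix.of fun x k => w k x))
    (h10 : IsMat s.real 10 (Matrix.of fun i j => symEigenvector (detectorGram w) j i))
    (hJ : NearlyJointlyDiagonal q δ (R * R - ∑ i ∈ Finset.range R, i) (kernelMat w) d e)
    (hRem : IsMat s.real 11 Rem) (hRemA : ActsAs q Rem U (p * (R : ℝ) ^ 3 * e))
    (hRemn : NormLe Rem (1 + p)) (hU : U.Nonempty) :
    Runs RealRAM.pass s (timeBound S 9000) fun s' =>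
      Frame 11 ({2} ∪ Set.Icc 11 24) s s' ∧
      ∃ i ∈ U, ∃ Rem', IsMat s'.real 11 Rem' ∧
        ActsAs q Rem' (U \ {i}) ((p + 1 : ℕ) * (R : ℝ) ^ 3 * e) ∧ NormLe Rem' (1 + (p + 1 : ℕ)) ∧
        IsRow q e w s'.real p i ∧
        ∀ p' ≠ p, ∀ m : Fin n, s'.real 2 (p' * n + m) = s.real 2 (p' * n + m) := by
  have hRS' : R ≤ S := (Nat.le_mul_self R).trans hRS
  refine Runs.seq (b := 8006) hS (Runs.identMat hS hRS' (by norm_num) henv.reg2) ?_ (by norm_num)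
  rintro s1 ⟨hF1, hX1⟩
  have henv1 := henv.frame hF1 (by norm_num)
  have h101 := h10.frame hF1 (by simp)
  have hRem1 := hRem.frame hF1 (by simp)
  have hr1 : s1.real 3 0 = R := by rw [hF1.2 3 (by simp)]; exact hr
  refine Runs.seq (a := 5100) (b := 2905) hS (Runs.forFrame (c := 5000)
    (A := {12, 13, 14, 15, 16, 17, 18, 19, 20, 21}) (m := R * R - ∑ i ∈ Finset.range R, i) hS
    ((Nat.sub_le _ _).trans hRS) (by simp [NExp.cost])
    (fun k r => ∃ X, IsMat r 12 X ∧ ClassInv q (kernelMat w) d e U k 0 X) ?_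
    ⟨_, hX1, ClassInv.start q (kernelMat w) d e hU⟩ ?_) ?_ (by norm_num)
  · intro s' hF
    simp [NExp.eval, (hF.1 2 (by norm_num)).trans henv1.reg2, (hF.1 6 (by norm_num)).trans henv1.reg6]
  · rintro k s' hk hx hF ⟨X, hX, hXC⟩
    refine Runs.kernelStep hS hRS (henv1.frame hF (by norm_num)) hx hk ?_ (h101.frame hF (by simp))
      hJ hpR hX hXC (hRem1.frame hF (by simp)) hRemA hRemn
    rw [hF.2 3 (by simp)]; exact hr1
  rintro s2 ⟨hF2, X, hX2, hXC⟩
  obtain ⟨i, hiU, hXi, hXn⟩ := hJ.exists_single hXC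
  have hR2 : s2.nat 2 = R := (hF2.1 2 (by norm_num)).trans henv1.reg2
  have hF02 : Frame 11 (Set.Icc 11 24) s s2 :=
    (hF1.weaken (by norm_num) (by intro y; simp; omega)).trans
      (hF2.weaken (by norm_num) (by intro y; simp; omega))
  have hRem2 := hRem1.frame hF2 (by simp)
  refine Runs.seq (b := 1703) hS (Runs.subMat (a := 22) (b := 11) (c := 12) hS hRS' (by norm_num) hR2
    (by norm_num) (by norm_num) hRem2 hX2) ?_ (by norm_num)
  rintro s3 ⟨hF3, hRem3⟩
  have hF03 : Frame 11 (Set.Icc 11 24) s s3 :=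
    hF02.trans (hF3.weaken (by norm_num) (by intro y; simp; omega))
  have henv3 := henv.frame hF03 (by norm_num)
  refine Runs.seq (b := 501) hS (Runs.conjMat hS hRS' hNS henv3 (h6.frame hF03 (by simp))
    (hX2.frame hF3 (by simp))) ?_ (by norm_num)
  rintro s4 ⟨hF4, h24⟩
  have hF04 : Frame 11 (Set.Icc 11 24) s s4 :=
    hF03.trans (hF4.weaken (by norm_num) (by intro y; simp; omega))
  have henv4 := henv.frame hF04 (by norm_num)
  refine Runs.seq (b := 200) hS (Runs.argMax hS hnS hn henv4 h24) ?_ (by norm_num)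
  rintro s5 ⟨hF5, j, hj, hmax⟩
  have hF05 : Frame 11 (Set.Icc 11 24) s s5 :=
    hF04.trans (hF5.weaken (by norm_num) (by simp))
  have henv5 := henv.frame hF05 (by norm_num)
  refine (Runs.writeRow hS hnS hl henv5 (h24.frame hF5 (by simp))
    ((hF05.1 10 (by norm_num)).trans hp) hj).imp ?_
  rintro s6 ⟨hF6, hrow, hother⟩
  refine ⟨(hF05.weaken le_rfl Set.subset_union_right).trans
    (hF6.weaken (by norm_num) Set.subset_union_left), i, hiU, Rem - X, ?_, ?_, ?_,
    ⟨X, hXi, hXn, j, hmax, hrow⟩, ?_⟩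
  · exact (((hRem3.frame hF4 (by simp)).frame hF5 (by simp)).frame hF6 (by simp))
  · refine (hRemA.sub hXi (by simpa using hiU)).mono (le_of_eq ?_)
    push_cast; ring
  · have := hRemn.sub hXn
    rw [show (1 + p + 1 : ℝ) = 1 + (p + 1 : ℕ) by push_cast; ring] at this
    exact this
  · intro p' hp' m
    rw [hother p' hp' m, hF05.2 2 (by simp)]

end RealRAM

namespace RealRAM

variable {n l R : ℕ}

/-! ### All passes -/

/-- The invariant is an injective record f of the components found so far, with `Rem` acting as the
projection to the complement of its image. Before each of the R passes this complement is nonempty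
by counting. -/
theorem Runs.passes {S : ℕ} {s : State} {q : Fin R → EuclideanSpace ℝ (Fin R)}
    {δ e : ℝ} {w : Fin R → EuclideanSpace ℝ (Fin (n ^ l))} {d : ℕ → Fin R → ℝ}
    (hS : 1 ≤ S) (hRS : R * R ≤ S)
    (hNS : n ^ l ≤ S) (hnS : n ≤ S) (hl : 1 ≤ l) (hn : 1 ≤ n) (hR : R ≠ 0)
    (henv : Env n l R s) (hr : s.real 3 0 = R)
    (h6 : IsMat s.real 6 (Matrix.of fun x k => w k x))
    (h10 : IsMat s.real 10 (Matrix.of fun i j => symEigenvector (detectorGram w) j i))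
    (hJ : NearlyJointlyDiagonal q δ (R * R - ∑ i ∈ Finset.range R, i) (kernelMat w) d e)
    (hRem : IsMat s.real 11 (1 : Matrix (Fin R) (Fin R) ℝ)) :
    Runs (RealRAM.forN 10 (.var 2) RealRAM.pass) s (timeBound S 9100) fun s' =>
      ∃ f : Fin R → Fin R, Function.Injective f ∧ ∀ p : Fin R, IsRow q e w s'.real p (f p) := by
  have hRS' : R ≤ S := (Nat.le_mul_self R).trans hRS
  refine (Runs.forFrame (x := 10) (e := .var 2) (c := 9000) (A := {2} ∪ Set.Icc 11 24) (m := R) hS hRS' (by simp [NExp.cost])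
    (fun p r => ∃ f : ℕ → Fin R, Set.InjOn f (Finset.range p) ∧ ∃ Rem, IsMat r 11 Rem ∧
      ActsAs q Rem (Finset.univ \ (Finset.range p).image f) (p * (R : ℝ) ^ 3 * e) ∧
      NormLe Rem (1 + p) ∧ ∀ p' < p, IsRow q e w r p' (f p')) ?_ ?_ ?_).imp ?_
  · intro s' hF; exact (hF.1 2 (by norm_num)).trans henv.reg2
  · refine ⟨fun _ => ⟨0, Nat.pos_of_ne_zero hR⟩, by simp, 1, hRem, ?_, ?_, by simp⟩
    · simpa using ActsAs.one q
    · simpa using NormLe.one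
  · rintro p s' hp hx hF ⟨f, hf, Rem, hRem', hA, hNm, hrows⟩
    have hU : (Finset.univ \ (Finset.range p).image f).Nonempty := by
      rw [← Finset.card_pos, Finset.card_sdiff_of_subset (Finset.subset_univ _)]
      have := Finset.card_image_le (s := Finset.range p) (f := f)
      simp only [Finset.card_range] at this
      simp only [Finset.card_univ, Fintype.card_fin]
      omega
    refine (Runs.pass hS hRS hNS hnS hl hn (henv.frame hF (by norm_num)) hx hp.le ?_
      (h6.frame hF (by simp)) (h10.frame hF (by simp)) hJ hRem' hA hNm hU).imp ?_
    · rw [hF.2 3 (by simp)]; exact hr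
    rintro s'' ⟨hF', i, hi, Rem'', h11, hA', hN', hrow, hother⟩
    have hi' : ∀ a < p, f a ≠ i := by
      intro a ha h
      simp only [Finset.mem_sdiff, Finset.mem_univ, true_and, Finset.mem_image, Finset.mem_range,
        not_exists, not_and] at hi
      exact hi a ha h
    have hne : ∀ a < p, Function.update f p i a = f a := fun a ha => by
      rw [Function.update_of_ne (by omega)]
    refine ⟨hF', Function.update f p i, ?_, Rem'', h11, ?_, hN', ?_⟩
    · intro a ha b hb hab
      simp only [Finset.coe_range, Set.mem_Iio] at ha hb
      rcases Nat.lt_succ_iff_lt_or_eq.1 ha with ha | rfl <;>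
        rcases Nat.lt_succ_iff_lt_or_eq.1 hb with hb | rfl
      · rw [hne a ha, hne b hb] at hab
        exact hf (by simpa using ha) (by simpa using hb) hab
      · rw [hne a ha, Function.update_self] at hab
        exact absurd hab (hi' a ha)
      · rw [hne b hb, Function.update_self] at hab
        exact absurd hab.symm (hi' b hb)
      · rfl
    · have himg : (Finset.range (p + 1)).image (Function.update f p i) =
          insert i ((Finset.range p).image f) := by
        rw [Finset.range_add_one, Finset.image_insert, Function.update_self]
        congr 1
        exact Finset.image_congr fun a ha => hne a (by simpa using ha)
      rw [himg, Finset.sdiff_insert]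
      rwa [← Finset.sdiff_singleton_eq_erase] at *
    · intro p' hp'
      rcases Nat.lt_succ_iff_lt_or_eq.1 hp' with h | rfl
      · rw [hne p' h]
        obtain ⟨X, h1, h2, j, h3, h4⟩ := hrows p' h
        refine ⟨X, h1, h2, j, h3, fun m => ?_⟩
        rw [hother p' (by omega), h4]
      · rw [Function.update_self]; exact hrow
  · rintro s' ⟨-, f, hf, -, -, -, -, hrows⟩
    refine ⟨fun p => f p, fun a b hab => Fin.ext (hf (by simp) (by simp) hab), fun p => hrows p p.2⟩

theorem closeUpToPermSign_of_isRow {q : Fin R → EuclideanSpace ℝ (Fin R)} {e ε : ℝ}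
    {w : Fin R → EuclideanSpace ℝ (Fin (n ^ l))} {A : Fin R → EuclideanSpace ℝ (Fin n)}
    (hε : 0 < ε)
    (hread : ∀ i X, ActsAs q X {i} ((R : ℝ) ^ 3 * e) → NormLe X 1 → ∀ j,
        (∀ m, conjEntry w X (diagIndex l m) (diagIndex l m) ≤
          conjEntry w X (diagIndex l j) (diagIndex l j)) →
        ∃ s : ℝ, (s = 1 ∨ s = -1) ∧ ‖A i - s • readRow (conjEntry w X) j‖ ≤ ε / R)
    {s : State} {f : Fin R → Fin R} (hf : Function.Injective f)
    (hrow : ∀ p : Fin R, IsRow q e w s.real p (f p)) :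
    CloseUpToPermSign A (output s n R) ε := by
  have h : ∀ p : Fin R, ∃ c : ℝ, (c = 1 ∨ c = -1) ∧ ‖A (f p) - c • output s n R p‖ ≤ ε / R := by
    intro p
    obtain ⟨X, h1, h2, j, h3, h4⟩ := hrow p
    obtain ⟨c, hc, hle⟩ := hread (f p) X h1 h2 j h3
    refine ⟨c, hc, ?_⟩
    have : output s n R p = readRow (conjEntry w X) j := by
      ext m; exact h4 m
    rwa [this]
  choose c hc hle using h
  let σ : Equiv.Perm (Fin R) := Equiv.ofBijective f (Finite.injective_iff_bijective.1 hf)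
  refine ⟨σ.symm, fun i => c (σ.symm i), fun i => hc _, ?_⟩
  rw [← Equiv.sum_comp σ]
  simp only [Equiv.symm_apply_apply]
  calc _ ≤ ∑ _p : Fin R, ε / R := Finset.sum_le_sum fun p _ => hle p
    _ ≤ ε := by
      rcases Nat.eq_zero_or_pos R with rfl | h
      · simpa using hε.le
      · have : (0 : ℝ) < R := by exact_mod_cast h
        simp; field_simp; rfl

/-! ### The detector matrix -/

/-- Detector values of all pairs. -/
def detectorRows (w : Fin R → EuclideanSpace ℝ (Fin (n ^ l))) :
    Matrix (Fin (R * R)) (Fin (n ^ l * n ^ l)) ℝ :=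
  Matrix.of fun p z => detectorBilin l n (w (finProdFinEquiv.symm p).1) (w (finProdFinEquiv.symm p).2)
    (finProdFinEquiv.symm z)

/-- Entry of the scaled eigenvector number `k` at the position with digits `i₁`, `i₀`; all registers. -/
def scaledEntry (k i₁ i₀ : ℕ) : RExp :=
  .get 6 (.idx (.idx (.var i₁) (.var 3) (.var i₀)) (.var 2) (.var k))

/-- Array `7` becomes the table of detector values. -/
def detectorTable : Prog :=
  forN 10 (.var 2) (forN 11 (.var 2) (forN 12 (.var 0) (forN 13 (.var 3)
    (forN 14 (.var 0) (forN 15 (.var 3) (.setReal 7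
      (.idx (.idx (.var 10) (.var 2) (.var 11)) (.mul (.var 4) (.var 4))
        (.idx (.idx (.var 12) (.var 3) (.var 13)) (.var 4) (.idx (.var 14) (.var 3) (.var 15))))
      (.add
        (.sub (.mul (scaledEntry 10 12 13) (scaledEntry 11 14 15))
          (.mul (scaledEntry 10 14 13) (scaledEntry 11 12 15)))
        (.sub (.mul (scaledEntry 11 12 13) (scaledEntry 10 14 15))
          (.mul (scaledEntry 11 14 13) (scaledEntry 10 12 15))))))))))

/-- The address of a detector value in array `7`. -/
def detectorAddr (n l R k j i₁ i₀ j₁ j₀ : ℕ) : ℕ :=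
  (k * R + j) * (n ^ l * n ^ l) + ((i₁ * n ^ (l - 1) + i₀) * n ^ l + (j₁ * n ^ (l - 1) + j₀))

theorem scaledEntry_eval {k i₁ i₀ k' a b : ℕ} {s : State}
    {w : Fin R → EuclideanSpace ℝ (Fin (n ^ l))} (hl : 1 ≤ l) (henv : Env n l R s)
    (h6 : IsMat s.real 6 (Matrix.of fun x k => w k x)) (hk : s.nat k = k') (ha : s.nat i₁ = a)
    (hb : s.nat i₀ = b) (hk' : k' < R) (ha' : a < n) (hb' : b < n ^ (l - 1)) :
    (scaledEntry k i₁ i₀).eval s = w ⟨k', hk'⟩ ⟨_, flat_lt hl ha' hb'⟩ := by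
  simp only [scaledEntry, RExp.eval, NExp.eval, hk, ha, hb, henv.reg2, henv.reg3]
  exact h6 ⟨_, flat_lt hl ha' hb'⟩ ⟨k', hk'⟩

set_option maxHeartbeats 800000 in
theorem Runs.detectorTable {S : ℕ} {s : State} {w : Fin R → EuclideanSpace ℝ (Fin (n ^ l))}
    (hS : 1 ≤ S) (hRS : R ≤ S) (hnS : n ≤ S) (hN₁S : n ^ (l - 1) ≤ S) (hl : 1 ≤ l)
    (henv : Env n l R s) (h6 : IsMat s.real 6 (Matrix.of fun x k => w k x)) :
    Runs RealRAM.detectorTable s (timeBound S 800) fun s' => Frame 10 {7} s s' ∧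
      IsMat s'.real 7 (detectorRows w) := by
  set f : ℕ → ℝ := fun a => if h : a < (R * R) * (n ^ l * n ^ l) then
    detectorRows w (finProdFinEquiv.symm ⟨a, h⟩).1 (finProdFinEquiv.symm ⟨a, h⟩).2 else 0 with hf
  have hfv : ∀ (p : Fin (R * R)) (z : Fin (n ^ l * n ^ l)),
      f (p * (n ^ l * n ^ l) + z) = detectorRows w p z := by
    intro p z
    have h1 : p.val * (n ^ l * n ^ l) + z.val = (finProdFinEquiv (p, z)).val := by
      simp [finProdFinEquiv, add_comm, mul_comm]
    simp only [hf]
    rw [dif_pos (by rw [h1]; exact Fin.is_lt _)]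
    have h2 : ∀ h, (⟨p.val * (n ^ l * n ^ l) + z.val, h⟩ : Fin ((R * R) * (n ^ l * n ^ l))) =
        finProdFinEquiv (p, z) := fun h => Fin.ext h1
    rw [h2, Equiv.symm_apply_apply]
  have hidx : ∀ {m m' : ℕ} (a : Fin m) (b : Fin m'), (finProdFinEquiv (a, b)).val = a * m' + b := by
    intro m m' a b
    simp [finProdFinEquiv, add_comm, mul_comm]
  have hfaddr : ∀ k j i₁ i₀ j₁ j₀, (hk : k < R) → (hj : j < R) → (hi₁ : i₁ < n) →
      (hi₀ : i₀ < n ^ (l - 1)) → (hj₁ : j₁ < n) → (hj₀ : j₀ < n ^ (l - 1)) →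
      f (detectorAddr n l R k j i₁ i₀ j₁ j₀) = detectorBilin l n (w ⟨k, hk⟩) (w ⟨j, hj⟩)
        (⟨_, flat_lt hl hi₁ hi₀⟩, ⟨_, flat_lt hl hj₁ hj₀⟩) := by
    intro k j i₁ i₀ j₁ j₀ hk hj hi₁ hi₀ hj₁ hj₀
    have h1 := hfv (finProdFinEquiv (⟨k, hk⟩, ⟨j, hj⟩))
      (finProdFinEquiv (⟨_, flat_lt hl hi₁ hi₀⟩, ⟨_, flat_lt hl hj₁ hj₀⟩))
    rw [hidx, hidx] at h1
    refine h1.trans ?_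
    rw [detectorRows, Matrix.of_apply, Equiv.symm_apply_apply, Equiv.symm_apply_apply]
  have henv' : ∀ {d : ℕ} {s'}, Frame d {7} s s' → 10 ≤ d → Env n l R s' :=
    fun h hd => henv.frame h (by omega)
  -- The address set is a sixfold existential; each of the six nested loops removes one quantifier.
  refine (Runs.forFill (x := 10) (e := .var 2) (c := 700) (A := {7}) (a := 7) (f := f)
    (D' := {a | ∃ k < R, ∃ j < R, ∃ i₁ < n, ∃ i₀ < n ^ (l - 1), ∃ j₁ < n, ∃ j₀ < n ^ (l - 1),
      a = detectorAddr n l R k j i₁ i₀ j₁ j₀})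
    (fun k => {a | ∃ j < R, ∃ i₁ < n, ∃ i₀ < n ^ (l - 1), ∃ j₁ < n, ∃ j₀ < n ^ (l - 1),
      a = detectorAddr n l R k j i₁ i₀ j₁ j₀}) hS hRS (by simp [NExp.cost])
    (fun s' h => (henv' h le_rfl).reg2) (by rintro a ⟨k, hk, h⟩; exact ⟨k, hk, h⟩) ?_).imp ?_
  · intro k s1 hk hx1 hF1
    refine Runs.forFill (c := 600)
      (fun j => {a | ∃ i₁ < n, ∃ i₀ < n ^ (l - 1), ∃ j₁ < n, ∃ j₀ < n ^ (l - 1),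
        a = detectorAddr n l R k j i₁ i₀ j₁ j₀}) hS hRS (by simp [NExp.cost])
      (fun s' h => (henv' (hF1.trans (h.anti (by norm_num))) le_rfl).reg2)
      (by rintro a ⟨k, hk, h⟩; exact ⟨k, hk, h⟩) ?_
    intro j s2 hj hx2 hF2
    have hF12 := hF1.trans (hF2.anti (by norm_num))
    refine Runs.forFill (c := 500)
      (fun i₁ => {a | ∃ i₀ < n ^ (l - 1), ∃ j₁ < n, ∃ j₀ < n ^ (l - 1),
        a = detectorAddr n l R k j i₁ i₀ j₁ j₀}) hS hnS (by simp [NExp.cost])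
      (fun s' h => (henv' (hF12.trans (h.anti (by norm_num))) le_rfl).reg0)
      (by rintro a ⟨k, hk, h⟩; exact ⟨k, hk, h⟩) ?_
    intro i₁ s3 hi₁ hx3 hF3
    have hF13 := hF12.trans (hF3.anti (by norm_num))
    refine Runs.forFill (c := 400)
      (fun i₀ => {a | ∃ j₁ < n, ∃ j₀ < n ^ (l - 1),
        a = detectorAddr n l R k j i₁ i₀ j₁ j₀}) hS hN₁S (by simp [NExp.cost])
      (fun s' h => (henv' (hF13.trans (h.anti (by norm_num))) le_rfl).reg3)
      (by rintro a ⟨k, hk, h⟩; exact ⟨k, hk, h⟩) ?_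
    intro i₀ s4 hi₀ hx4 hF4
    have hF14 := hF13.trans (hF4.anti (by norm_num))
    refine Runs.forFill (c := 300)
      (fun j₁ => {a | ∃ j₀ < n ^ (l - 1),
        a = detectorAddr n l R k j i₁ i₀ j₁ j₀}) hS hnS (by simp [NExp.cost])
      (fun s' h => (henv' (hF14.trans (h.anti (by norm_num))) le_rfl).reg0)
      (by rintro a ⟨k, hk, h⟩; exact ⟨k, hk, h⟩) ?_
    intro j₁ s5 hj₁ hx5 hF5
    have hF15 := hF14.trans (hF5.anti (by norm_num))
    refine Runs.forFill (c := 200)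
      (fun j₀ => {detectorAddr n l R k j i₁ i₀ j₁ j₀}) hS hN₁S (by simp [NExp.cost])
      (fun s' h => (henv' (hF15.trans (h.anti (by norm_num))) le_rfl).reg3)
      (by rintro a ⟨k, hk, h⟩; exact ⟨k, hk, h⟩) ?_
    intro j₀ s6 hj₀ hx6 hF6
    have hF16 := hF15.trans (hF6.anti (by norm_num))
    have henv6 := henv' hF16 le_rfl
    have h66 := h6.frame hF16 (by simp)
    have y5 := (hF6.1 14 (by norm_num)).trans hx5
    have y4 := (hF6.1 13 (by norm_num)).trans ((hF5.1 13 (by norm_num)).trans hx4)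
    have y3 := (hF6.1 12 (by norm_num)).trans ((hF5.1 12 (by norm_num)).trans
      ((hF4.1 12 (by norm_num)).trans hx3))
    have y2 := (hF6.1 11 (by norm_num)).trans ((hF5.1 11 (by norm_num)).trans
      ((hF4.1 11 (by norm_num)).trans ((hF3.1 11 (by norm_num)).trans hx2)))
    have y1 := (hF6.1 10 (by norm_num)).trans ((hF5.1 10 (by norm_num)).trans
      ((hF4.1 10 (by norm_num)).trans ((hF3.1 10 (by norm_num)).trans
        ((hF2.1 10 (by norm_num)).trans hx1))))
    refine Runs.setReal hS (by simp [scaledEntry, RExp.cost, NExp.cost]) ?_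
    have haddr : NExp.eval s6 (.idx (.idx (.var 10) (.var 2) (.var 11)) (.mul (.var 4) (.var 4))
        (.idx (.idx (.var 12) (.var 3) (.var 13)) (.var 4) (.idx (.var 14) (.var 3) (.var 15)))) =
        detectorAddr n l R k j i₁ i₀ j₁ j₀ := by
      simp [NExp.eval, detectorAddr, y1, y2, y3, y4, y5, hx6, henv6.reg2, henv6.reg3, henv6.reg4]
    rw [haddr]
    refine Fills.write (by simp) ?_
    rw [hfaddr k j i₁ i₀ j₁ j₀ hk hj hi₁ hi₀ hj₁ hj₀, detectorBilin_apply_flat hl hi₁ hj₁ hi₀ hj₀]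
    simp only [RExp.eval]
    rw [scaledEntry_eval hl henv6 h66 y1 y3 y4 hk hi₁ hi₀,
      scaledEntry_eval hl henv6 h66 y2 y5 hx6 hj hj₁ hj₀,
      scaledEntry_eval hl henv6 h66 y1 y5 y4 hk hj₁ hi₀,
      scaledEntry_eval hl henv6 h66 y2 y3 hx6 hj hi₁ hj₀,
      scaledEntry_eval hl henv6 h66 y2 y3 y4 hj hi₁ hi₀,
      scaledEntry_eval hl henv6 h66 y1 y5 hx6 hk hj₁ hj₀,
      scaledEntry_eval hl henv6 h66 y2 y5 y4 hj hj₁ hi₀,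
      scaledEntry_eval hl henv6 h66 y1 y3 hx6 hk hi₁ hj₀]
  · rintro s' ⟨hF, h, -⟩
    refine ⟨hF, fun p z => ?_⟩
    rw [← hfv]
    obtain ⟨⟨k, j⟩, rfl⟩ := finProdFinEquiv.surjective p
    obtain ⟨⟨x, y⟩, rfl⟩ := finProdFinEquiv.surjective z
    refine h _ ⟨k, k.2, j, j.2, ?_⟩
    -- Every address x < n^l is x₁ n^{l-1} + x₀ with leading digit x₁ < n, so the loops reach the
    -- whole table.
    have hN : n ^ l = n ^ (l - 1) * n := by rw [← pow_succ]; congr 1; omega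
    have hlt : ∀ x : Fin (n ^ l), x.val / n ^ (l - 1) < n := fun x =>
      Nat.div_lt_of_lt_mul (hN ▸ x.2)
    have hpos : ∀ x : Fin (n ^ l), 0 < n ^ (l - 1) := fun x => by
      have := x.pos
      rw [hN] at this
      exact Nat.pos_of_mul_pos_right this
    have hdm : ∀ x : Fin (n ^ l), x.val / n ^ (l - 1) * n ^ (l - 1) + x.val % n ^ (l - 1) = x :=
      fun x => by rw [mul_comm]; exact Nat.div_add_mod _ _
    refine ⟨x / n ^ (l - 1), hlt x, x % n ^ (l - 1), Nat.mod_lt _ (hpos x), y / n ^ (l - 1), hlt y,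
      y % n ^ (l - 1), Nat.mod_lt _ (hpos x), ?_⟩
    rw [detectorAddr, hdm, hdm, hidx, hidx]

/-- Array `8` becomes the Gram matrix of the detector values. -/
def gramTable : Prog :=
  fillMat 13 8 (.mul (.var 2) (.var 2)) (.mul (.var 2) (.var 2)) (.mul (.var 4) (.var 4))
    (.mul (.get 7 (.idx (.var 13) (.mul (.var 4) (.var 4)) (.var 15)))
      (.get 7 (.idx (.var 14) (.mul (.var 4) (.var 4)) (.var 15))))

theorem Runs.gramTable {S : ℕ} {s : State} {w : Fin R → EuclideanSpace ℝ (Fin (n ^ l))}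
    (hS : 1 ≤ S) (hRS : R * R ≤ S) (hNS : n ^ l * n ^ l ≤ S)
    (henv : Env n l R s) (h7 : IsMat s.real 7 (detectorRows w)) :
    Runs RealRAM.gramTable s (timeBound S 600) fun s' => Frame 13 {20, 8} s s' ∧
      IsMat s'.real 8 (detectorGram w) := by
  have henv' := fun s' (h : Frame 13 {20, 8} s s') => henv.frame h (by norm_num)
  refine Runs.fillEntries (detectorGram w) (fun _ _ => n ^ l * n ^ l)
    (fun p p' z => if h : z < n ^ l * n ^ l then
      detectorRows w p ⟨z, h⟩ * detectorRows w p' ⟨z, h⟩ else 0) hS hRS hRS (fun _ _ => hNS)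
    ⟨by simp [NExp.cost], by simp [NExp.cost], by simp [NExp.cost], by simp [RExp.cost, NExp.cost],
      by norm_num⟩
    (fun s' h => by simp [NExp.eval, (henv' s' h).reg2])
    (fun s' h => by simp [NExp.eval, (henv' s' h).reg2])
    (fun _ _ s' h _ _ => by simp [NExp.eval, (henv' s' h).reg4]) ?_ ?_
  · intro p p' z s' hz hF h1 h2 h3
    have e1 := (h7.frame hF (by simp)) p ⟨z, hz⟩
    have e2 := (h7.frame hF (by simp)) p' ⟨z, hz⟩
    simp only [RExp.eval, NExp.eval, h1, h2, h3, (henv' s' hF).reg4, dif_pos hz]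
    rw [e1, e2]
  · intro p p'
    rw [Finset.sum_range, detectorGram, Matrix.of_apply, PiLp.inner_apply,
      ← Equiv.sum_comp finProdFinEquiv.symm]
    refine Finset.sum_congr rfl fun z _ => ?_
    simp [detectorRows, mul_comm]

/-! ### The scaled eigenvectors -/

/-- Arrays `4`, `5`, `6` become the eigenvalues, the eigenvectors, and the scaled leading eigenvectors
of array `0`. -/
def spectralTable : Prog :=
  .seq (.eig (.var 4) 0 4 5) (fillMat 13 6 (.var 4) (.var 2) (.const 1)
    (.mul (.root (.const 2) (.get 4 (.var 14))) (.get 5 (.idx (.var 13) (.var 4) (.var 14)))))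

theorem Runs.spectralTable {S : ℕ} {s : State} {M : Matrix (Fin (n ^ l)) (Fin (n ^ l)) ℝ}
    (hS : 1 ≤ S) (hRN : R ≤ n ^ l) (hNS : n ^ l ≤ S) (henv : Env n l R s)
    (h0 : IsMat s.real 0 M) :
    Runs RealRAM.spectralTable s (timeBound S 700) fun s' => Frame 13 {4, 5, 6, 20} s s' ∧
      IsMat s'.real 6 (Matrix.of fun x k => scaledEigvec M hRN k x) := by
  refine Runs.seq (b := 600) hS (Runs.eigMat (x := 13) hS hNS (by simp [NExp.cost]) (by norm_num)
    henv.reg4 h0) ?_ (by norm_num)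
  rintro s1 ⟨hF1, hw, hv⟩
  have henv1 := henv.frame hF1 (by norm_num)
  have henv1' := fun s' (h : Frame 13 {20, 6} s1 s') => henv1.frame h (by norm_num)
  refine (Runs.fillPointwise (r := .var 4) (d := .var 2) (Matrix.of fun x k => scaledEigvec M hRN k x)
    hS hNS (hRN.trans hNS)
    ⟨by simp [NExp.cost], by simp [NExp.cost], by simp [RExp.cost, NExp.cost], by norm_num⟩
    (fun s' h => (henv1' s' h).reg4) (fun s' h => (henv1' s' h).reg2) ?_).imp ?_
  · intro x k s' hF h1 h2
    have e1 := (hv.frame hF (by simp)) x (Fin.castLE hRN k)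
    have e2 : s'.real 4 k = symEigenvalue M (Fin.castLE hRN k) := by
      rw [hF.2 4 (by simp)]; exact hw (Fin.castLE hRN k)
    simp only [Fin.val_castLE] at e1
    simp only [RExp.eval, NExp.eval, h1, h2, (henv1' s' hF).reg4, e2, Matrix.of_apply, scaledEigvec,
      PiLp.smul_apply, smul_eq_mul, symBasis_apply]
    rw [e1, Real.sqrt_eq_rpow, Matrix.of_apply]
    -- The machine root and the real square root agree also on negative numbers, where both are 0.
    have : (max (symEigenvalue M (Fin.castLE hRN k)) 0) ^ (((2 : ℕ) : ℝ)⁻¹) =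
        (symEigenvalue M (Fin.castLE hRN k)) ^ (1 / 2 : ℝ) := by
      rw [← Real.sqrt_eq_rpow, Nat.cast_ofNat, ← one_div, ← Real.sqrt_eq_rpow]
      rcases le_total 0 (symEigenvalue M (Fin.castLE hRN k)) with h | h
      · rw [max_eq_left h]
      · rw [max_eq_right h, Real.sqrt_zero, Real.sqrt_eq_zero_of_nonpos h]
    rw [this]
  · rintro s2 ⟨hF2, h6⟩
    exact ⟨(hF1.weaken le_rfl (by intro y; simp; tauto)).trans
      (hF2.weaken le_rfl (by intro y; simp; tauto)), h6⟩

end RealRAM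

namespace RealRAM

variable {n l R : ℕ}

/-! ### The whole program -/

/-- Registers `3`, `4`, `5`, `6` become `n ^ (l - 1)`, `n ^ l`, `∑ i < l, n ^ i` and the number of
pairs; array `3` holds `R`, and array `25` the squared norm of the input tensor. -/
def prologue : Prog :=
  .seq (.setNat 4 (.const 1))
    (.seq (forN 10 (.var 1) (.seq (.setNat 5 (.add (.var 5) (.var 4)))
        (.seq (.setNat 3 (.var 4)) (.setNat 4 (.mul (.var 4) (.var 0))))))
      (.seq (forN 10 (.var 2) (.setNat 6 (.add (.var 6) (.var 10))))
        (.seq (setSum 3 (.const 0) 13 (.var 2) (.const 1))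
          (setSum 25 (.const 0) 13 (.mul (.var 4) (.var 4)) (.mul (.get 0 (.var 13)) (.get 0 (.var 13)))))))

theorem Runs.prologue {S : ℕ} {s : State} (hS : 1 ≤ S) (hlS : l ≤ S) (hRS : R ≤ S)
    (hNS : n ^ l * n ^ l ≤ S) (hl : 1 ≤ l) (h0 : s.nat 0 = n) (h1 : s.nat 1 = l) (h2 : s.nat 2 = R)
    (hz : ∀ x, 3 ≤ x → s.nat x = 0) :
    Runs RealRAM.prologue s (timeBound S 2000) fun s' => Env n l R s' ∧ s'.real 0 = s.real 0 ∧
      s'.real 1 = s.real 1 ∧ s'.real 2 = s.real 2 ∧ s'.real 3 0 = R ∧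
      s'.real 25 0 = ∑ p ∈ Finset.range (n ^ l * n ^ l), s.real 0 p * s.real 0 p := by
  refine Runs.seq (a := 1) (b := 1900) hS (Q' := fun s' => s'.nat 0 = n ∧ s'.nat 1 = l ∧
    s'.nat 2 = R ∧ s'.nat 4 = 1 ∧ s'.nat 5 = 0 ∧ s'.nat 6 = 0 ∧ s'.real = s.real) ?_ ?_ (by norm_num)
  · refine Runs.setNat hS (by simp [NExp.cost]) ?_
    simp [NExp.eval, h0, h1, h2, hz]
  rintro s1 ⟨h10, h11, h12, h14, h15, h16, h1r⟩
  refine Runs.seq (a := 200) (b := 1600) hS (Q' := fun s' => s'.nat 0 = n ∧ s'.nat 2 = R ∧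
    s'.nat 1 = l ∧ s'.nat 3 = n ^ (l - 1) ∧ s'.nat 4 = n ^ l ∧
    s'.nat 5 = ∑ i ∈ Finset.range l, n ^ i ∧ s'.nat 6 = 0 ∧ s'.real = s.real) ?_ ?_ (by norm_num)
  · refine (Runs.forN (x := 10) (e := .var 1) (c := 20) hS hlS (by simp [NExp.cost]) (fun i s' =>
      s'.nat 0 = n ∧ s'.nat 2 = R ∧
      s'.nat 1 = l ∧ (1 ≤ i → s'.nat 3 = n ^ (i - 1)) ∧ s'.nat 4 = n ^ i ∧
      s'.nat 5 = ∑ i ∈ Finset.range i, n ^ i ∧ s'.nat 6 = 0 ∧ s'.real = s.real) ?_ ?_ ?_ ?_).timeLe hS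
      (by norm_num)
    · simp [State.setReg, h10, h11, h12, h14, h15, h16, h1r]
    · rintro i s' - h -; exact h.2.2.1
    · rintro i s' - ⟨g0, g2, g1, g3, g4, g5, g6, gr⟩ hx
      refine Runs.seq (a := 5) (b := 12) hS (Q' := fun s'' => s''.nat 0 = n ∧ s''.nat 2 = R ∧
        s''.nat 1 = l ∧ s''.nat 4 = n ^ i ∧ s''.nat 5 = ∑ i ∈ Finset.range (i + 1), n ^ i ∧
        s''.nat 6 = 0 ∧ s''.real = s.real ∧ s''.nat 10 = i) ?_ ?_ (by norm_num)
      · refine Runs.setNat hS (by simp [NExp.cost]) ?_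
        simp [NExp.eval, g0, g1, g2, g4, g5, g6, gr, hx, Finset.sum_range_succ]
      rintro s'' ⟨k0, k2, k1, k4, k5, k6, kr, k10⟩
      refine Runs.seq (a := 5) (b := 5) hS (Q' := fun s'' => s''.nat 0 = n ∧ s''.nat 2 = R ∧
        s''.nat 1 = l ∧ s''.nat 3 = n ^ i ∧ s''.nat 4 = n ^ i ∧
        s''.nat 5 = ∑ i ∈ Finset.range (i + 1), n ^ i ∧
        s''.nat 6 = 0 ∧ s''.real = s.real ∧ s''.nat 10 = i) ?_ ?_ (by norm_num)
      · refine Runs.setNat hS (by simp [NExp.cost]) ?_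
        simp [NExp.eval, k0, k1, k2, k4, k5, k6, kr, k10]
      rintro s3 ⟨m0, m2, m1, m3, m4, m5, m6, mr, m10⟩
      refine Runs.setNat hS (by simp [NExp.cost]) ?_
      simp [NExp.eval, State.setReg, m0, m1, m2, m3, m4, m5, m6, mr, m10, pow_succ]
    · rintro s' ⟨g0, g2, g1, g3, g4, g5, g6, gr⟩ -
      exact ⟨g0, g2, g1, g3 hl, g4, g5, g6, gr⟩
  rintro s2 ⟨g0, g2, g1, g3, g4, g5, g6, gr⟩
  refine Runs.seq (a := 150) (b := 1400) hS (Q' := fun s' => Env n l R s' ∧ s'.real = s.real) ?_ ?_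
    (by norm_num)
  · refine (Runs.forN (x := 10) (e := .var 2) (c := 10) hS hRS (by simp [NExp.cost]) (fun i s' =>
      s'.nat 0 = n ∧ s'.nat 2 = R ∧
      s'.nat 1 = l ∧ s'.nat 3 = n ^ (l - 1) ∧ s'.nat 4 = n ^ l ∧
      s'.nat 5 = ∑ i ∈ Finset.range l, n ^ i ∧ s'.nat 6 = ∑ i ∈ Finset.range i, i ∧ s'.real = s.real)
      ?_ ?_ ?_ ?_).timeLe hS (by norm_num)
    · simp [State.setReg, g0, g1, g2, g3, g4, g5, g6, gr]
    · rintro i s' - h -; exact h.2.1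
    · rintro i s' - ⟨k0, k2, k1, k3, k4, k5, k6, kr⟩ hx
      refine Runs.setNat hS (by simp [NExp.cost]) ?_
      simp [NExp.eval, State.setReg, k0, k1, k2, k3, k4, k5, k6, kr, hx, Finset.sum_range_succ]
    · rintro s' ⟨k0, k2, k1, k3, k4, k5, k6, kr⟩ -
      exact ⟨⟨k0, k1, k2, k3, k4, k5, k6⟩, kr⟩
  rintro s3 ⟨henv, hr⟩
  have sumOne : (R : ℝ) = ∑ k ∈ Finset.range R, (1 : ℝ) := by simp
  refine Runs.seq (a := 400) (b := 400) hS (Runs.setSum (S := S) (M := R) (p := 0)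
    (A := {3, 20}) (f := fun _ => (R : ℝ)) (fun _ => 1) hS hRS (by simp [NExp.cost])
    (by simp [NExp.cost]) (by simp [RExp.cost]) (by simp) (by simp) (by norm_num)
    (fun s' hF => (henv.frame hF (by norm_num)).reg2) (fun _ _ => rfl)
    (fun _ _ _ _ _ => by simp [RExp.eval]) sumOne) ?_ (by norm_num)
  rintro s4 ⟨hF4, h4, -⟩
  have henv4 := henv.frame hF4 (by norm_num)
  have hT : s4.real 0 = s.real 0 := by rw [hF4.2 0 (by simp), hr]
  refine (Runs.setSum (a := 25) (S := S) (M := n ^ l * n ^ l) (p := 0)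
    (A := {25, 20}) (f := fun _ => ∑ p ∈ Finset.range (n ^ l * n ^ l), s.real 0 p * s.real 0 p)
    (fun p => s.real 0 p * s.real 0 p) hS hNS (by simp [NExp.cost])
    (by simp [NExp.cost]) (by simp [RExp.cost, NExp.cost]) (by simp) (by simp) (by norm_num)
    ?_ (fun _ _ => rfl) ?_ rfl).imp ?_
  · intro s' hF; simp [NExp.eval, (henv4.frame hF (by norm_num)).reg4]
  · intro k s' _ hF hz; simp [RExp.eval, NExp.eval, hz, hF.2 0 (by simp), hT]
  · rintro s5 ⟨hF5, h5, -⟩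
    refine ⟨henv4.frame hF5 (by norm_num), ?_, ?_, ?_, ?_, h5 0 rfl⟩
    · rw [hF5.2 0 (by simp), hT]
    · rw [hF5.2 1 (by simp), hF4.2 1 (by simp), hr]
    · rw [hF5.2 2 (by simp), hF4.2 2 (by simp), hr]
    · rw [hF5.2 3 (by simp)]; exact h4 0 rfl

/-- The computation for a tensor which is not small. -/
def mainStage : Prog :=
  .seq spectralTable (.seq detectorTable (.seq gramTable
    (.seq (.eig (.mul (.var 2) (.var 2)) 8 9 10) (.seq (identMat 11) (forN 10 (.var 2) pass)))))

/-- The test for small tensors, whose components may be replaced by zero. -/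
def smallTest : Test :=
  .rlt (.mul (.mul (.const 2) (.get 3 (.const 0))) (.root (.mul (.const 4) (.var 1)) (.get 25 (.const 0))))
    (.get 1 (.const 0))

/-- The decomposition algorithm. -/
def decompose : Prog :=
  .ite (.nlt (.var 0) (.const 2))
    (.setReal 2 (.const 0) (.root (.mul (.const 2) (.var 1)) (.get 0 (.const 0))))
    (.seq prologue (.ite smallTest .skip mainStage))

theorem isMat_initState (T : Tensor (2 * l) n) (ε γ : ℝ) (ω : ℕ → ℝ) :
    IsMat (initState R T ε γ ω).real 0 (flatMat T) := by
  intro i j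
  simp [initState, flatMat_apply, flat_index_lt i j]

theorem sum_initState_sq (T : Tensor (2 * l) n) (ε γ : ℝ) (ω : ℕ → ℝ) :
    ∑ p ∈ Finset.range (n ^ l * n ^ l), (initState R T ε γ ω).real 0 p *
      (initState R T ε γ ω).real 0 p = frobNorm T ^ 2 := by
  rw [sum_range_sq_eq_entrySq (isMat_initState T ε γ ω), ← sum_flatMat_sq, entrySq]

theorem Runs.mainStage {S : ℕ} {s : State} (hS : 1 ≤ S) (hn : 2 ≤ n) (hl : 2 ≤ l) (hR : R ≠ 0)
    (hNS : n ^ l * n ^ l ≤ S)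
    (A : Fin R → EuclideanSpace ℝ (Fin n)) (Err : Tensor (2 * l) n)
    (hU : condNumber (khatriRaoPow l A) ≠ ⊤) (hM : condNumber (detectorMatrix l A) ≠ ⊤)
    {ε : ℝ} (hε : 0 < ε) (hErr : frobNorm Err ≤ ε ^ (2 * l) /
      (n * (condNumber (khatriRaoPow l A)).toReal * (condNumber (detectorMatrix l A)).toReal) ^
        lossExponent l)
    (hbig : ε ≤ 2 * R * (frobNorm (momentTensor (2 * l) A + Err) ^ 2) ^ (((4 * l : ℕ) : ℝ)⁻¹))
    (henv : Env n l R s) (hr : s.real 3 0 = R)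
    (h0 : IsMat s.real 0 (flatMat (momentTensor (2 * l) A + Err))) :
    Runs RealRAM.mainStage s (timeBound S 12000) fun s' => CloseUpToPermSign A (output s' n R) ε := by
  obtain ⟨hRN, q, δ, d, e, hJ, hread⟩ :=
    exists_nearlyJointlyDiagonal hn hl hR A Err hU hM hε hErr hbig
  set w := scaledEigvec (flatMat (momentTensor (2 * l) A + Err)) hRN with hw
  have hN1 : 1 ≤ n ^ l := Nat.one_le_pow _ _ (by omega)
  have hNS1 : n ^ l ≤ S := (Nat.le_mul_self _).trans hNS
  have hRS : R * R ≤ S := (Nat.mul_le_mul hRN hRN).trans hNS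
  have hRS1 : R ≤ S := hRN.trans hNS1
  have hnS : n ≤ S := (Nat.le_self_pow (by omega) n).trans hNS1
  have hN₁S : n ^ (l - 1) ≤ S := (Nat.pow_le_pow_right (by omega) (Nat.sub_le _ _)).trans hNS1
  refine Runs.seq (b := 11200) hS (Runs.spectralTable hS hRN hNS1 henv h0) ?_ (by norm_num)
  rintro s1 ⟨hF1, h61⟩
  have henv1 := henv.frame hF1 (by norm_num)
  have hr1 : s1.real 3 0 = R := by rw [hF1.2 3 (by simp)]; exact hr
  refine Runs.seq (b := 10390) hS (Runs.detectorTable hS hRS1 hnS hN₁S (by omega) henv1 h61) ?_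
    (by norm_num)
  rintro s2 ⟨hF2, h72⟩
  have henv2 := henv1.frame hF2 (by norm_num)
  have hr2 : s2.real 3 0 = R := by rw [hF2.2 3 (by simp)]; exact hr1
  have h62 := h61.frame hF2 (by simp)
  refine Runs.seq (b := 9780) hS (Runs.gramTable hS hRS hNS henv2 h72) ?_ (by norm_num)
  rintro s3 ⟨hF3, h83⟩
  have henv3 := henv2.frame hF3 (by norm_num)
  have hr3 : s3.real 3 0 = R := by rw [hF3.2 3 (by simp)]; exact hr2
  have h63 := h62.frame hF3 (by simp)
  refine Runs.seq (b := 9720) hS (Runs.eigMat (x := 13) hS hRS (by simp [NExp.cost]) (by norm_num)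
    (by simp [NExp.eval, henv3.reg2]) h83) ?_ (by norm_num)
  rintro s4 ⟨hF4, -, h104⟩
  have henv4 := henv3.frame hF4 (by norm_num)
  have hr4 : s4.real 3 0 = R := by rw [hF4.2 3 (by simp)]; exact hr3
  have h64 := h63.frame hF4 (by simp)
  refine Runs.seq (b := 9100) hS (Runs.identMat hS hRS1 (by norm_num) henv4.reg2) ?_ (by norm_num)
  rintro s5 ⟨hF5, h115⟩
  have henv5 := henv4.frame hF5 (by norm_num)
  have hr5 : s5.real 3 0 = R := by rw [hF5.2 3 (by simp)]; exact hr4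
  refine (Runs.passes hS hRS hNS1 hnS (by omega) (by omega) hR henv5 hr5 (h64.frame hF5 (by simp))
    (h104.frame hF5 (by simp)) hJ h115).imp ?_
  rintro s6 ⟨f, hf, hrows⟩
  exact closeUpToPermSign_of_isRow hε hread hf hrows

/-- Roots of nearby numbers are close. -/
theorem abs_abs_sub_root_le {a x ε : ℝ} {L : ℕ} (hL : L ≠ 0) (hε : 0 ≤ ε)
    (h : |x - |a| ^ L| ≤ ε ^ L) : |(|a| - (max x 0) ^ ((L : ℝ)⁻¹))| ≤ ε := by
  set y := (max x 0) ^ ((L : ℝ)⁻¹) with hy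
  have hy0 : 0 ≤ y := by positivity
  have hyL : y ^ L = max x 0 := Real.rpow_inv_natCast_pow (le_max_right _ _) hL
  have hsup : ∀ u v : ℝ, 0 ≤ u → 0 ≤ v → u ^ L + v ^ L ≤ (u + v) ^ L := fun u v hu hv =>
    pow_add_pow_le hu hv hL
  rw [abs_le] at h ⊢
  constructor
  · have : y ≤ |a| + ε := by
      refine le_of_pow_le_pow_left₀ (n := L) hL (by positivity) ?_
      refine le_trans ?_ (hsup _ _ (abs_nonneg a) hε)
      rw [hyL]
      refine max_le (by linarith) (by positivity)
    linarith
  · have : |a| ≤ y + ε := by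
      refine le_of_pow_le_pow_left₀ (n := L) hL (by positivity) ?_
      refine le_trans ?_ (hsup _ _ hy0 hε)
      rw [hyL]
      have := le_max_left x 0
      linarith
    linarith

theorem closeUpToPermSign_of_card_eq_zero (hR : R = 0) (A B : Fin R → EuclideanSpace ℝ (Fin n))
    {ε : ℝ} (hε : 0 < ε) : CloseUpToPermSign A B ε := by
  subst hR
  exact ⟨1, fun _ => 1, fun _ => .inl rfl, by simpa using hε.le⟩

theorem card_le_pow (hl : 2 ≤ l) (A : Fin R → EuclideanSpace ℝ (Fin n))
    (hU : condNumber (khatriRaoPow l A) ≠ ⊤) (hM : condNumber (detectorMatrix l A) ≠ ⊤) :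
    R ≤ n ^ l := by
  rcases Nat.eq_zero_or_pos R with rfl | hR
  · exact Nat.zero_le _
  · obtain ⟨σ, -, -, -, -, h⟩ := exists_stretch_of_condNumber hl hR.ne' A hU hM
    exact h

/-- In dimension one the problem is the extraction of a root. -/
theorem closeUpToPermSign_of_dim_one (hl : 2 ≤ l) (hR : R ≤ 1) (A : Fin R → EuclideanSpace ℝ (Fin 1))
    (Err : Tensor (2 * l) 1) {ε : ℝ} (hε : 0 < ε) (hErr : frobNorm Err ≤ ε ^ (2 * l)) {s : State}
    (hs : s.real 2 0 = (max ((momentTensor (2 * l) A + Err) fun _ => 0) 0) ^ (((2 * l : ℕ) : ℝ)⁻¹)) :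
    CloseUpToPermSign A (output s 1 R) ε := by
  rcases Nat.eq_zero_or_pos R with hR0 | hR0
  · exact closeUpToPermSign_of_card_eq_zero hR0 _ _ hε
  obtain rfl : R = 1 := by omega
  have he : |Err fun _ => 0| ≤ frobNorm Err := by
    rw [frobNorm, ← Real.sqrt_sq_eq_abs]
    exact Real.sqrt_le_sqrt (Finset.single_le_sum (f := fun I => Err I ^ 2)
      (fun _ _ => sq_nonneg _) (Finset.mem_univ _))
  set a := A 0 0 with ha
  have hx : (momentTensor (2 * l) A + Err) (fun _ => 0) = |a| ^ (2 * l) + Err fun _ => 0 := by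
    rw [Even.pow_abs (by simp)]
    simp [momentTensor, tensorPow, ha]
  have habs := abs_abs_sub_root_le (a := a) (x := (momentTensor (2 * l) A + Err) fun _ => 0)
    (L := 2 * l) (by omega) hε.le (by rw [hx, add_sub_cancel_left]; exact he.trans hErr)
  rw [← hs] at habs
  have hnorm : ∀ v : EuclideanSpace ℝ (Fin 1), ‖v‖ = |v 0| := by
    intro v; rw [EuclideanSpace.norm_eq]; simp [Real.sqrt_sq_eq_abs]
  have hout : output s 1 1 0 0 = s.real 2 0 := by simp [output]
  refine ⟨1, fun _ => if 0 ≤ a then 1 else -1, fun _ => by split_ifs <;> simp, ?_⟩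
  rw [Fin.sum_univ_one, hnorm]
  simp only [PiLp.sub_apply, PiLp.smul_apply, Equiv.Perm.one_apply, hout, smul_eq_mul, ← ha]
  split_ifs with h
  · rwa [abs_of_nonneg h, ← one_mul (s.real 2 0)] at habs
  · rw [abs_of_neg (not_le.1 h)] at habs
    rw [← abs_neg]
    convert habs using 2
    ring

/-- Three cases: in dimension at most one a single root suffices; for a small tensor the untouched
output array already holds an admissible answer, zero; otherwise the main stage runs, where the
failed test bounds ε from above. -/
theorem Runs.decompose {S : ℕ} (hS : 1 ≤ S) (hl : 2 ≤ l) (hlS : l ≤ S)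
    (hNS : n ^ l * n ^ l ≤ S)
    (A : Fin R → EuclideanSpace ℝ (Fin n)) (Err : Tensor (2 * l) n)
    (hU : condNumber (khatriRaoPow l A) ≠ ⊤) (hM : condNumber (detectorMatrix l A) ≠ ⊤)
    {ε : ℝ} (hε : 0 < ε) (hErr : frobNorm Err ≤ ε ^ (2 * l) /
      (n * (condNumber (khatriRaoPow l A)).toReal * (condNumber (detectorMatrix l A)).toReal) ^
        lossExponent l) (γ : ℝ) (ω : ℕ → ℝ) :
    Runs RealRAM.decompose (initState R (momentTensor (2 * l) A + Err) ε γ ω) (timeBound S 15000)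
      fun s' => CloseUpToPermSign A (output s' n R) ε := by
  set T := momentTensor (2 * l) A + Err with hT
  set s := initState R T ε γ ω with hs
  have hRN := card_le_pow hl A hU hM
  have hκ := one_le_condNumber_toReal _ hU
  have hκM := one_le_condNumber_toReal _ hM
  have hs0 : s.nat 0 = n := by simp [hs, initState]
  have hs1 : s.nat 1 = l := by simp [hs, initState]
  have hs2 : s.nat 2 = R := by simp [hs, initState]
  refine Runs.ite (c := 14500) hS ?_ ?_ (by simp [Test.cost, NExp.cost])
  · intro hlt
    have hn : n < 2 := by simpa [Test.Holds, NExp.eval, hs0] using hlt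
    refine Runs.setReal hS (by simp [RExp.cost, NExp.cost]) ?_
    rcases Nat.eq_zero_or_pos n with hn0 | hn0
    · refine closeUpToPermSign_of_card_eq_zero ?_ _ _ hε
      rw [hn0, zero_pow (by omega)] at hRN
      omega
    obtain rfl : n = 1 := by omega
    refine closeUpToPermSign_of_dim_one hl (by simpa using hRN) A Err hε (hErr.trans ?_) ?_
    · refine div_le_self (by positivity) (one_le_pow₀ ?_)
      rw [Nat.cast_one, one_mul]
      exact one_le_mul_of_one_le_of_one_le hκ hκM
    · have e1 : s.real 0 0 = T fun _ => 0 := by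
        simp only [hs, initState, if_true]
        rw [dif_pos (by simp)]
        exact congrArg T (Subsingleton.elim _ _)
      rw [State.write_real]
      simp [NExp.eval, RExp.eval, e1, hs1, hT]
  · intro hlt
    have hn : 2 ≤ n := by
      have : 1 < n := by simpa [Test.Holds, NExp.eval, hs0] using hlt
      omega
    have hNS1 : n ^ l ≤ S := (Nat.le_mul_self _).trans hNS
    refine Runs.seq (b := 12400) hS (Runs.prologue hS hlS (hRN.trans hNS1) hNS (by omega) hs0 hs1 hs2
      ?_) ?_ (by norm_num)
    · intro x hx
      simp [hs, initState, show x ≠ 0 by omega, show x ≠ 1 by omega, show x ≠ 2 by omega]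
    rintro s1 ⟨henv, h0, h1, h2, h3, h25⟩
    rw [hs, sum_initState_sq T ε γ ω] at h25
    have e1 : s1.real 1 0 = ε := by rw [h1]; simp [hs, initState]
    have htest : smallTest.Holds s1 ↔
        2 * R * (frobNorm T ^ 2) ^ (((4 * l : ℕ) : ℝ)⁻¹) < ε := by
      simp only [smallTest, Test.Holds, RExp.eval, NExp.eval, h3, h25, e1, henv.reg1,
        max_eq_left (sq_nonneg (frobNorm T))]
      norm_num
    refine Runs.ite (c := 12000) hS ?_ ?_ (by simp [smallTest, Test.cost, RExp.cost, NExp.cost])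
    · intro hsmall
      refine (Runs.skip hS ?_).timeLe hS (by norm_num)
      rcases Nat.eq_zero_or_pos R with hR0 | hR0
      · exact closeUpToPermSign_of_card_eq_zero hR0 _ _ hε
      have hout : ∀ i, output s1 n R i = 0 := by
        intro i
        ext j
        simp [output, h2, hs, initState]
      refine ⟨1, fun _ => 1, fun _ => .inl rfl, ?_⟩
      simp only [hout, smul_zero, sub_zero]
      exact sum_norm_le_of_small hn hl hR0.ne' hRN A Err hκ hκM hε hErr (htest.1 hsmall).le
    · intro hsmall
      have hbig := not_lt.1 (mt htest.2 hsmall)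
      -- For R = 0 the test for small tensors succeeds, its left side being 0.
      have hR0 : R ≠ 0 := by
        rintro rfl
        simp only [Nat.cast_zero, mul_zero, zero_mul] at hbig
        linarith
      exact Runs.mainStage hS hn hl hR0 hNS A Err hU hM hε hErr hbig henv h3
        ((isMat_initState T ε γ ω).congr h0)

end RealRAM

end

/-! ### The main theorem -/

theorem mainTheorem7 :
    ∃ (alg : RealRAM.Prog) (C k : ℕ),
      ∀ l : ℕ, 2 ≤ l →
        ∃ c c' : ℝ, 0 < c ∧ 0 < c' ∧
          ∀ (n R : ℕ) (A : Fin R → EuclideanSpace ℝ (Fin n)) (Err T : Tensor (2 * l) n)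
            (ε γ : ℝ), 0 < ε → 0 < γ → γ < 1 →
            condNumber (khatriRaoPow l A) ≠ ⊤ →
            condNumber (detectorMatrix l A) ≠ ⊤ →
            T = momentTensor (2 * l) A + Err →
            frobNorm Err ≤ ε ^ c /
              (n * (condNumber (khatriRaoPow l A)).toReal
                * (condNumber (detectorMatrix l A)).toReal) ^ c' →
            (∀ ω : ℕ → ℝ, ∃ (s : RealRAM.State) (t : ℕ),
              RealRAM.Exec alg (RealRAM.initState R T ε γ ω) s t ∧
              (t : ℝ) ≤ C * (l + (n : ℝ) ^ l + (condNumber (khatriRaoPow l A)).toReal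
                + (condNumber (detectorMatrix l A)).toReal + Real.log (1 / γ)) ^ k) ∧
            RealRAM.gaussianTape {ω : ℕ → ℝ | ¬ ∃ (s : RealRAM.State) (t : ℕ),
              RealRAM.Exec alg (RealRAM.initState R T ε γ ω) s t ∧
              CloseUpToPermSign A (RealRAM.output s n R) ε} ≤ ENNReal.ofReal γ := by
  -- `timeBound S 15000` is 15001^15001 · S^15001, and S = l + n^{2l} is at most the square of the
  -- base of the claimed bound; hence the doubled exponent.
  refine ⟨RealRAM.decompose, 15001 ^ 15001, 2 * 15001, fun l hl =>
    ⟨(2 * l : ℕ), lossExponent l, ?_, ?_, ?_⟩⟩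
  · exact_mod_cast (show 0 < 2 * l by omega)
  · exact_mod_cast (show 0 < lossExponent l by unfold lossExponent; omega)
  intro n R A Err T ε γ hε hγ hγ1 hU hM hT hErr
  subst hT
  rw [Real.rpow_natCast, Real.rpow_natCast] at hErr
  set S : ℕ := l + n ^ l * n ^ l with hS
  have hrun := fun ω => RealRAM.Runs.decompose (n := n) (R := R) (S := S) (by omega) hl
    (by omega) (by omega) A Err hU hM hε hErr γ ω
  constructor
  · intro ω
    obtain ⟨s, t, h1, h2, -⟩ := hrun ω
    refine ⟨s, t, h1, ?_⟩
    have hκ := one_le_condNumber_toReal _ hU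
    have hκM := one_le_condNumber_toReal _ hM
    have hlog : 0 ≤ Real.log (1 / γ) := Real.log_nonneg (by rw [le_div_iff₀ hγ]; linarith)
    set b : ℝ := l + (n : ℝ) ^ l + (condNumber (khatriRaoPow l A)).toReal
                + (condNumber (detectorMatrix l A)).toReal + Real.log (1 / γ) with hb
    have hl2 : (2 : ℝ) ≤ l := by exact_mod_cast hl
    have hN0 : (0 : ℝ) ≤ (n : ℝ) ^ l := by positivity
    have hSb : (S : ℝ) ≤ b ^ 2 := by
      have h3 : (l : ℝ) + (n : ℝ) ^ l ≤ b := by rw [hb]; linarith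
      have h4 : ((l : ℝ) + (n : ℝ) ^ l) ^ 2 ≤ b ^ 2 := pow_le_pow_left₀ (by positivity) h3 2
      refine le_trans ?_ h4
      rw [hS]; push_cast
      nlinarith
    calc (t : ℝ) ≤ (RealRAM.timeBound S 15000 : ℕ) := by exact_mod_cast h2
      _ = ((15001 : ℕ) : ℝ) ^ 15001 * (S : ℝ) ^ 15001 := by
          rw [RealRAM.timeBound, ← mul_pow]; push_cast; rfl
      _ ≤ ((15001 : ℕ) : ℝ) ^ 15001 * (b ^ 2) ^ 15001 := by gcongr
      _ = _ := by rw [← pow_mul, Nat.cast_pow]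
  · have hempty : {ω : ℕ → ℝ | ¬ ∃ (s : RealRAM.State) (t : ℕ),
        RealRAM.Exec RealRAM.decompose
          (RealRAM.initState R (momentTensor (2 * l) A + Err) ε γ ω) s t ∧
        CloseUpToPermSign A (RealRAM.output s n R) ε} = ∅ := by
      rw [Set.eq_empty_iff_forall_notMem]
      intro ω hω
      obtain ⟨s, t, h1, -, h3⟩ := hrun ω
      exact hω ⟨s, t, h1, h3⟩
    rw [hempty, measure_empty]
    exact zero_le
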